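/- Let $\Omega=(0,2\pi)^2$, let $\dot L^2$ be the space of real $L^2(\Omega)$ functions with mean zero (extended $2\pi$-periodically in each direction), with norm $\|\cdot\|_2$, let $\dot H^1$ be the periodic mean-zero $H^1$ functions with norm $\|\varphi\|_{H^1}=\|\nabla\varphi\|_2$, and let $H^{-1}$ be its dual. Let $\nu>0$ and let $f\in\dot L^2$ be independent of time. Consider the two-dimensional Navier–Stokes equations $$\partial_t\omega+\nabla^\perp\psi\cdot\nabla\omega-\nu\Delta\omega=f,\qquad -\Delta\psi=\omega,$$ with $\nabla^\perp\psi=(\partial_y\psi,-\partial_x\psi)$, whose weak solutions $\omega\in C([0,\infty);\dot L^2)$ form a semigroup $S(t)$ on $\dot L^2$ with global attractor $\mathcal A=\mathcal A(\nu,f)$ (the compact set with $S(t)\mathcal A=\mathcal A$ for all $t\ge0$ that attracts all bounded sets), and, for a time step $\Delta t>0$, the scheme $$\frac{\omega^{n+1}-\omega^n}{\Delta t}+\nabla^\perp\psi^n\cdot\nabla\omega^n-\nu\Delta\omega^{n+1}=f,\qquad -\Delta\psi^n=\omega^n,\qquad \omega^n\in\dot L^2.$$ Put $$M_V:=\sup_{\omega\in\mathcal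 A}\bigl(\|\partial_{tt}\omega\|_{H^{-1}}^2+\|\omega\|_2^2\,\|\partial_t\omega\|_2^2\bigr),\qquad M_0:=\Bigl(\|\omega_0\|_2^2+\frac{2}{\nu^2}\|f\|_2^2\Bigr)^{1/2},$$ where the time derivatives are taken along the trajectories in $\mathcal A$. There are a number $k_0=k_0(\|\omega_0\|_2,\nu,\|f\|_2)>0$ and a constant $C(M_0,M_V;\nu)$, depending only on the quantities indicated, such that the following holds for all such $\nu$ and $f$ with $M_V<\infty$ and every $\omega_0\in\mathcal A$. Let $\omega$ be the solution of the Navier–Stokes equations with $\omega(0)=\omega_0$, and $(\omega^n)_{n\ge0}$ the solution of the scheme with $\omega^0=\omega_0$ and time step $\Delta t>0$. 1. If $\Delta t<k_0$, then $\|\omega^n\|_2\le M_0$ for all $n\ge0$. 2. If $\Delta t<k_0$, or more generally if $\Delta t>0$ is such that $\|\omega^n\|_2\le M_0$ for all $n\ge0$, then $$\|\omega^n-\omega(n\Delta t)\|_2^2\le \Delta t\;C(M_0,M_V;\nu)\qquad\text{for all } n\ge 0 \text{ with } n\Delta t\le1 .$$ -/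

import Mathlib

open MeasureTheory Set Filter Topology
open scoped ENNReal

namespace NSE2D

/-! ### Periodic functions on the square and weak derivatives -/

/-- The periodicity cell `Ω = (0, 2π) × (0, 2π)`. -/
def Omega : Set (ℝ × ℝ) := Ioo 0 (2 * Real.pi) ×ˢ Ioo 0 (2 * Real.pi)

/-- The real Hilbert space `L²(Ω)`. -/
abbrev L2 : Type := Lp ℝ 2 ((volume : Measure (ℝ × ℝ)).restrict Omega)

/-- Vanishing average: `g` belongs to the subspace of mean zero functions of `L²(Ω)`. -/
def MeanZero (g : L2) : Prop := ∫ p in Omega, g p = 0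

/-- Smooth test functions that are `2π`-periodic in each direction. -/
structure IsTest (φ : ℝ × ℝ → ℝ) : Prop where
  smooth : ContDiff ℝ ((⊤ : ℕ∞) : WithTop ℕ∞) φ
  periodic_x : Function.Periodic φ (2 * Real.pi, 0)
  periodic_y : Function.Periodic φ (0, 2 * Real.pi)

/-- `∂φ/∂x` for smooth `φ`. -/
noncomputable def dx (φ : ℝ × ℝ → ℝ) (p : ℝ × ℝ) : ℝ := fderiv ℝ φ p (1, 0)

/-- `∂φ/∂y` for smooth `φ`. -/
noncomputable def dy (φ : ℝ × ℝ → ℝ) (p : ℝ × ℝ) : ℝ := fderiv ℝ φ p (0, 1)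

/-- `Δφ` for smooth `φ`. -/
noncomputable def lap (φ : ℝ × ℝ → ℝ) (p : ℝ × ℝ) : ℝ := dx (dx φ) p + dy (dy φ) p

/-- The `L²` pairing `(g, φ) = ∫_Ω g φ`. -/
noncomputable def pair (g : L2) (φ : ℝ × ℝ → ℝ) : ℝ := ∫ p in Omega, g p * φ p

/-- `(ψ, ψx, ψy)` is the stream function of `ω` together with its weak gradient:
`ψ` is a mean zero function of the periodic space `H¹`, with weak partial derivatives `ψx`, `ψy`
in `L²`, and `-Δψ = ω` weakly. -/
structure IsStream (ω ψ ψx ψy : L2) : Prop where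
  meanZero : MeanZero ψ
  weak_dx : ∀ φ, IsTest φ → pair ψ (dx φ) = -pair ψx φ
  weak_dy : ∀ φ, IsTest φ → pair ψ (dy φ) = -pair ψy φ
  poisson : ∀ φ, IsTest φ → pair ψx (dx φ) + pair ψy (dy φ) = pair ω φ

/-- The distribution `∇^⊥ψ · ∇ω` tested against `φ`, where `∇^⊥ψ = (ψ_y, -ψ_x)` is the divergence
free velocity with vorticity `-Δψ = ω`: after integration by parts it is
`-∫_Ω ω (∇^⊥ψ · ∇φ)`. -/
noncomputable def advection (ω ψx ψy : L2) (φ : ℝ × ℝ → ℝ) : ℝ :=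
  -∫ p in Omega, ω p * (ψy p * dx φ p - ψx p * dy φ p)

/-! ### The Navier-Stokes equations and their global attractor -/

/-- `w` (restricted to `[0, ∞)`) is the mean zero weak solution, continuous in time with values in
`L²(Ω)`, of `∂ω/∂t + ∇^⊥ψ · ∇ω - ν Δω = f`, `-Δψ = ω`, with time-independent forcing `f`. -/
structure IsNSESolution (ν : ℝ) (f : L2) (w : ℝ → L2) : Prop where
  continuousOn : ContinuousOn w (Ici 0)
  meanZero : ∀ t, 0 ≤ t → MeanZero (w t)
  weak : ∃ ψ ψx ψy : ℝ → L2, (∀ t, 0 ≤ t → IsStream (w t) (ψ t) (ψx t) (ψy t)) ∧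
    ∀ φ, IsTest φ → ∀ t, 0 ≤ t →
      pair (w t) φ - pair (w 0) φ =
        ∫ s in (0 : ℝ)..t,
          (ν * pair (w s) (lap φ) - advection (w s) (ψx s) (ψy s) φ + pair f φ)

/-- `A` is the global attractor of the Navier-Stokes semigroup `S(t)` on the mean zero functions of
`L²(Ω)`: it is compact, `S(t) A = A` for all `t ≥ 0`, and it attracts all bounded sets,
uniformly on each of them. -/
structure IsGlobalAttractor (ν : ℝ) (f : L2) (A : Set L2) : Prop where
  meanZero : ∀ a ∈ A, MeanZero a
  isCompact : IsCompact A
  maps_into : ∀ w, IsNSESolution ν f w → w 0 ∈ A → ∀ t, 0 ≤ t → w t ∈ A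
  maps_onto : ∀ a ∈ A, ∀ t, 0 ≤ t → ∃ w, IsNSESolution ν f w ∧ w 0 ∈ A ∧ w t = a
  attracts : ∀ R ε : ℝ, 0 < ε → ∃ T : ℝ, 0 ≤ T ∧
    ∀ w, IsNSESolution ν f w → ‖w 0‖ ≤ R → ∀ t, T ≤ t → ∃ a ∈ A, dist (w t) a < ε

/-! ### Time derivatives along trajectories -/

/-- `‖∂ₜw(t)‖_{L²}`, with the time derivative taken in the sense of distributions on `Ω`;
it is `∞` when `w` has no time derivative in `L²(Ω)` at `t`. -/
noncomputable def normDt (w : ℝ → L2) (t : ℝ) : ℝ≥0∞ :=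
  ⨅ (g : L2) (_ : ∀ φ, IsTest φ → HasDerivAt (fun s => pair (w s) φ) (pair g φ) t), ‖g‖ₑ

/-- The norm, in the dual of the mean zero periodic `H¹` space normed by `‖∇φ‖_{L²}`, of a
functional `G` on test functions (possibly `∞`). -/
noncomputable def normHm1 (G : (ℝ × ℝ → ℝ) → ℝ) : ℝ≥0∞ :=
  ⨆ (φ : ℝ × ℝ → ℝ) (_ : IsTest φ) (_ : ∫ p in Omega, φ p = 0)
    (_ : ∫ p in Omega, (dx φ p ^ 2 + dy φ p ^ 2) ≤ 1), ENNReal.ofReal |G φ|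

/-- `‖∂ₜₜw(t)‖_{H⁻¹}`, with the time derivatives taken in the sense of distributions on `Ω`;
it is `∞` when the second derivative does not exist at `t` or is not in `H⁻¹`. -/
noncomputable def normDtt (w : ℝ → L2) (t : ℝ) : ℝ≥0∞ :=
  ⨅ (G : (ℝ × ℝ → ℝ) → ℝ)
    (_ : ∀ φ, IsTest φ → HasDerivAt (deriv fun s => pair (w s) φ) (G φ) t), normHm1 G

/-- `M_V = sup_{ω ∈ A} (‖∂ₜₜω‖²_{H⁻¹} + ‖ω‖²_{L²} ‖∂ₜω‖²_{L²})`, the time derivatives being those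
along the trajectories in `A`. Since `S(t) A = A`, the states `w t` with `t > 0`, `w 0 ∈ A`,
are exactly the points of `A`. -/
noncomputable def MV (ν : ℝ) (f : L2) (A : Set L2) : ℝ≥0∞ :=
  ⨆ (w : ℝ → L2) (_ : IsNSESolution ν f w) (_ : w 0 ∈ A) (t : ℝ) (_ : 0 < t),
    (normDtt w t ^ 2 + ‖w t‖ₑ ^ 2 * normDt w t ^ 2)

/-! ### The scheme -/

/-- `W 0, W 1, …` is a mean zero solution of the semi-implicit scheme
`(ω^{n+1} - ω^n) / Δt + ∇^⊥ψ^n · ∇ω^n - ν Δω^{n+1} = f`, `-Δψ^n = ω^n`,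
understood in the sense of distributions. -/
structure IsSchemeSolution (ν : ℝ) (f : L2) (Δt : ℝ) (W : ℕ → L2) : Prop where
  meanZero : ∀ n, MeanZero (W n)
  step : ∀ n, ∃ ψ ψx ψy : L2, IsStream (W n) ψ ψx ψy ∧ ∀ φ, IsTest φ →
    (pair (W (n + 1)) φ - pair (W n) φ) / Δt + advection (W n) ψx ψy φ
      - ν * pair (W (n + 1)) (lap φ) = pair f φ

/-- The stability bound `M₀² = ‖ω₀‖² + (2 c₀⁴ / ν²) ‖f‖²`; the Poincaré constant `c₀` in
`‖φ‖_{L²} ≤ c₀ ‖∇φ‖_{L²}` for mean zero periodic functions on `Ω` is `1`. Here `a` and `F` stand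
for `‖ω₀‖` and `‖f‖`. -/
noncomputable def M0 (a ν F : ℝ) : ℝ := Real.sqrt (a ^ 2 + 2 / ν ^ 2 * F ^ 2)

end NSE2D

/-! Everything is done with Fourier coefficients on `ℤ²` and trigonometric polynomials as test
functions. The transport form `∫ a ∇^⊥ψ · ∇φ`, with `-Δψ = b`, is bounded by `L²` norms of `a` and
`b` and the `H¹` norm of `φ`, provided one of the three factors is given an extra quarter
derivative: the velocity gains one derivative, and `∑ |k|^{-5/2}` converges in two dimensions. The
form also vanishes when `a = φ`.

On the attractor, `M_V < ∞` bounds `∂ₜₜω` in `H⁻¹`. A Taylor expansion over unit time bounds `∂ₜω`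
in `H⁻¹`, and elliptic regularity then bounds the attractor in `H¹` (`sob_four_le_of_mem`). At a
point of maximal norm on the compact attractor the energy balance gives `‖ω‖ ≤ ‖f‖/ν`
(`norm_le_of_mem`).

For the scheme, testing with the new state `W` replaces the explicit transport of `V` by that of `V
- W`. The `H^{1/4}` norm of `V - W` is interpolated between `L²`, absorbed by `‖V - W‖²`, and
`H^{1/2}`, absorbed by viscosity and by the `H^{1/2}` part of the discrete energy `stepEnergy`
(`stepEnergy_le`). The initial `H^{1/2}` norm may not enter the time step restriction, so the first
step is treated apart, from the `L²` norm of the initial state alone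
(`IsStep.stepEnergy_initial_le`); after it the energy stays below `M₀²`.

The error satisfies a step of the same form (`error_step`). Its consistency terms involve the time
increment of `ω`, whose squared `L²` norm is `O(Δt)`: it is `O(Δt)` in `H⁻¹` and bounded in `H¹`.
Each step thus adds `O(Δt²)`, and a discrete Gronwall argument sums this to `O(Δt)` on unit time.
Time steps too large for the energy method satisfy the estimate trivially, because both states are
bounded by `M₀`. -/

namespace NSE2D

/-! ### Fourier series on the cell, transferred from the unit torus -/

/-- Frequencies of the Fourier series on the periodicity cell. -/
abbrev Freq : Type := Fin 2 → ℤ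

/-- The phase `k · p`. -/
noncomputable def phase (k : Freq) (p : ℝ × ℝ) : ℝ := k 0 * p.1 + k 1 * p.2

/-- The exponential `e^{i k · p}`. -/
noncomputable def expo (k : Freq) (p : ℝ × ℝ) : ℂ := Complex.exp (phase k p * Complex.I)

/-- Lebesgue measure on the periodicity cell. -/
noncomputable abbrev cell : Measure (ℝ × ℝ) := (volume : Measure (ℝ × ℝ)).restrict Omega

/-- The Fourier coefficients, normalized so that Parseval's identity has constant one. -/
noncomputable def coeffC (F : ℝ × ℝ → ℂ) (k : Freq) : ℂ :=
  (2 * Real.pi : ℂ)⁻¹ * ∫ p in Omega, (starRingEnd ℂ) (expo k p) * F p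

-- Normalized Haar measure, against which Fourier coefficients on `UnitAddTorus` are taken; `h4`
-- below identifies it with the length measure of the circle of period one.
noncomputable local instance : MeasureSpace UnitAddCircle := ⟨AddCircle.haarAddCircle⟩

local instance : IsProbabilityMeasure (volume : Measure UnitAddCircle) :=
  inferInstanceAs (IsProbabilityMeasure AddCircle.haarAddCircle)

/-- The representative in `(0, 2π]` of a point of the unit circle. -/
noncomputable def circleRep (t : UnitAddCircle) : ℝ :=
  2 * Real.pi * (AddCircle.measurableEquivIoc 1 0 t : ℝ)

theorem measurePreserving_circleRep :
    MeasurePreserving circleRep (volume : Measure UnitAddCircle)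
      (ENNReal.ofReal (2 * Real.pi)⁻¹ • (volume : Measure ℝ).restrict (Ioo 0 (2 * Real.pi))) := by
  have hpi : (0 : ℝ) < 2 * Real.pi := by positivity
  have h1 := AddCircle.measurePreserving_equivIoc (T := 1) (a := 0)
  have h2 : MeasurePreserving (fun t : UnitAddCircle => (AddCircle.measurableEquivIoc 1 0 t : ℝ))
      (volume : Measure UnitAddCircle) ((volume : Measure ℝ).restrict (Ioc 0 1)) := by
    refine ⟨by fun_prop, ?_⟩
    have h3 : Measure.map (AddCircle.measurableEquivIoc (1 : ℝ) 0)
        (AddCircle.measureSpace 1).volume = _ := h1.map_eq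
    have h4 : (volume : Measure UnitAddCircle)
        = (AddCircle.measureSpace 1).volume := by
      simp [volume]
      rfl
    rw [h4, show (fun t : UnitAddCircle => (AddCircle.measurableEquivIoc 1 0 t : ℝ))
      = Subtype.val ∘ (AddCircle.measurableEquivIoc (1 : ℝ) 0) from rfl,
      ← Measure.map_map measurable_subtype_coe (by fun_prop), h3,
      map_comap_subtype_coe measurableSet_Ioc]
    simp
  have h5 : MeasurePreserving (fun x : ℝ => 2 * Real.pi * x)
      ((volume : Measure ℝ).restrict (Ioc 0 1))
      (ENNReal.ofReal (2 * Real.pi)⁻¹ • (volume : Measure ℝ).restrict (Ioo 0 (2 * Real.pi))) := by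
    refine ⟨by fun_prop, ?_⟩
    have h6 : (Ioc 0 1 : Set ℝ) = (fun x : ℝ => 2 * Real.pi * x) ⁻¹' (Ioc 0 (2 * Real.pi)) := by
      ext x
      simp only [mem_Ioc, mem_preimage]
      constructor
      · rintro ⟨h, h'⟩; constructor
        · positivity
        · nlinarith
      · rintro ⟨h, h'⟩; constructor
        · exact (mul_pos_iff_of_pos_left hpi).1 h
        · nlinarith
    rw [h6, ← Measure.restrict_map (by fun_prop) measurableSet_Ioc,
      Real.map_volume_mul_left hpi.ne', Measure.restrict_smul, abs_of_pos (by positivity),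
      Measure.restrict_congr_set (Ioo_ae_eq_Ioc (α := ℝ))]
  exact h5.comp h2

/-- The representative in `(0, 2π]²` of a point of the unit torus. -/
noncomputable def torusRep (t : UnitAddTorus (Fin 2)) : ℝ × ℝ := (circleRep (t 0), circleRep (t 1))

/-- The bridge through which Parseval's identity and orthogonality are pulled back from the torus;
the factor `(2π)⁻²` is what the normalization of `coeffC` compensates. -/
theorem measurePreserving_torusRep :
    MeasurePreserving torusRep volume (ENNReal.ofReal ((2 * Real.pi) ^ 2)⁻¹ • cell) := by
  have hpi : (0 : ℝ) < 2 * Real.pi := by positivity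
  have h := measurePreserving_circleRep
  have : IsFiniteMeasure
      (ENNReal.ofReal (2 * Real.pi)⁻¹ • (volume : Measure ℝ).restrict (Ioo 0 (2 * Real.pi))) :=
    Measure.smul_finite _ ENNReal.ofReal_ne_top
  have h1 := measurePreserving_pi (fun _ : Fin 2 => (volume : Measure UnitAddCircle)) _ (fun _ => h)
  have h2 := (measurePreserving_finTwoArrow _).comp h1
  refine ⟨h2.measurable, Eq.trans h2.map_eq ?_⟩
  rw [Measure.prod_smul_left, Measure.prod_smul_right, Measure.prod_restrict, smul_smul,
    ← ENNReal.ofReal_mul (by positivity)]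
  congr 2
  ring

theorem expo_torusRep (k : Freq) (t : UnitAddTorus (Fin 2)) :
    expo k (torusRep t) = UnitAddTorus.mFourier k t := by
  have h : ∀ (n : ℤ) (s : UnitAddCircle),
      (fourier n s : ℂ) = Complex.exp ((n : ℂ) * circleRep s * Complex.I) := by
    intro n s
    have hs : ((AddCircle.measurableEquivIoc 1 0 s : ℝ) : UnitAddCircle) = s :=
      (AddCircle.measurableEquivIoc 1 0).symm_apply_apply s
    conv_lhs => rw [← hs]
    rw [fourier_coe_apply, circleRep]
    congr 1
    push_cast
    ring
  rw [expo, UnitAddTorus.mFourier, ContinuousMap.coe_mk, Fin.prod_univ_two, h, h, ← Complex.exp_add,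
    phase, torusRep]
  congr 1
  push_cast
  ring

theorem integral_torusRep {F : ℝ × ℝ → ℂ} (hF : AEStronglyMeasurable F cell) :
    ∫ t, F (torusRep t) = ((2 * Real.pi : ℂ) ^ 2)⁻¹ * ∫ p in Omega, F p := by
  have h := measurePreserving_torusRep
  have h1 : AEStronglyMeasurable F (Measure.map torusRep volume) := by
    rw [h.map_eq]; exact hF.smul_measure _
  rw [← integral_map h.measurable.aemeasurable h1, h.map_eq, integral_smul_measure,
    ENNReal.toReal_ofReal (by positivity), Complex.real_smul]
  push_cast
  rfl

theorem continuous_expo (k : Freq) : Continuous (expo k) := by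
  unfold expo phase; fun_prop

theorem norm_expo (k : Freq) (p : ℝ × ℝ) : ‖expo k p‖ = 1 := by
  rw [expo, Complex.norm_exp_ofReal_mul_I]

theorem coeffC_eq {F : ℝ × ℝ → ℂ} (hF : AEStronglyMeasurable F cell) (k : Freq) :
    UnitAddTorus.mFourierCoeff (F ∘ torusRep) k = (2 * Real.pi : ℂ)⁻¹ * coeffC F k := by
  have h : ∀ t, UnitAddTorus.mFourier (-k) t • (F ∘ torusRep) t
      = (fun p => (starRingEnd ℂ) (expo k p) * F p) (torusRep t) := by
    intro t
    simp only [Function.comp, smul_eq_mul, UnitAddTorus.mFourier_neg, expo_torusRep]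
  have hm : AEStronglyMeasurable (fun p => (starRingEnd ℂ) (expo k p) * F p) cell :=
    ((Complex.continuous_conj.comp (continuous_expo k)).aestronglyMeasurable).mul hF
  rw [UnitAddTorus.mFourierCoeff]
  simp_rw [h]
  rw [integral_torusRep hm, coeffC]
  ring

/-- Parseval's identity for complex square integrable functions on the cell. -/
theorem hasSum_conj_coeffC_mul {F H : ℝ × ℝ → ℂ} (hF : MemLp F 2 cell) (hH : MemLp H 2 cell) :
    HasSum (fun k => (starRingEnd ℂ) (coeffC F k) * coeffC H k)
      (∫ p in Omega, (starRingEnd ℂ) (F p) * H p) := by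
  have hpi : (2 * Real.pi : ℂ) ≠ 0 := by
    exact_mod_cast (by positivity : (2 * Real.pi : ℝ) ≠ 0)
  have hmp := measurePreserving_torusRep
  have lift : ∀ {G : ℝ × ℝ → ℂ}, MemLp G 2 cell → MemLp (G ∘ torusRep) 2 volume := by
    intro G hG
    exact (hG.smul_measure ENNReal.ofReal_ne_top).comp_measurePreserving hmp
  have hco : ∀ {G : ℝ × ℝ → ℂ} (hG : MemLp G 2 cell) (k : Freq),
      UnitAddTorus.mFourierCoeff ((lift hG).toLp _) k = (2 * Real.pi : ℂ)⁻¹ * coeffC G k := by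
    intro G hG k
    rw [← coeffC_eq hG.1]
    refine integral_congr_ae ?_
    filter_upwards [(lift hG).coeFn_toLp] with t ht
    rw [ht]
  have h := UnitAddTorus.hasSum_prod_mFourierCoeff ((lift hF).toLp _) ((lift hH).toLp _)
  have hint : ∫ t, (starRingEnd ℂ) ((lift hF).toLp _ t) * (lift hH).toLp _ t
      = ((2 * Real.pi : ℂ) ^ 2)⁻¹ * ∫ p in Omega, (starRingEnd ℂ) (F p) * H p := by
    rw [← integral_torusRep (F := fun p => (starRingEnd ℂ) (F p) * H p)
      ((Complex.continuous_conj.comp_aestronglyMeasurable hF.1).mul hH.1)]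
    refine integral_congr_ae ?_
    filter_upwards [(lift hF).coeFn_toLp, (lift hH).coeFn_toLp] with t ht ht'
    rw [ht, ht']; rfl
  rw [hint] at h
  have h2 := h.mul_left ((2 * Real.pi : ℂ) ^ 2)
  rw [mul_inv_cancel_left₀ (pow_ne_zero 2 hpi)] at h2
  refine h2.congr_fun (fun k => ?_)
  rw [hco hF, hco hH]
  have hc : (starRingEnd ℂ) (2 * Real.pi : ℂ)⁻¹ = (2 * Real.pi : ℂ)⁻¹ := by
    rw [show (2 * Real.pi : ℂ)⁻¹ = (((2 * Real.pi)⁻¹ : ℝ) : ℂ) by push_cast; rfl, Complex.conj_ofReal]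
  rw [map_mul, hc]
  field_simp

theorem integral_expo (k : Freq) :
    ∫ p in Omega, expo k p = if k = 0 then (2 * Real.pi : ℂ) ^ 2 else 0 := by
  have hpi : (2 * Real.pi : ℂ) ≠ 0 := by
    exact_mod_cast (by positivity : (2 * Real.pi : ℝ) ≠ 0)
  have h := integral_torusRep (continuous_expo k).aestronglyMeasurable
  have h2 := orthonormal_iff_ite.1 (UnitAddTorus.orthonormal_mFourier (d := Fin 2)) 0 k
  rw [ContinuousMap.inner_toLp] at h2
  simp only [UnitAddTorus.mFourier_zero, ContinuousMap.one_apply, map_one, mul_one] at h2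
  simp_rw [expo_torusRep] at h
  rw [h2] at h
  by_cases hk : k = 0
  · subst hk
    simp only [↓reduceIte] at h ⊢
    field_simp at h
    rw [mul_pow]; exact h.symm
  · rw [if_neg (fun h => hk h.symm)] at h
    rw [if_neg hk]
    simpa [hpi] using h.symm

/-! ### Lattice weights and a trilinear convolution bound -/

/-- `max 1 |k|²`. -/
noncomputable def freqSq (k : Freq) : ℝ := max 1 ((k 0 : ℝ) ^ 2 + (k 1 : ℝ) ^ 2)

/-- The weight `|k|^{1/2}` (equal to `1` at `k = 0`). -/
noncomputable def wt (k : Freq) : ℝ := √(√(freqSq k))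

theorem one_le_freqSq (k : Freq) : 1 ≤ freqSq k := le_max_left _ _

theorem one_le_wt (k : Freq) : 1 ≤ wt k :=
  Real.one_le_sqrt.2 (Real.one_le_sqrt.2 (one_le_freqSq k))

theorem wt_pos (k : Freq) : 0 < wt k := one_pos.trans_le (one_le_wt k)

theorem wt_sq (k : Freq) : wt k ^ 2 = √(freqSq k) := Real.sq_sqrt (Real.sqrt_nonneg _)

theorem wt_pow_four (k : Freq) : wt k ^ 4 = freqSq k := by
  rw [show 4 = 2 * 2 from rfl, pow_mul, wt_sq, Real.sq_sqrt (one_pos.trans_le (one_le_freqSq k)).le]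

theorem wt_neg (k : Freq) : wt (-k) = wt k := by simp [wt, freqSq]

theorem freqSq_of_ne_zero {k : Freq} (hk : k ≠ 0) :
    freqSq k = (k 0 : ℝ) ^ 2 + (k 1 : ℝ) ^ 2 := by
  refine max_eq_right ?_
  have h : 1 ≤ (k 0) ^ 2 + (k 1) ^ 2 := by
    by_contra h
    have h0 : k 0 ^ 2 = 0 := by nlinarith [sq_nonneg (k 0), sq_nonneg (k 1)]
    have h1 : k 1 ^ 2 = 0 := by nlinarith [sq_nonneg (k 0), sq_nonneg (k 1)]
    refine hk (funext fun i => ?_)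
    fin_cases i
    · exact pow_eq_zero_iff two_ne_zero |>.1 h0
    · exact pow_eq_zero_iff two_ne_zero |>.1 h1
  exact_mod_cast h

theorem abs_apply_le_wt_sq (k : Freq) (i : Fin 2) : |(k i : ℝ)| ≤ wt k ^ 2 := by
  rw [wt_sq]
  refine Real.abs_le_sqrt (le_trans ?_ (le_max_right _ _))
  fin_cases i <;> simp <;> positivity

/-- The terms are at most `|k|^{-5/2}` in the sup norm, and `5/2 > 2`. Of this exponent, `2` comes
from the squared gain of the velocity and `1/2` from the extra quarter derivative. -/
theorem summable_wt_pow_neg : Summable fun k : Freq => (wt k ^ 5)⁻¹ := by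
  have h : Summable fun x : Freq => ‖x‖ ^ (-(5 / 2 : ℝ)) :=
    EisensteinSeries.summable_one_div_norm_rpow (by norm_num)
  refine (h.add (hasSum_ite_eq (0 : Freq) (1 : ℝ)).summable).of_nonneg_of_le
    (fun k => by have := wt_pos k; positivity) (fun k => ?_)
  by_cases hk : k = 0
  · subst hk
    have : (wt 0 ^ 5)⁻¹ ≤ 1 := inv_le_one_of_one_le₀ (one_le_pow₀ (one_le_wt 0))
    simp only [↓reduceIte]
    have h0 : (0 : ℝ) ≤ ‖(0 : Freq)‖ ^ (-(5 / 2 : ℝ)) := by positivity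
    linarith
  · simp only [hk, ↓reduceIte, add_zero]
    have hn : 0 < ‖k‖ := norm_pos_iff.2 hk
    have h1 : ‖k‖ ≤ wt k ^ 2 := by
      refine (pi_norm_le_iff_of_nonneg (by positivity)).2 (fun i => ?_)
      rw [Int.norm_eq_abs]
      exact abs_apply_le_wt_sq k i
    rw [Real.rpow_neg hn.le]
    refine inv_anti₀ (by positivity) ?_
    calc ‖k‖ ^ (5 / 2 : ℝ) ≤ (wt k ^ 2) ^ (5 / 2 : ℝ) := by gcongr
      _ = wt k ^ 5 := by
        rw [← Real.rpow_natCast, ← Real.rpow_natCast, ← Real.rpow_mul (wt_pos k).le]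
        norm_num

theorem tsum_mul_sq_le {ι : Type*} (F G : ι → ℝ≥0∞) :
    (∑' i, F i * G i) ^ 2 ≤ (∑' i, F i ^ 2) * ∑' i, G i ^ 2 := by
  let _ : MeasurableSpace ι := ⊤
  have h := ENNReal.lintegral_mul_le_Lp_mul_Lq (Measure.count : Measure ι)
    Real.HolderConjugate.two_two (f := F) (g := G) (by fun_prop) (by fun_prop)
  simp only [Pi.mul_apply, lintegral_count] at h
  calc (∑' i, F i * G i) ^ 2
      ≤ ((∑' i, F i ^ (2 : ℝ)) ^ (1 / 2 : ℝ) * (∑' i, G i ^ (2 : ℝ)) ^ (1 / 2 : ℝ)) ^ 2 := by gcongr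
    _ = _ := by
      rw [mul_pow, ← ENNReal.rpow_natCast, ← ENNReal.rpow_natCast, ← ENNReal.rpow_mul,
        ← ENNReal.rpow_mul]
      norm_num

/-- Cauchy-Schwarz bound for a weighted trilinear convolution sum. -/
theorem tsum_convolution_sq_le (h f g u v : Freq → ℝ≥0∞) {D : ℝ≥0∞}
    (hD : ∀ k, ∑' l, u l ^ 2 * v (l - k) ^ 2 ≤ D) :
    (∑' k, ∑' l, h k * (u l * f l) * (v (l - k) * g (l - k))) ^ 2
      ≤ D * (∑' k, h k ^ 2) * (∑' k, f k ^ 2) * ∑' k, g k ^ 2 := by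
  rw [← ENNReal.tsum_prod (f := fun k l => h k * (u l * f l) * (v (l - k) * g (l - k)))]
  -- The grouping is what makes Cauchy-Schwarz work: `f(l) g(l - k)` has a square sum that
  -- factorizes, and all weights go with `h(k)`, where the sum over `l` is at most `D`.
  have h1 : ∀ x : Freq × Freq, h x.1 * (u x.2 * f x.2) * (v (x.2 - x.1) * g (x.2 - x.1))
      = (f x.2 * g (x.2 - x.1)) * (h x.1 * (u x.2 * v (x.2 - x.1))) := fun x => by ring
  simp_rw [h1]
  refine (tsum_mul_sq_le _ _).trans ?_
  have h2 : ∑' x : Freq × Freq, (f x.2 * g (x.2 - x.1)) ^ 2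
      = (∑' k, f k ^ 2) * ∑' k, g k ^ 2 := by
    rw [ENNReal.tsum_prod (f := fun k l => (f l * g (l - k)) ^ 2), ENNReal.tsum_comm,
      ← ENNReal.tsum_mul_right]
    refine tsum_congr fun l => ?_
    simp_rw [mul_pow]
    rw [ENNReal.tsum_mul_left]
    congr 1
    exact (Equiv.subLeft l).tsum_eq (fun k => g k ^ 2)
  have h3 : ∑' x : Freq × Freq, (h x.1 * (u x.2 * v (x.2 - x.1))) ^ 2
      ≤ D * ∑' k, h k ^ 2 := by
    rw [ENNReal.tsum_prod (f := fun k l => (h k * (u l * v (l - k))) ^ 2), ← ENNReal.tsum_mul_left]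
    refine ENNReal.tsum_le_tsum fun k => ?_
    simp_rw [mul_pow]
    rw [ENNReal.tsum_mul_left, mul_comm]
    gcongr
    exact hD k
  rw [h2]
  refine (mul_le_mul_right h3 _).trans_eq (by ring)

/-- The lattice constant `2 ∑ |k|^{-5/2}`. -/
noncomputable def latticeConst : ℝ := 2 * ∑' k : Freq, (wt k ^ 5)⁻¹

theorem tsum_sub_right (f : Freq → ℝ≥0∞) (k : Freq) : ∑' l, f (l - k) = ∑' l, f l :=
  (Equiv.subRight k).tsum_eq f

theorem tsum_ofReal_wt_pow_neg :
    ∑' k : Freq, ENNReal.ofReal (wt k ^ 5)⁻¹ = ENNReal.ofReal (∑' k : Freq, (wt k ^ 5)⁻¹) :=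
  (ENNReal.ofReal_tsum_of_nonneg (fun k => by have := wt_pos k; positivity)
    summable_wt_pow_neg).symm

theorem latticeConst_nonneg : 0 ≤ latticeConst :=
  mul_nonneg zero_le_two (tsum_nonneg fun k => by have := wt_pos k; positivity)

/-- The squared weights have total degree five in `wt`. Replacing the larger of the two by the
smaller bounds each term by one of two summable fifth powers. -/
theorem tsum_wt_mul_wt_le (k : Freq) :
    ∑' l, ENNReal.ofReal (√(wt l))⁻¹ ^ 2 * ENNReal.ofReal (wt (l - k) ^ 2)⁻¹ ^ 2
      ≤ ENNReal.ofReal latticeConst := by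
  have h : ∀ l, ENNReal.ofReal (√(wt l))⁻¹ ^ 2 * ENNReal.ofReal (wt (l - k) ^ 2)⁻¹ ^ 2
      ≤ ENNReal.ofReal (wt l ^ 5)⁻¹ + ENNReal.ofReal (wt (l - k) ^ 5)⁻¹ := by
    intro l
    have hl := wt_pos l
    have hm := wt_pos (l - k)
    rw [← ENNReal.ofReal_pow (by positivity), ← ENNReal.ofReal_pow (by positivity),
      ← ENNReal.ofReal_mul (by positivity), ← ENNReal.ofReal_add (by positivity) (by positivity)]
    refine ENNReal.ofReal_le_ofReal ?_
    rw [inv_pow, Real.sq_sqrt hl.le, inv_pow, ← pow_mul, ← mul_inv]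
    rcases le_total (wt l) (wt (l - k)) with h | h
    · have : (wt l * wt (l - k) ^ (2 * 2))⁻¹ ≤ (wt l ^ 5)⁻¹ := by
        refine inv_anti₀ (by positivity) ?_
        calc wt l ^ 5 = wt l * wt l ^ (2 * 2) := by ring
          _ ≤ _ := by gcongr
      have h' : 0 ≤ (wt (l - k) ^ 5)⁻¹ := by positivity
      linarith
    · have : (wt l * wt (l - k) ^ (2 * 2))⁻¹ ≤ (wt (l - k) ^ 5)⁻¹ := by
        refine inv_anti₀ (by positivity) ?_
        calc wt (l - k) ^ 5 = wt (l - k) * wt (l - k) ^ (2 * 2) := by ring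
          _ ≤ _ := by gcongr
      have h' : 0 ≤ (wt l ^ 5)⁻¹ := by positivity
      linarith
  refine (ENNReal.tsum_le_tsum h).trans_eq ?_
  rw [ENNReal.tsum_add, tsum_sub_right (fun l => ENNReal.ofReal (wt l ^ 5)⁻¹),
    tsum_ofReal_wt_pow_neg, latticeConst, ← ENNReal.ofReal_add, two_mul] <;>
  exact tsum_nonneg fun k => by have := wt_pos k; positivity

theorem tsum_wt_le (k : Freq) :
    ∑' l : Freq, (1 : ℝ≥0∞) ^ 2 * ENNReal.ofReal (wt (l - k) ^ 2 * √(wt (l - k)))⁻¹ ^ 2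
      ≤ ENNReal.ofReal latticeConst := by
  have h : ∀ l, (1 : ℝ≥0∞) ^ 2 * ENNReal.ofReal (wt (l - k) ^ 2 * √(wt (l - k)))⁻¹ ^ 2
      = ENNReal.ofReal (wt (l - k) ^ 5)⁻¹ := by
    intro l
    have hm := wt_pos (l - k)
    rw [← ENNReal.ofReal_pow (by positivity), one_pow, one_mul, inv_pow, mul_pow,
      Real.sq_sqrt hm.le]
    congr 2
    ring
  simp_rw [h]
  rw [tsum_sub_right (fun l => ENNReal.ofReal (wt l ^ 5)⁻¹), tsum_ofReal_wt_pow_neg]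
  refine ENNReal.ofReal_le_ofReal ?_
  have : 0 ≤ ∑' k : Freq, (wt k ^ 5)⁻¹ := tsum_nonneg fun k => by have := wt_pos k; positivity
  rw [latticeConst]; linarith

/-! ### Fourier coefficients of real square integrable functions -/

instance : IsFiniteMeasure cell := by
  refine ⟨?_⟩
  rw [Measure.restrict_apply_univ, Omega, Measure.volume_eq_prod, Measure.prod_prod]
  simp [ENNReal.mul_lt_top_iff]

/-- Fourier coefficients of an element of `L²(Ω)`. -/
noncomputable def coeff (g : L2) (k : Freq) : ℂ := coeffC (fun p => (g p : ℂ)) k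

theorem memLp_ofReal (g : L2) : MemLp (fun p => (g p : ℂ)) 2 cell := (Lp.memLp g).ofReal

theorem hasSum_conj_coeff_mul (a b : L2) :
    HasSum (fun k => ((starRingEnd ℂ) (coeff a k) * coeff b k).re) (inner ℝ a b) := by
  have h := (hasSum_conj_coeffC_mul (memLp_ofReal a) (memLp_ofReal b)).mapL Complex.reCLM
  have e : Complex.reCLM (∫ p in Omega, (starRingEnd ℂ) (a p : ℂ) * (b p : ℂ)) = inner ℝ a b := by
    rw [L2.inner_def]
    simp only [Complex.conj_ofReal, ← Complex.ofReal_mul]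
    rw [integral_complex_ofReal, Complex.reCLM_apply, Complex.ofReal_re]
    refine integral_congr_ae (ae_of_all _ fun p => ?_)
    simp [mul_comm]
  rw [e] at h
  exact h

theorem hasSum_norm_coeff_sq (g : L2) : HasSum (fun k => ‖coeff g k‖ ^ 2) (‖g‖ ^ 2) := by
  have h := hasSum_conj_coeff_mul g g
  rw [real_inner_self_eq_norm_sq] at h
  refine h.congr_fun fun k => ?_
  rw [← Complex.normSq_eq_conj_mul_self, Complex.ofReal_re, Complex.normSq_eq_norm_sq]

theorem integrable_mul_of_continuous {F : ℝ × ℝ → ℂ} (hF : MemLp F 2 cell) {e : ℝ × ℝ → ℂ}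
    (he : Continuous e) {B : ℝ} (hB : ∀ p, ‖e p‖ ≤ B) : Integrable (fun p => e p * F p) cell :=
  (hF.integrable (by norm_num)).bdd_mul he.aestronglyMeasurable (ae_of_all _ hB)

theorem coeffC_sub {F H : ℝ × ℝ → ℂ} (hF : MemLp F 2 cell) (hH : MemLp H 2 cell) (k : Freq) :
    coeffC (fun p => F p - H p) k = coeffC F k - coeffC H k := by
  have hc : Continuous fun p => (starRingEnd ℂ) (expo k p) :=
    Complex.continuous_conj.comp (continuous_expo k)
  have hb : ∀ p, ‖(starRingEnd ℂ) (expo k p)‖ ≤ 1 := fun p => by simp [norm_expo]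
  rw [coeffC, coeffC, coeffC, ← mul_sub, ← integral_sub (integrable_mul_of_continuous hF hc hb)
    (integrable_mul_of_continuous hH hc hb)]
  simp_rw [mul_sub]

theorem coeff_sub (a b : L2) (k : Freq) : coeff (a - b) k = coeff a k - coeff b k := by
  rw [coeff, coeff, coeff, ← coeffC_sub (memLp_ofReal a) (memLp_ofReal b), coeffC, coeffC]
  congr 1
  refine integral_congr_ae ?_
  filter_upwards [Lp.coeFn_sub a b] with p hp
  rw [hp]; simp

theorem expo_zero (p : ℝ × ℝ) : expo 0 p = 1 := by simp [expo, phase]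

theorem MeanZero.coeff_zero {g : L2} (hg : MeanZero g) : coeff g 0 = 0 := by
  rw [coeff, coeffC]
  simp only [expo_zero, map_one, one_mul]
  rw [integral_complex_ofReal, show ∫ p in Omega, g p = 0 from hg]
  simp

theorem expo_neg (k : Freq) (p : ℝ × ℝ) : expo (-k) p = (starRingEnd ℂ) (expo k p) := by
  rw [expo, expo, ← Complex.exp_conj]
  congr 1
  simp [phase]
  ring

theorem expo_add (k l : Freq) (p : ℝ × ℝ) : expo (k + l) p = expo k p * expo l p := by
  rw [expo, expo, expo, ← Complex.exp_add]
  congr 1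
  simp [phase]
  ring

theorem coeff_neg (g : L2) (k : Freq) : coeff g (-k) = (starRingEnd ℂ) (coeff g k) := by
  rw [coeff, coeffC, coeff, coeffC, map_mul, ← integral_conj]
  congr 1
  · rw [show (2 * Real.pi : ℂ)⁻¹ = (((2 * Real.pi)⁻¹ : ℝ) : ℂ) by push_cast; rfl,
      Complex.conj_ofReal]
  · simp [expo_neg]

theorem conj_coeff (g : L2) (k : Freq) :
    (starRingEnd ℂ) (coeff g k) = (2 * Real.pi : ℂ)⁻¹ * ∫ p in Omega, expo k p * g p := by
  rw [← coeff_neg, coeff, coeffC]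
  simp [expo_neg]

/-! ### Trigonometric polynomials as test functions -/

/-- The trigonometric polynomial with coefficients `z k`, `k ∈ S`. -/
noncomputable def trig (S : Finset Freq) (z : Freq → ℂ) (p : ℝ × ℝ) : ℝ :=
  (2 * Real.pi)⁻¹ * ∑ k ∈ S, (z k * expo k p).re

theorem contDiff_expo (k : Freq) : ContDiff ℝ ((⊤ : ℕ∞) : WithTop ℕ∞) (expo k) := by
  unfold expo phase
  refine ContDiff.cexp (ContDiff.mul ?_ contDiff_const)
  exact Complex.ofRealCLM.contDiff.comp
    ((contDiff_const.mul contDiff_fst).add (contDiff_const.mul contDiff_snd))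

theorem contDiff_trig (S : Finset Freq) (z : Freq → ℂ) :
    ContDiff ℝ ((⊤ : ℕ∞) : WithTop ℕ∞) (trig S z) := by
  unfold trig
  refine contDiff_const.mul (ContDiff.sum fun k _ => ?_)
  exact Complex.reCLM.contDiff.comp (contDiff_const.mul (contDiff_expo k))

theorem expo_periodic_x (k : Freq) : Function.Periodic (expo k) (2 * Real.pi, 0) := by
  intro p
  have h : ((phase k (p + (2 * Real.pi, 0)) : ℝ) : ℂ) * Complex.I
      = phase k p * Complex.I + (k 0) * (2 * Real.pi * Complex.I) := by
    simp [phase]; ring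
  rw [expo, h, Complex.exp_add, Complex.exp_int_mul_two_pi_mul_I, mul_one, expo]

theorem expo_periodic_y (k : Freq) : Function.Periodic (expo k) (0, 2 * Real.pi) := by
  intro p
  have h : ((phase k (p + (0, 2 * Real.pi)) : ℝ) : ℂ) * Complex.I
      = phase k p * Complex.I + (k 1) * (2 * Real.pi * Complex.I) := by
    simp [phase]; ring
  rw [expo, h, Complex.exp_add, Complex.exp_int_mul_two_pi_mul_I, mul_one, expo]

theorem isTest_trig (S : Finset Freq) (z : Freq → ℂ) : IsTest (trig S z) where
  smooth := contDiff_trig S z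
  periodic_x p := by simp only [trig, expo_periodic_x _ p]
  periodic_y p := by simp only [trig, expo_periodic_y _ p]

theorem continuous_trig (S : Finset Freq) (z : Freq → ℂ) : Continuous (trig S z) :=
  (contDiff_trig S z).continuous

theorem hasFDerivAt_expo (k : Freq) (p : ℝ × ℝ) :
    HasFDerivAt (expo k) (((k 0 : ℝ) • ContinuousLinearMap.fst ℝ ℝ ℝ
      + (k 1 : ℝ) • ContinuousLinearMap.snd ℝ ℝ ℝ).smulRight (Complex.I * expo k p)) p := by
  have h1 : HasFDerivAt (phase k) ((k 0 : ℝ) • ContinuousLinearMap.fst ℝ ℝ ℝ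
      + (k 1 : ℝ) • ContinuousLinearMap.snd ℝ ℝ ℝ) p := by
    unfold phase
    exact (hasFDerivAt_fst.const_mul _).add (hasFDerivAt_snd.const_mul _)
  have h2 : HasDerivAt (fun t : ℝ => Complex.exp (t * Complex.I))
      (Complex.I * expo k p) (phase k p) := by
    have := ((Complex.ofRealCLM.hasDerivAt (x := phase k p)).mul_const Complex.I).cexp
    simpa [expo, mul_comm] using this
  refine (h2.hasFDerivAt.comp p h1).congr_fderiv ?_
  ext <;> simp

theorem fderiv_trig_apply (S : Finset Freq) (z : Freq → ℂ) (p v : ℝ × ℝ) :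
    fderiv ℝ (trig S z) p v
      = trig S (fun k => Complex.I * ((k 0 : ℝ) * v.1 + (k 1 : ℝ) * v.2 : ℝ) * z k) p := by
  have h : ∀ k, HasFDerivAt (fun p => (z k * expo k p).re)
      (Complex.reCLM.comp (z k • (((k 0 : ℝ) • ContinuousLinearMap.fst ℝ ℝ ℝ
      + (k 1 : ℝ) • ContinuousLinearMap.snd ℝ ℝ ℝ).smulRight (Complex.I * expo k p)))) p :=
    fun k => Complex.reCLM.hasFDerivAt.comp p ((hasFDerivAt_expo k p).const_mul (z k))
  have h2 := (HasFDerivAt.fun_sum (u := S) fun k _ => h k).const_mul (2 * Real.pi)⁻¹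
  rw [show trig S z = fun p => (2 * Real.pi)⁻¹ * ∑ k ∈ S, (z k * expo k p).re from rfl, h2.fderiv]
  simp only [trig, _root_.smul_apply, _root_.sum_apply, smul_eq_mul]
  congr 1
  refine Finset.sum_congr rfl fun k _ => ?_
  simp only [ContinuousLinearMap.comp_apply, _root_.smul_apply,
    ContinuousLinearMap.smulRight_apply, _root_.add_apply, Complex.reCLM_apply,
    ContinuousLinearMap.coe_fst', ContinuousLinearMap.coe_snd', smul_eq_mul, Complex.real_smul]
  congr 1
  ring

theorem dx_trig (S : Finset Freq) (z : Freq → ℂ) :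
    dx (trig S z) = trig S (fun k => Complex.I * (k 0 : ℝ) * z k) := by
  funext p
  rw [dx, fderiv_trig_apply]
  simp

theorem dy_trig (S : Finset Freq) (z : Freq → ℂ) :
    dy (trig S z) = trig S (fun k => Complex.I * (k 1 : ℝ) * z k) := by
  funext p
  rw [dy, fderiv_trig_apply]
  simp

/-- Frequency zero is excluded because `wt 0 = 1`, whereas the Laplacian annihilates constants. -/
theorem lap_trig {S : Finset Freq} (hS : 0 ∉ S) (z : Freq → ℂ) :
    lap (trig S z) = trig S (fun k => -((wt k ^ 4 : ℝ) : ℂ) * z k) := by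
  funext p
  rw [lap, dx_trig, dx_trig, dy_trig, dy_trig, trig, trig, trig, ← mul_add, ← Finset.sum_add_distrib]
  congr 1
  refine Finset.sum_congr rfl fun k hk => ?_
  rw [wt_pow_four, freqSq_of_ne_zero (fun h => hS (h ▸ hk)), ← Complex.add_re]
  congr 1
  push_cast
  linear_combination (((k 0 : ℂ)) ^ 2 + (k 1 : ℂ) ^ 2) * z k * expo k p * Complex.I_sq

theorem abs_trig_le (S : Finset Freq) (z : Freq → ℂ) (p : ℝ × ℝ) :
    |trig S z p| ≤ (2 * Real.pi)⁻¹ * ∑ k ∈ S, ‖z k‖ := by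
  rw [trig, abs_mul, abs_of_pos (by positivity)]
  gcongr
  refine (Finset.abs_sum_le_sum_abs _ _).trans (Finset.sum_le_sum fun k _ => ?_)
  refine (Complex.abs_re_le_norm _).trans ?_
  rw [norm_mul, norm_expo, mul_one]

theorem integral_mul_trig {g : ℝ × ℝ → ℝ} (hg : Integrable g cell) (S : Finset Freq) (z : Freq → ℂ) :
    ∫ p in Omega, g p * trig S z p
      = ∑ k ∈ S, (z k * ((2 * Real.pi : ℂ)⁻¹ * ∫ p in Omega, expo k p * g p)).re := by
  have hi : ∀ k, Integrable (fun p => expo k p * (g p : ℂ)) cell := fun k =>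
    hg.ofReal.bdd_mul (continuous_expo k).aestronglyMeasurable
      (ae_of_all _ fun p => (norm_expo k p).le)
  have h1 : ∀ p, g p * trig S z p
      = ∑ k ∈ S, ((2 * Real.pi : ℂ)⁻¹ * z k * (expo k p * g p)).re := by
    intro p
    rw [trig, ← mul_assoc, Finset.mul_sum]
    refine Finset.sum_congr rfl fun k _ => ?_
    rw [show (2 * Real.pi : ℂ)⁻¹ * z k * (expo k p * g p)
      = ((g p * (2 * Real.pi)⁻¹ : ℝ) : ℂ) * (z k * expo k p) by push_cast; ring,
      Complex.re_ofReal_mul]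
  simp_rw [h1]
  have hi2 : ∀ k, Integrable (fun p => (2 * Real.pi : ℂ)⁻¹ * z k * (expo k p * g p)) cell :=
    fun k => (hi k).const_mul _
  rw [integral_finsetSum S (f := fun k p => ((2 * Real.pi : ℂ)⁻¹ * z k * (expo k p * g p)).re)
    fun k _ => (hi2 k).re]
  refine Finset.sum_congr rfl fun k _ => ?_
  have := integral_re (hi2 k)
  simp only [RCLike.re_to_complex] at this
  rw [this, integral_const_mul]
  congr 1
  ring

theorem pair_trig (g : L2) (S : Finset Freq) (z : Freq → ℂ) :
    pair g (trig S z) = ∑ k ∈ S, (z k * (starRingEnd ℂ) (coeff g k)).re := by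
  rw [pair, integral_mul_trig ((Lp.memLp g).integrable (by norm_num))]
  simp_rw [conj_coeff]

/-! ### Trigonometric polynomials as elements of `L²(Ω)` -/

theorem memLp_trig (S : Finset Freq) (z : Freq → ℂ) : MemLp (trig S z) 2 cell :=
  MemLp.of_bound (continuous_trig S z).aestronglyMeasurable _
    (ae_of_all _ fun p => (Real.norm_eq_abs _).trans_le (abs_trig_le S z p))

/-- A trigonometric polynomial as an element of `L²(Ω)`. -/
noncomputable def trigL2 (S : Finset Freq) (z : Freq → ℂ) : L2 := (memLp_trig S z).toLp _

theorem coeFn_trigL2 (S : Finset Freq) (z : Freq → ℂ) : trigL2 S z =ᵐ[cell] trig S z :=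
  (memLp_trig S z).coeFn_toLp

/-- Frequency sets and coefficients of real functions. -/
structure IsReal (S : Finset Freq) (z : Freq → ℂ) : Prop where
  neg_mem : ∀ k ∈ S, -k ∈ S
  conj : ∀ k, z (-k) = (starRingEnd ℂ) (z k)

/-- Conjugation permutes the summands through `k ↦ -k`, so the real part in `trig` loses nothing. -/
theorem IsReal.ofReal_trig {S : Finset Freq} {z : Freq → ℂ} (h : IsReal S z) (p : ℝ × ℝ) :
    (trig S z p : ℂ) = (2 * Real.pi : ℂ)⁻¹ * ∑ k ∈ S, z k * expo k p := by
  have h1 : (starRingEnd ℂ) (∑ k ∈ S, z k * expo k p) = ∑ k ∈ S, z k * expo k p := by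
    rw [map_sum]
    refine Finset.sum_nbij' (fun k => -k) (fun k => -k) h.neg_mem h.neg_mem
      (fun _ _ => neg_neg _) (fun _ _ => neg_neg _) (fun k _ => ?_)
    rw [map_mul, h.conj, expo_neg]
  have h2 := Complex.conj_eq_iff_re.1 h1
  rw [trig, ← h2]
  push_cast
  simp

theorem IsReal.coeff_trigL2 {S : Finset Freq} {z : Freq → ℂ} (h : IsReal S z) (k : Freq) :
    coeff (trigL2 S z) k = if k ∈ S then z k else 0 := by
  have hpi : (2 * Real.pi : ℂ) ≠ 0 := by
    exact_mod_cast (by positivity : (2 * Real.pi : ℝ) ≠ 0)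
  have h1 : coeff (trigL2 S z) k
      = (2 * Real.pi : ℂ)⁻¹ * ∫ p in Omega, ∑ l ∈ S, (2 * Real.pi : ℂ)⁻¹ * z l * expo (l - k) p := by
    rw [coeff, coeffC]
    congr 1
    refine integral_congr_ae ?_
    filter_upwards [coeFn_trigL2 S z] with p hp
    rw [hp, h.ofReal_trig, Finset.mul_sum, Finset.mul_sum]
    refine Finset.sum_congr rfl fun l _ => ?_
    rw [sub_eq_add_neg, expo_add, expo_neg]
    ring
  have hi : ∀ l, Integrable (fun p => (2 * Real.pi : ℂ)⁻¹ * z l * expo (l - k) p) cell := fun l =>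
    (Integrable.of_bound (continuous_expo _).aestronglyMeasurable 1
      (ae_of_all _ fun p => (norm_expo _ p).le)).const_mul _
  rw [h1, integral_finsetSum _ fun l _ => hi l]
  simp_rw [integral_const_mul, integral_expo, sub_eq_zero, mul_ite, mul_zero, Finset.sum_ite_eq']
  split_ifs
  · field_simp
  · simp

theorem integral_trig {S : Finset Freq} (hS : 0 ∉ S) (z : Freq → ℂ) :
    ∫ p in Omega, trig S z p = 0 := by
  have h := integral_mul_trig (g := fun _ => 1) (integrable_const 1) S z
  simp only [one_mul, Complex.ofReal_one, mul_one, integral_expo] at h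
  rw [h]
  refine Finset.sum_eq_zero fun k hk => ?_
  rw [if_neg (fun h0 : k = 0 => hS (h0 ▸ hk))]
  simp

theorem pair_trigL2 (g : L2) (S : Finset Freq) (z : Freq → ℂ) :
    pair g (trig S z) = inner ℝ g (trigL2 S z) := by
  rw [pair, L2.inner_def]
  refine integral_congr_ae ?_
  filter_upwards [coeFn_trigL2 S z] with p hp
  rw [hp]; simp [mul_comm]

theorem sum_norm_coeff_sq_le (g : L2) (S : Finset Freq) : ∑ k ∈ S, ‖coeff g k‖ ^ 2 ≤ ‖g‖ ^ 2 :=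
  (hasSum_norm_coeff_sq g).summable.sum_le_tsum S (fun _ _ => by positivity) |>.trans_eq
    (hasSum_norm_coeff_sq g).tsum_eq

/-- Without conjugate symmetry of `z` its entries need not be Fourier coefficients. The bound
follows by pairing the polynomial with itself, Young's inequality and Bessel's inequality. -/
theorem norm_trigL2_sq_le (S : Finset Freq) (z : Freq → ℂ) :
    ‖trigL2 S z‖ ^ 2 ≤ ∑ k ∈ S, ‖z k‖ ^ 2 := by
  set g := trigL2 S z
  have h1 : ‖g‖ ^ 2 = ∑ k ∈ S, (z k * (starRingEnd ℂ) (coeff g k)).re := by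
    rw [← real_inner_self_eq_norm_sq, ← pair_trig, pair_trigL2]
  have h2 : ∑ k ∈ S, (z k * (starRingEnd ℂ) (coeff g k)).re
      ≤ ∑ k ∈ S, (‖z k‖ ^ 2 + ‖coeff g k‖ ^ 2) / 2 := by
    refine Finset.sum_le_sum fun k _ => (Complex.re_le_norm _).trans ?_
    rw [norm_mul, RCLike.norm_conj]
    nlinarith [sq_nonneg (‖z k‖ - ‖coeff g k‖)]
  rw [← Finset.sum_div, Finset.sum_add_distrib] at h2
  have h3 := sum_norm_coeff_sq_le g S
  linarith

theorem integral_trig_sq (S : Finset Freq) (z : Freq → ℂ) :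
    ∫ p in Omega, trig S z p ^ 2 = ‖trigL2 S z‖ ^ 2 := by
  rw [← real_inner_self_eq_norm_sq, L2.inner_def]
  refine integral_congr_ae ?_
  filter_upwards [coeFn_trigL2 S z] with p hp
  rw [hp]; simp [sq]

/-! ### Sobolev norms -/

/-- The squared homogeneous Sobolev norm of order `j / 4` of the frequency family `z` on `S`. -/
noncomputable def sobFin (j : ℕ) (S : Finset Freq) (z : Freq → ℂ) : ℝ :=
  ∑ k ∈ S, wt k ^ j * ‖z k‖ ^ 2

/-- Membership in the Sobolev space of order `j / 4`. -/
def InSob (j : ℕ) (g : L2) : Prop := Summable fun k => wt k ^ j * ‖coeff g k‖ ^ 2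

/-- The squared homogeneous Sobolev norm of order `j / 4`. -/
noncomputable def sob (j : ℕ) (g : L2) : ℝ := ∑' k, wt k ^ j * ‖coeff g k‖ ^ 2

theorem sob_term_nonneg (j : ℕ) (z : ℂ) (k : Freq) : 0 ≤ wt k ^ j * ‖z‖ ^ 2 := by
  have := wt_pos k; positivity

theorem sobFin_nonneg (j : ℕ) (S : Finset Freq) (z : Freq → ℂ) : 0 ≤ sobFin j S z :=
  Finset.sum_nonneg fun k _ => sob_term_nonneg j _ k

theorem sob_nonneg (j : ℕ) (g : L2) : 0 ≤ sob j g := tsum_nonneg fun k => sob_term_nonneg j _ k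

theorem inSob_zero (g : L2) : InSob 0 g := by
  simpa [InSob] using (hasSum_norm_coeff_sq g).summable

theorem sob_zero (g : L2) : sob 0 g = ‖g‖ ^ 2 := by
  simpa [sob] using (hasSum_norm_coeff_sq g).tsum_eq

theorem InSob.mono {i j : ℕ} (hij : i ≤ j) {g : L2} (h : InSob j g) : InSob i g :=
  h.of_nonneg_of_le (fun k => sob_term_nonneg i _ k) fun k => by
    gcongr; exact one_le_wt k

theorem InSob.sob_mono {i j : ℕ} (hij : i ≤ j) {g : L2} (h : InSob j g) : sob i g ≤ sob j g :=
  (h.mono hij).tsum_le_tsum (fun k => by gcongr; exact one_le_wt k) h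

theorem InSob.sobFin_le {j : ℕ} {g : L2} (h : InSob j g) (S : Finset Freq) :
    sobFin j S (coeff g) ≤ sob j g := h.sum_le_tsum S fun k _ => sob_term_nonneg j _ k

theorem InSob.sub {j : ℕ} {a b : L2} (ha : InSob j a) (hb : InSob j b) : InSob j (a - b) := by
  refine ((ha.mul_left 2).add (hb.mul_left 2)).of_nonneg_of_le
    (fun k => sob_term_nonneg j _ k) fun k => ?_
  have h := wt_pos k
  rw [coeff_sub]
  have h1 := norm_sub_le (coeff a k) (coeff b k)
  have h2 : ‖coeff a k - coeff b k‖ ^ 2 ≤ 2 * ‖coeff a k‖ ^ 2 + 2 * ‖coeff b k‖ ^ 2 := by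
    nlinarith [norm_nonneg (coeff a k - coeff b k), sq_nonneg (‖coeff a k‖ - ‖coeff b k‖)]
  calc wt k ^ j * ‖coeff a k - coeff b k‖ ^ 2
      ≤ wt k ^ j * (2 * ‖coeff a k‖ ^ 2 + 2 * ‖coeff b k‖ ^ 2) := by gcongr
    _ = _ := by ring

theorem InSob.sob_sub_le {j : ℕ} {a b : L2} (ha : InSob j a) (hb : InSob j b) :
    sob j (a - b) ≤ 2 * sob j a + 2 * sob j b := by
  rw [sob, sob, sob, ← tsum_mul_left, ← tsum_mul_left, ← (ha.mul_left 2).tsum_add (hb.mul_left 2)]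
  refine (ha.sub hb).tsum_le_tsum (fun k => ?_) ((ha.mul_left 2).add (hb.mul_left 2))
  have h := wt_pos k
  rw [coeff_sub]
  have h1 := norm_sub_le (coeff a k) (coeff b k)
  have h2 : ‖coeff a k - coeff b k‖ ^ 2 ≤ 2 * ‖coeff a k‖ ^ 2 + 2 * ‖coeff b k‖ ^ 2 := by
    nlinarith [norm_nonneg (coeff a k - coeff b k), sq_nonneg (‖coeff a k‖ - ‖coeff b k‖)]
  calc wt k ^ j * ‖coeff a k - coeff b k‖ ^ 2
      ≤ wt k ^ j * (2 * ‖coeff a k‖ ^ 2 + 2 * ‖coeff b k‖ ^ 2) := by gcongr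
    _ = _ := by ring

/-- The frequencies `k ≠ 0` with `|k₀|, |k₁| ≤ N`. -/
noncomputable def box (N : ℕ) : Finset Freq :=
  (Fintype.piFinset fun _ => Finset.Icc (-(N : ℤ)) N).erase 0

theorem zero_notMem_box (N : ℕ) : 0 ∉ box N := Finset.notMem_erase _ _

theorem neg_mem_box {N : ℕ} {k : Freq} (hk : k ∈ box N) : -k ∈ box N := by
  simp only [box, Finset.mem_erase, Fintype.mem_piFinset, Finset.mem_Icc, ne_eq] at hk ⊢
  refine ⟨fun h => hk.1 (neg_eq_zero.1 h), fun i => ?_⟩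
  have := hk.2 i
  simp only [Pi.neg_apply]
  omega

theorem box_mono : Monotone box := by
  intro M N h
  refine Finset.erase_subset_erase _ (Fintype.piFinset_subset _ _ fun _ => ?_)
  exact Finset.Icc_subset_Icc (by omega) (by omega)

theorem exists_mem_box {k : Freq} (hk : k ≠ 0) : ∃ N, k ∈ box N := by
  refine ⟨(k 0).natAbs + (k 1).natAbs, ?_⟩
  simp only [box, Finset.mem_erase, Fintype.mem_piFinset, Finset.mem_Icc]
  refine ⟨hk, fun i => ?_⟩
  have h0 : -(((k 0).natAbs + (k 1).natAbs : ℕ) : ℤ) ≤ k 0 ∧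
      k 0 ≤ (((k 0).natAbs + (k 1).natAbs : ℕ) : ℤ) := by omega
  have h1 : -(((k 0).natAbs + (k 1).natAbs : ℕ) : ℤ) ≤ k 1 ∧
      k 1 ≤ (((k 0).natAbs + (k 1).natAbs : ℕ) : ℤ) := by omega
  fin_cases i
  exacts [h0, h1]

theorem isReal_box_coeff (N : ℕ) (g : L2) : IsReal (box N) (coeff g) where
  neg_mem _ := neg_mem_box
  conj k := coeff_neg g k

theorem tendsto_sum_box {x : Freq → ℝ} (hx : Summable x) (h0 : x 0 = 0) :
    Tendsto (fun N => ∑ k ∈ box N, x k) atTop (𝓝 (∑' k, x k)) := by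
  have h : Tendsto (fun N => insert 0 (box N)) atTop (atTop : Filter (Finset Freq)) := by
    refine tendsto_atTop_finset_of_monotone
      (fun M N h => Finset.insert_subset_insert _ (box_mono h)) fun k => ?_
    by_cases hk : k = 0
    · exact ⟨0, by simp [hk]⟩
    · obtain ⟨N, hN⟩ := exists_mem_box hk
      exact ⟨N, Finset.mem_insert_of_mem hN⟩
  refine (hx.hasSum.comp h).congr fun N => ?_
  simp only [Function.comp]
  rw [Finset.sum_insert (zero_notMem_box N), h0, zero_add]

theorem tendsto_sobFin_box {j : ℕ} {g : L2} (h : InSob j g) (h0 : coeff g 0 = 0) :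
    Tendsto (fun N => sobFin j (box N) (coeff g)) atTop (𝓝 (sob j g)) :=
  tendsto_sum_box h (by simp [h0])

/-- This turns bounds from truncated test functions, uniform in `N`, into regularity: every finite
set of nonzero frequencies lies in some box. -/
theorem inSob_of_sobFin_le {j : ℕ} {g : L2} (h0 : coeff g 0 = 0) {B : ℝ}
    (h : ∀ N, sobFin j (box N) (coeff g) ≤ B) : InSob j g ∧ sob j g ≤ B := by
  have h1 : InSob j g := by
    refine summable_of_sum_le (c := B) (fun k => sob_term_nonneg j _ k) fun u => ?_
    have h2 : ∃ N, ∀ k ∈ u, k ≠ 0 → k ∈ box N := by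
      induction u using Finset.induction_on with
      | empty => exact ⟨0, by simp⟩
      | insert a s _ ih =>
        obtain ⟨N, hN⟩ := ih
        by_cases ha : a = 0
        · refine ⟨N, fun k hk hk0 => ?_⟩
          rcases Finset.mem_insert.1 hk with rfl | hk
          · exact absurd ha hk0
          · exact hN k hk hk0
        · obtain ⟨M, hM⟩ := exists_mem_box ha
          refine ⟨max M N, fun k hk hk0 => ?_⟩
          rcases Finset.mem_insert.1 hk with rfl | hk
          · exact box_mono (le_max_left _ _) hM
          · exact box_mono (le_max_right _ _) (hN k hk hk0)
    obtain ⟨N, hN⟩ := h2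
    calc ∑ k ∈ u, wt k ^ j * ‖coeff g k‖ ^ 2
        = ∑ k ∈ u.filter (· ≠ 0), wt k ^ j * ‖coeff g k‖ ^ 2 := by
          rw [Finset.sum_filter]
          refine Finset.sum_congr rfl fun k _ => ?_
          split_ifs with hk
          · rfl
          · rw [not_not.1 hk, h0]; simp
      _ ≤ ∑ k ∈ box N, wt k ^ j * ‖coeff g k‖ ^ 2 := by
          refine Finset.sum_le_sum_of_subset_of_nonneg (fun k hk => ?_)
            fun k _ _ => sob_term_nonneg j _ k
          exact hN k (Finset.mem_filter.1 hk).1 (Finset.mem_filter.1 hk).2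
      _ ≤ B := h N
  exact ⟨h1, le_of_tendsto' (tendsto_sobFin_box h1 h0) h⟩

/-- Used to check that a trigonometric polynomial is admissible in the supremum defining `normHm1`.
-/
theorem integral_grad_trig_sq_le {S : Finset Freq} (hS : 0 ∉ S) (z : Freq → ℂ) :
    ∫ p in Omega, (dx (trig S z) p ^ 2 + dy (trig S z) p ^ 2) ≤ sobFin 4 S z := by
  have hi : ∀ w, Integrable (fun p => trig S w p ^ 2) cell := fun w => (memLp_trig S w).integrable_sq
  rw [dx_trig, dy_trig, integral_add (hi _) (hi _), integral_trig_sq, integral_trig_sq]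
  refine (add_le_add (norm_trigL2_sq_le _ _) (norm_trigL2_sq_le _ _)).trans_eq ?_
  rw [← Finset.sum_add_distrib, sobFin]
  refine Finset.sum_congr rfl fun k hk => ?_
  rw [wt_pow_four, freqSq_of_ne_zero (fun h => hS (h ▸ hk))]
  simp only [norm_mul, Complex.norm_I, Complex.norm_real, one_mul, mul_pow, Real.norm_eq_abs, sq_abs]
  ring

/-! ### The transport term -/

/-- `∫ a ∇^⊥ψ · ∇φ`, where `(vx, vy) = ∇ψ`. -/
noncomputable def transport (a vx vy : L2) (φ : ℝ × ℝ → ℝ) : ℝ := -advection a vx vy φ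

theorem transport_eq (a vx vy : L2) (φ : ℝ × ℝ → ℝ) :
    transport a vx vy φ = ∫ p in Omega, a p * (vy p * dx φ p - vx p * dy φ p) := by
  rw [transport, advection, neg_neg]

theorem IsStream.sub {a b ψ ψx ψy χ χx χy : L2} (ha : IsStream a ψ ψx ψy)
    (hb : IsStream b χ χx χy) : IsStream (a - b) (ψ - χ) (ψx - χx) (ψy - χy) := by
  have hi : ∀ g : L2, Integrable g cell := fun g => (Lp.memLp g).integrable (by norm_num)
  have hbd : ∀ {φ : ℝ × ℝ → ℝ}, Continuous φ → ∀ g : L2, Integrable (fun p => g p * φ p) cell := by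
    intro φ hφ g
    have hK : IsCompact (Icc 0 (2 * Real.pi) ×ˢ Icc 0 (2 * Real.pi)) := isCompact_Icc.prod isCompact_Icc
    obtain ⟨C, hC⟩ := hK.exists_bound_of_continuousOn hφ.continuousOn
    refine (hi g).mul_bdd (c := C) hφ.aestronglyMeasurable ?_
    refine (ae_restrict_iff' (measurableSet_Ioo.prod measurableSet_Ioo)).2 (ae_of_all _ fun p hp => ?_)
    exact hC p ⟨Ioo_subset_Icc_self hp.1, Ioo_subset_Icc_self hp.2⟩
  have hsub : ∀ {φ : ℝ × ℝ → ℝ}, Continuous φ → ∀ g h : L2,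
      pair (g - h) φ = pair g φ - pair h φ := by
    intro φ hφ g h
    rw [pair, pair, pair, ← integral_sub (hbd hφ g) (hbd hφ h)]
    refine integral_congr_ae ?_
    filter_upwards [Lp.coeFn_sub g h] with p hp
    rw [hp]; simp [sub_mul]
  have hdx : ∀ {φ : ℝ × ℝ → ℝ}, IsTest φ → Continuous (dx φ) := fun h =>
    (h.smooth.continuous_fderiv (by simp)).clm_apply continuous_const
  have hdy : ∀ {φ : ℝ × ℝ → ℝ}, IsTest φ → Continuous (dy φ) := fun h =>
    (h.smooth.continuous_fderiv (by simp)).clm_apply continuous_const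
  refine ⟨?_, fun φ hφ => ?_, fun φ hφ => ?_, fun φ hφ => ?_⟩
  · have h : ∫ p in Omega, (ψ - χ) p = ∫ p in Omega, (ψ p - χ p) := by
      refine integral_congr_ae ?_
      filter_upwards [Lp.coeFn_sub ψ χ] with p hp
      rw [hp]; rfl
    rw [MeanZero, h, integral_sub (hi ψ) (hi χ), show ∫ p in Omega, ψ p = 0 from ha.meanZero,
      show ∫ p in Omega, χ p = 0 from hb.meanZero, sub_zero]
  · rw [hsub (hdx hφ), hsub hφ.smooth.continuous, ha.weak_dx φ hφ, hb.weak_dx φ hφ]; ring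
  · rw [hsub (hdy hφ), hsub hφ.smooth.continuous, ha.weak_dy φ hφ, hb.weak_dy φ hφ]; ring
  · rw [hsub (hdx hφ), hsub (hdy hφ), hsub hφ.smooth.continuous, ← ha.poisson φ hφ,
      ← hb.poisson φ hφ]; ring

theorem eq_of_forall_re_mul_eq {a b : ℂ} (h : ∀ z : ℂ, (z * a).re = (z * b).re) : a = b := by
  refine Complex.ext ?_ ?_
  · simpa using h 1
  · have := h Complex.I
    simp at this
    exact this

theorem IsStream.coeff_x {b ψ ψx ψy : L2} (h : IsStream b ψ ψx ψy) (k : Freq) :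
    coeff ψx k = Complex.I * (k 0 : ℝ) * coeff ψ k := by
  have h1 : ∀ z : ℂ, (z * (Complex.I * (k 0 : ℝ) * (starRingEnd ℂ) (coeff ψ k))).re
      = (z * -(starRingEnd ℂ) (coeff ψx k)).re := by
    intro z
    have h2 := h.weak_dx _ (isTest_trig {k} fun _ => z)
    rw [dx_trig, pair_trig, pair_trig, Finset.sum_singleton, Finset.sum_singleton, ← Complex.neg_re]
      at h2
    rw [show z * (Complex.I * (k 0 : ℝ) * (starRingEnd ℂ) (coeff ψ k))
      = Complex.I * (k 0 : ℝ) * z * (starRingEnd ℂ) (coeff ψ k) by ring, h2, mul_neg]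
  have h3 := congrArg (starRingEnd ℂ) (eq_of_forall_re_mul_eq h1)
  simp only [map_mul, map_neg, Complex.conj_I, Complex.conj_conj, Complex.conj_ofReal] at h3
  linear_combination h3

theorem IsStream.coeff_y {b ψ ψx ψy : L2} (h : IsStream b ψ ψx ψy) (k : Freq) :
    coeff ψy k = Complex.I * (k 1 : ℝ) * coeff ψ k := by
  have h1 : ∀ z : ℂ, (z * (Complex.I * (k 1 : ℝ) * (starRingEnd ℂ) (coeff ψ k))).re
      = (z * -(starRingEnd ℂ) (coeff ψy k)).re := by
    intro z
    have h2 := h.weak_dy _ (isTest_trig {k} fun _ => z)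
    rw [dy_trig, pair_trig, pair_trig, Finset.sum_singleton, Finset.sum_singleton, ← Complex.neg_re]
      at h2
    rw [show z * (Complex.I * (k 1 : ℝ) * (starRingEnd ℂ) (coeff ψ k))
      = Complex.I * (k 1 : ℝ) * z * (starRingEnd ℂ) (coeff ψ k) by ring, h2, mul_neg]
  have h3 := congrArg (starRingEnd ℂ) (eq_of_forall_re_mul_eq h1)
  simp only [map_mul, map_neg, Complex.conj_I, Complex.conj_conj, Complex.conj_ofReal] at h3
  linear_combination h3

theorem IsStream.coeff_vorticity {b ψ ψx ψy : L2} (h : IsStream b ψ ψx ψy) (k : Freq) :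
    coeff b k = (((k 0 : ℝ) ^ 2 + (k 1 : ℝ) ^ 2 : ℝ) : ℂ) * coeff ψ k := by
  have h1 : ∀ z : ℂ, (z * (Complex.I * (k 0 : ℝ) * (starRingEnd ℂ) (coeff ψx k)
      + Complex.I * (k 1 : ℝ) * (starRingEnd ℂ) (coeff ψy k))).re
      = (z * (starRingEnd ℂ) (coeff b k)).re := by
    intro z
    have h2 := h.poisson _ (isTest_trig {k} fun _ => z)
    rw [dx_trig, dy_trig, pair_trig, pair_trig, pair_trig, Finset.sum_singleton,
      Finset.sum_singleton, Finset.sum_singleton, ← Complex.add_re] at h2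
    rw [← h2]
    congr 1
    ring
  have h3 := congrArg (starRingEnd ℂ) (eq_of_forall_re_mul_eq h1)
  simp only [map_mul, map_add, Complex.conj_I, Complex.conj_conj, Complex.conj_ofReal, h.coeff_x,
    h.coeff_y, map_neg] at h3
  rw [← h3]
  push_cast
  linear_combination (-((k 0 : ℂ)) ^ 2 - (k 1 : ℂ) ^ 2) * coeff ψ k * Complex.I_sq

/-- The velocity is one derivative smoother than the vorticity: `|k i| |k|⁻² ≤ |k|⁻¹`. -/
theorem IsStream.norm_coeff_le {b ψ ψx ψy : L2} (h : IsStream b ψ ψx ψy) (k : Freq) :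
    ‖coeff ψx k‖ ≤ (wt k ^ 2)⁻¹ * ‖coeff b k‖ ∧ ‖coeff ψy k‖ ≤ (wt k ^ 2)⁻¹ * ‖coeff b k‖ := by
  have hw := wt_pos k
  rw [h.coeff_x, h.coeff_y]
  by_cases hk : k = 0
  · subst hk
    simp only [Pi.zero_apply, Int.cast_zero, Complex.ofReal_zero, mul_zero, zero_mul, norm_zero,
      and_self]
    positivity
  · rw [h.coeff_vorticity, ← freqSq_of_ne_zero hk, ← wt_pow_four]
    simp only [norm_mul, Complex.norm_I, Complex.norm_real, one_mul, Real.norm_eq_abs]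
    rw [abs_of_pos (by positivity : 0 < wt k ^ 4), ← mul_assoc,
      show (wt k ^ 2)⁻¹ * wt k ^ 4 = wt k ^ 2 by field_simp]
    exact ⟨by gcongr; exact abs_apply_le_wt_sq k 0, by gcongr; exact abs_apply_le_wt_sq k 1⟩

theorem coeffC_mul_expo (v : L2) (k l : Freq) :
    coeffC (fun p => (v p : ℂ) * expo k p) l = coeff v (l - k) := by
  rw [coeff, coeffC, coeffC]
  congr 1
  refine integral_congr_ae (ae_of_all _ fun p => ?_)
  simp only
  rw [sub_eq_add_neg, expo_add, expo_neg, map_mul, Complex.conj_conj]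
  ring

/-- Parseval's identity for `a` and `v` times an exponential, whose coefficients are those of `v`
shifted by `k`; this is the convolution formula for a product. -/
theorem enorm_integral_expo_mul_le (a v : L2) (k : Freq) :
    ‖∫ p in Omega, expo k p * ((a p * v p : ℝ) : ℂ)‖ₑ
      ≤ ∑' l, ‖coeff a l‖ₑ * ‖coeff v (l - k)‖ₑ := by
  have hH : MemLp (fun p => (v p : ℂ) * expo k p) 2 cell := by
    refine (memLp_ofReal v).of_le
      ((memLp_ofReal v).1.mul (continuous_expo k).aestronglyMeasurable) (ae_of_all _ fun p => ?_)
    rw [norm_mul, norm_expo, mul_one]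
  have h := hasSum_conj_coeffC_mul (memLp_ofReal a) hH
  simp_rw [coeffC_mul_expo] at h
  have h1 : ∫ p in Omega, expo k p * ((a p * v p : ℝ) : ℂ)
      = ∫ p in Omega, (starRingEnd ℂ) (a p : ℂ) * ((v p : ℂ) * expo k p) := by
    refine integral_congr_ae (ae_of_all _ fun p => ?_)
    simp only [Complex.conj_ofReal]
    push_cast
    ring
  rw [h1, ← h.tsum_eq]
  refine enorm_tsum_le_tsum_enorm.trans_eq (tsum_congr fun l => ?_)
  rw [enorm_mul, RCLike.enorm_conj]
  rfl

theorem transport_trig (a vx vy : L2) (S : Finset Freq) (z : Freq → ℂ) :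
    transport a vx vy (trig S z) = ∑ k ∈ S,
      ((Complex.I * (k 0 : ℝ) * z k * ((2 * Real.pi : ℂ)⁻¹ *
          ∫ p in Omega, expo k p * ((a p * vy p : ℝ) : ℂ))).re
        - (Complex.I * (k 1 : ℝ) * z k * ((2 * Real.pi : ℂ)⁻¹ *
          ∫ p in Omega, expo k p * ((a p * vx p : ℝ) : ℂ))).re) := by
  have hi : ∀ v : L2, Integrable (fun p => a p * v p) cell := fun v =>
    (Lp.memLp a).integrable_mul (Lp.memLp v)
  have hit : ∀ (v : L2) w, Integrable (fun p => a p * v p * trig S w p) cell := fun v w =>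
    (hi v).mul_bdd (c := (2 * Real.pi)⁻¹ * ∑ k ∈ S, ‖w k‖)
      (continuous_trig S w).aestronglyMeasurable (ae_of_all _ fun p => abs_trig_le S w p)
  rw [transport_eq, dx_trig, dy_trig, Finset.sum_sub_distrib, ← integral_mul_trig (hi vy),
    ← integral_mul_trig (hi vx), ← integral_sub (hit _ _) (hit _ _)]
  refine integral_congr_ae (ae_of_all _ fun p => ?_)
  simp only
  ring

/-- Pointwise Fourier bound for the transport term. -/
theorem enorm_transport_trig_le {a b vx vy : L2}
    (hv : ∀ k, ‖coeff vx k‖ ≤ (wt k ^ 2)⁻¹ * ‖coeff b k‖ ∧ ‖coeff vy k‖ ≤ (wt k ^ 2)⁻¹ * ‖coeff b k‖)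
    (S : Finset Freq) (z : Freq → ℂ) :
    ENNReal.ofReal |transport a vx vy (trig S z)| ≤ 2 * ∑' k, ∑' l,
      (if k ∈ S then ENNReal.ofReal (wt k ^ 2 * ‖z k‖) else 0) * ENNReal.ofReal ‖coeff a l‖ *
        ENNReal.ofReal ((wt (l - k) ^ 2)⁻¹ * ‖coeff b (l - k)‖) := by
  set X : Freq → ℝ≥0∞ := fun k => ∑' l, ENNReal.ofReal ‖coeff a l‖ *
        ENNReal.ofReal ((wt (l - k) ^ 2)⁻¹ * ‖coeff b (l - k)‖)
  have hX : ∀ v : L2, (∀ k, ‖coeff v k‖ ≤ (wt k ^ 2)⁻¹ * ‖coeff b k‖) → ∀ k,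
      ‖∫ p in Omega, expo k p * ((a p * v p : ℝ) : ℂ)‖ₑ ≤ X k := by
    intro v hv k
    refine (enorm_integral_expo_mul_le a v k).trans (ENNReal.tsum_le_tsum fun l => ?_)
    rw [← ofReal_norm, ← ofReal_norm]
    gcongr
    exact hv _
  have hpi : ‖(2 * Real.pi : ℂ)⁻¹‖ ≤ 1 := by
    rw [norm_inv, norm_mul, Complex.norm_real, Complex.norm_ofNat, Real.norm_eq_abs,
      abs_of_pos Real.pi_pos]
    exact inv_le_one_of_one_le₀ (by linarith [Real.pi_gt_three])
  have hterm : ∀ (i : Fin 2) (k : Freq) (J : ℂ), ‖J‖ₑ ≤ X k →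
      ‖(Complex.I * (k i : ℝ) * z k * ((2 * Real.pi : ℂ)⁻¹ * J)).re‖ₑ
        ≤ ENNReal.ofReal (wt k ^ 2 * ‖z k‖) * X k := by
    intro i k J hJ
    have h1 : ‖(Complex.I * (k i : ℝ) * z k * ((2 * Real.pi : ℂ)⁻¹ * J)).re‖
        ≤ wt k ^ 2 * ‖z k‖ * ‖J‖ := by
      refine (Complex.abs_re_le_norm _).trans ?_
      simp only [norm_mul, Complex.norm_I, Complex.norm_real, one_mul, Real.norm_eq_abs] at hpi ⊢
      have h2 := abs_apply_le_wt_sq k i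
      have h3 : ‖(2 * Real.pi : ℂ)⁻¹‖ * ‖J‖ ≤ 1 * ‖J‖ := by gcongr
      simp only [norm_inv, norm_mul, Complex.norm_real, Real.norm_eq_abs] at h3
      rw [one_mul] at h3
      calc _ ≤ wt k ^ 2 * ‖z k‖ * _ := by gcongr
        _ ≤ _ := by
          have := wt_pos k
          refine mul_le_mul_of_nonneg_left ?_ (by positivity)
          simpa using h3
    rw [← ofReal_norm]
    refine (ENNReal.ofReal_le_ofReal h1).trans ?_
    rw [ENNReal.ofReal_mul (by have := wt_pos k; positivity), ofReal_norm J]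
    gcongr
  rw [transport_trig]
  have h4 : ENNReal.ofReal |∑ k ∈ S,
      ((Complex.I * (k 0 : ℝ) * z k * ((2 * Real.pi : ℂ)⁻¹ *
          ∫ p in Omega, expo k p * ((a p * vy p : ℝ) : ℂ))).re
        - (Complex.I * (k 1 : ℝ) * z k * ((2 * Real.pi : ℂ)⁻¹ *
          ∫ p in Omega, expo k p * ((a p * vx p : ℝ) : ℂ))).re)|
      ≤ ∑ k ∈ S, 2 * (ENNReal.ofReal (wt k ^ 2 * ‖z k‖) * X k) := by
    rw [← Real.norm_eq_abs, ofReal_norm]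
    refine (enorm_sum_le _ _).trans (Finset.sum_le_sum fun k _ => ?_)
    refine enorm_sub_le.trans ?_
    exact (add_le_add (hterm 0 k _ (hX vy (fun k => (hv k).2) k))
      (hterm 1 k _ (hX vx (fun k => (hv k).1) k))).trans_eq (two_mul _).symm
  refine h4.trans ?_
  rw [← Finset.mul_sum]
  gcongr
  rw [tsum_eq_sum (s := S) (fun k hk => by simp [hk])]
  refine Finset.sum_le_sum fun k hk => ?_
  simp only [hk, ↓reduceIte, X]
  rw [← ENNReal.tsum_mul_left]
  refine (tsum_congr fun l => ?_).le
  ring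

theorem tsum_ofReal_sq {x : Freq → ℝ} (hx : ∀ k, 0 ≤ x k) {y : Freq → ℝ}
    (hxy : ∀ k, x k ^ 2 = y k) (hy : Summable y) :
    ∑' k, ENNReal.ofReal (x k) ^ 2 = ENNReal.ofReal (∑' k, y k) := by
  rw [ENNReal.ofReal_tsum_of_nonneg (fun k => (sq_nonneg (x k)).trans_eq (hxy k)) hy]
  refine tsum_congr fun k => ?_
  rw [← ENNReal.ofReal_pow (hx k), hxy]

theorem tsum_ite_ofReal_sq (S : Finset Freq) {x : Freq → ℝ} (hx : ∀ k, 0 ≤ x k) {y : Freq → ℝ}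
    (hxy : ∀ k, x k ^ 2 = y k) :
    ∑' k, (if k ∈ S then ENNReal.ofReal (x k) else 0) ^ 2 = ENNReal.ofReal (∑ k ∈ S, y k) := by
  rw [tsum_eq_sum (s := S) (fun k hk => by simp [hk]),
    ENNReal.ofReal_sum_of_nonneg fun k _ => (sq_nonneg (x k)).trans_eq (hxy k)]
  refine Finset.sum_congr rfl fun k hk => ?_
  rw [if_pos hk, ← ENNReal.ofReal_pow (hx k), hxy]

/-- The constant in the transport estimates. -/
noncomputable def transportConst : ℝ := 2 * √latticeConst

theorem transportConst_nonneg : 0 ≤ transportConst := by unfold transportConst; positivity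

theorem abs_le_of_ofReal_le {T L X Y Z : ℝ} {Q : ℝ≥0∞} (hL : 0 ≤ L) (hX : 0 ≤ X)
    (hY : 0 ≤ Y) (hZ : 0 ≤ Z) (h : ENNReal.ofReal |T| ≤ 2 * Q)
    (hQ : Q ^ 2 ≤ ENNReal.ofReal L * ENNReal.ofReal X * ENNReal.ofReal Y * ENNReal.ofReal Z) :
    |T| ≤ 2 * √L * √X * √Y * √Z := by
  have h1 : ENNReal.ofReal (T ^ 2) ≤ ENNReal.ofReal (4 * (L * X * Y * Z)) := by
    rw [← sq_abs, ENNReal.ofReal_pow (abs_nonneg T), ENNReal.ofReal_mul (by norm_num),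
      ENNReal.ofReal_mul (by positivity), ENNReal.ofReal_mul (by positivity),
      ENNReal.ofReal_mul (by positivity)]
    calc ENNReal.ofReal |T| ^ 2 ≤ (2 * Q) ^ 2 := by gcongr
      _ = 4 * Q ^ 2 := by rw [mul_pow]; norm_num
      _ ≤ _ := by
        rw [show ENNReal.ofReal 4 = 4 by simp]
        gcongr
  have h2 := (ENNReal.ofReal_le_ofReal_iff (by positivity)).1 h1
  refine (Real.abs_le_sqrt h2).trans_eq ?_
  rw [Real.sqrt_mul (by norm_num), Real.sqrt_mul (by positivity), Real.sqrt_mul (by positivity),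
    Real.sqrt_mul (by positivity), show (4 : ℝ) = 2 ^ 2 by norm_num, Real.sqrt_sq (by norm_num)]
  ring

/-- Transport estimate with the first factor in `H^{1/4}`. -/
theorem abs_transport_le_sob_left {a b ψ ψx ψy : L2} (hb : IsStream b ψ ψx ψy) (S : Finset Freq) (z : Freq → ℂ)
    (ha : InSob 1 a) :
    |transport a ψx ψy (trig S z)|
      ≤ transportConst * √(sob 1 a) * ‖b‖ * √(sobFin 4 S z) := by
  have h := enorm_transport_trig_le (a := a) hb.norm_coeff_le S z
  have hc := tsum_convolution_sq_le
    (fun k => if k ∈ S then ENNReal.ofReal (wt k ^ 2 * ‖z k‖) else 0)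
    (fun l => ENNReal.ofReal (√(wt l) * ‖coeff a l‖)) (fun l => ENNReal.ofReal ‖coeff b l‖)
    (fun l => ENNReal.ofReal (√(wt l))⁻¹) (fun l => ENNReal.ofReal (wt l ^ 2)⁻¹) tsum_wt_mul_wt_le
  rw [tsum_ite_ofReal_sq S (y := fun k => wt k ^ 4 * ‖z k‖ ^ 2)
      (fun k => by have := wt_pos k; positivity) (fun k => by ring),
    tsum_ofReal_sq (y := fun k => wt k ^ 1 * ‖coeff a k‖ ^ 2) (fun k => by positivity)
      (fun k => by rw [mul_pow, Real.sq_sqrt (wt_pos k).le, pow_one]) ha,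
    tsum_ofReal_sq (y := fun k => ‖coeff b k‖ ^ 2) (fun k => by positivity) (fun k => rfl)
      (hasSum_norm_coeff_sq b).summable, (hasSum_norm_coeff_sq b).tsum_eq] at hc
  have hQ1 : ∀ l, ENNReal.ofReal (√(wt l))⁻¹ * ENNReal.ofReal (√(wt l) * ‖coeff a l‖)
      = ENNReal.ofReal ‖coeff a l‖ := by
    intro l
    have h1 := wt_pos l
    rw [← ENNReal.ofReal_mul (by positivity), inv_mul_cancel_left₀ (by positivity)]
  have hQ2 : ∀ k l, ENNReal.ofReal (wt (l - k) ^ 2)⁻¹ * ENNReal.ofReal ‖coeff b (l - k)‖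
        = ENNReal.ofReal ((wt (l - k) ^ 2)⁻¹ * ‖coeff b (l - k)‖) := by
    intro k l
    have h2 := wt_pos (l - k)
    rw [← ENNReal.ofReal_mul (by positivity)]
  simp only [hQ1, hQ2] at hc
  have := abs_le_of_ofReal_le latticeConst_nonneg (sobFin_nonneg 4 S z) (sob_nonneg 1 a)
    (sq_nonneg ‖b‖) h hc
  rw [Real.sqrt_sq (norm_nonneg b)] at this
  refine this.trans_eq ?_
  rw [transportConst]; ring

/-- Transport estimate with the advecting vorticity in `H^{1/4}`. -/
theorem abs_transport_le_sob_right {a b ψ ψx ψy : L2} (hb : IsStream b ψ ψx ψy) (S : Finset Freq) (z : Freq → ℂ)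
    (hb1 : InSob 1 b) :
    |transport a ψx ψy (trig S z)|
      ≤ transportConst * ‖a‖ * √(sob 1 b) * √(sobFin 4 S z) := by
  have h := enorm_transport_trig_le (a := a) hb.norm_coeff_le S z
  have hc := tsum_convolution_sq_le
    (fun k => if k ∈ S then ENNReal.ofReal (wt k ^ 2 * ‖z k‖) else 0)
    (fun l => ENNReal.ofReal ‖coeff a l‖) (fun l => ENNReal.ofReal (√(wt l) * ‖coeff b l‖))
    (fun _ => 1) (fun l => ENNReal.ofReal (wt l ^ 2 * √(wt l))⁻¹) tsum_wt_le
  rw [tsum_ite_ofReal_sq S (y := fun k => wt k ^ 4 * ‖z k‖ ^ 2)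
      (fun k => by have := wt_pos k; positivity) (fun k => by ring),
    tsum_ofReal_sq (y := fun k => ‖coeff a k‖ ^ 2) (fun k => by positivity) (fun k => rfl)
      (hasSum_norm_coeff_sq a).summable, (hasSum_norm_coeff_sq a).tsum_eq,
    tsum_ofReal_sq (y := fun k => wt k ^ 1 * ‖coeff b k‖ ^ 2) (fun k => by positivity)
      (fun k => by rw [mul_pow, Real.sq_sqrt (wt_pos k).le, pow_one]) hb1] at hc
  have hQ : ∀ k l, ENNReal.ofReal (wt (l - k) ^ 2 * √(wt (l - k)))⁻¹
      * ENNReal.ofReal (√(wt (l - k)) * ‖coeff b (l - k)‖)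
        = ENNReal.ofReal ((wt (l - k) ^ 2)⁻¹ * ‖coeff b (l - k)‖) := by
    intro k l
    have h2 := wt_pos (l - k)
    rw [← ENNReal.ofReal_mul (by positivity)]
    congr 1
    field_simp
  simp only [hQ, one_mul] at hc
  have := abs_le_of_ofReal_le latticeConst_nonneg (sobFin_nonneg 4 S z) (sq_nonneg ‖a‖)
    (sob_nonneg 1 b) h hc
  rw [Real.sqrt_sq (norm_nonneg a)] at this
  refine this.trans_eq ?_
  rw [transportConst]; ring

/-- Transport estimate with the test function in `H^{5/4}`. -/
theorem abs_transport_le_sob_test {a b ψ ψx ψy : L2} (hb : IsStream b ψ ψx ψy) (S : Finset Freq) (z : Freq → ℂ) :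
    |transport a ψx ψy (trig S z)| ≤ transportConst * ‖a‖ * ‖b‖ * √(sobFin 5 S z) := by
  have h := enorm_transport_trig_le (a := a) hb.norm_coeff_le S z
  -- Here `a` takes the unweighted outer slot and the test function a weighted one; reflecting the
  -- coefficients of `b` and exchanging the two sums restores the form found in `h`.
  have hc := tsum_convolution_sq_le
    (fun l => ENNReal.ofReal ‖coeff a l‖)
    (fun k => if k ∈ S then ENNReal.ofReal (√(wt k) * (wt k ^ 2 * ‖z k‖)) else 0)
    (fun l => ENNReal.ofReal ‖coeff b (-l)‖)
    (fun l => ENNReal.ofReal (√(wt l))⁻¹) (fun l => ENNReal.ofReal (wt l ^ 2)⁻¹) tsum_wt_mul_wt_le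
  have hn : ∑' k, ‖coeff b (-k)‖ ^ 2 = ‖b‖ ^ 2 := by
    exact ((Equiv.neg Freq).tsum_eq (fun k => ‖coeff b k‖ ^ 2)).trans (hasSum_norm_coeff_sq b).tsum_eq
  rw [tsum_ite_ofReal_sq S (y := fun k => wt k ^ 5 * ‖z k‖ ^ 2)
      (fun k => by have := wt_pos k; positivity)
      (fun k => by rw [mul_pow, Real.sq_sqrt (wt_pos k).le]; ring),
    tsum_ofReal_sq (y := fun k => ‖coeff a k‖ ^ 2) (fun k => by positivity) (fun k => rfl)
      (hasSum_norm_coeff_sq a).summable, (hasSum_norm_coeff_sq a).tsum_eq,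
    tsum_ofReal_sq (y := fun k => ‖coeff b (-k)‖ ^ 2) (fun k => by positivity) (fun k => rfl)
      ((Equiv.neg Freq).summable_iff.2 (hasSum_norm_coeff_sq b).summable), hn,
    ENNReal.tsum_comm] at hc
  have hQ : ∀ k l, ENNReal.ofReal ‖coeff a l‖ * (ENNReal.ofReal (√(wt k))⁻¹ *
      (if k ∈ S then ENNReal.ofReal (√(wt k) * (wt k ^ 2 * ‖z k‖)) else 0)) *
      (ENNReal.ofReal (wt (k - l) ^ 2)⁻¹ * ENNReal.ofReal ‖coeff b (-(k - l))‖)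
      = (if k ∈ S then ENNReal.ofReal (wt k ^ 2 * ‖z k‖) else 0) * ENNReal.ofReal ‖coeff a l‖ *
        ENNReal.ofReal ((wt (l - k) ^ 2)⁻¹ * ‖coeff b (l - k)‖) := by
    intro k l
    have h1 := wt_pos k
    have h2 := wt_pos (l - k)
    rw [neg_sub, ← neg_sub l k, wt_neg, ← ENNReal.ofReal_mul (by positivity)]
    split_ifs with hk
    · rw [← ENNReal.ofReal_mul (by positivity), inv_mul_cancel_left₀ (by positivity),
        mul_comm (ENNReal.ofReal ‖coeff a l‖)]
    · simp
  simp only [hQ] at hc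
  have := abs_le_of_ofReal_le latticeConst_nonneg (sq_nonneg ‖a‖) (sobFin_nonneg 5 S z)
    (sq_nonneg ‖b‖) h hc
  rw [Real.sqrt_sq (norm_nonneg a), Real.sqrt_sq (norm_nonneg b)] at this
  refine this.trans_eq ?_
  rw [transportConst]; ring

/-! ### Algebra of the transport term -/

theorem integrable_transport (a vx vy : L2) (S : Finset Freq) (z : Freq → ℂ) :
    Integrable (fun p => a p * (vy p * dx (trig S z) p - vx p * dy (trig S z) p)) cell := by
  have hi : ∀ (v : L2) w, Integrable (fun p => a p * v p * trig S w p) cell := fun v w =>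
    ((Lp.memLp a).integrable_mul (Lp.memLp v)).mul_bdd (c := (2 * Real.pi)⁻¹ * ∑ k ∈ S, ‖w k‖)
      (continuous_trig S w).aestronglyMeasurable (ae_of_all _ fun p => abs_trig_le S w p)
  rw [dx_trig, dy_trig]
  refine ((hi vy fun k => Complex.I * (k 0 : ℝ) * z k).sub
    (hi vx fun k => Complex.I * (k 1 : ℝ) * z k)).congr (ae_of_all _ fun p => ?_)
  simp only [Pi.sub_apply]
  ring

theorem transport_sub_left (a b vx vy : L2) (S : Finset Freq) (z : Freq → ℂ) :
    transport (a - b) vx vy (trig S z)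
      = transport a vx vy (trig S z) - transport b vx vy (trig S z) := by
  rw [transport_eq, transport_eq, transport_eq,
    ← integral_sub (integrable_transport a vx vy S z) (integrable_transport b vx vy S z)]
  refine integral_congr_ae ?_
  filter_upwards [Lp.coeFn_sub a b] with p hp
  rw [hp, Pi.sub_apply]
  ring

theorem transport_sub_right (a vx vy ux uy : L2) (S : Finset Freq) (z : Freq → ℂ) :
    transport a (vx - ux) (vy - uy) (trig S z)
      = transport a vx vy (trig S z) - transport a ux uy (trig S z) := by
  rw [transport_eq, transport_eq, transport_eq,
    ← integral_sub (integrable_transport a vx vy S z) (integrable_transport a ux uy S z)]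
  refine integral_congr_ae ?_
  filter_upwards [Lp.coeFn_sub vx ux, Lp.coeFn_sub vy uy] with p hp hq
  rw [hp, hq, Pi.sub_apply, Pi.sub_apply]
  ring

theorem IsTest.fderiv_apply {φ : ℝ × ℝ → ℝ} (h : IsTest φ) (v : ℝ × ℝ) :
    IsTest fun p => fderiv ℝ φ p v where
  smooth := (h.smooth.fderiv_right (m := ((⊤ : ℕ∞) : WithTop ℕ∞)) (by simp)).clm_apply contDiff_const
  periodic_x p := by
    simp only
    rw [← fderiv_comp_add_right, show (fun x => φ (x + (2 * Real.pi, 0))) = φ from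
      funext h.periodic_x]
  periodic_y p := by
    simp only
    rw [← fderiv_comp_add_right, show (fun x => φ (x + (0, 2 * Real.pi))) = φ from
      funext h.periodic_y]

theorem IsTest.dy_dx {φ : ℝ × ℝ → ℝ} (h : IsTest φ) : dy (dx φ) = dx (dy φ) := by
  funext p
  have hd : DifferentiableAt ℝ (fderiv ℝ φ) p :=
    (h.smooth.fderiv_right (m := ((⊤ : ℕ∞) : WithTop ℕ∞)) (by simp)).differentiable (by simp) p
  have key : ∀ v w : ℝ × ℝ, fderiv ℝ (fun p => fderiv ℝ φ p v) p w = fderiv ℝ (fderiv ℝ φ) p w v := by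
    intro v w
    rw [fderiv_clm_apply hd (differentiableAt_const v)]
    simp
  have hs : IsSymmSndFDerivAt ℝ φ p := h.smooth.contDiffAt.isSymmSndFDerivAt
    (by rw [minSmoothness_of_isRCLikeNormedField]; exact WithTop.coe_le_coe.2 (le_top (a := (2 : ℕ∞))))
  exact (key _ _).trans ((hs _ _).trans (key _ _).symm)

/-- The integrand is half of `∇^⊥ψ · ∇(φ²)`. Moving the derivatives off `ψ` leaves the two mixed
second derivatives of `φ²`, which cancel. -/
theorem IsStream.transport_self {b ψ ψx ψy : L2} (hb : IsStream b ψ ψx ψy) (S : Finset Freq)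
    (z : Freq → ℂ) : transport (trigL2 S z) ψx ψy (trig S z) = 0 := by
  set φ := trig S z
  have hφ := isTest_trig S z
  have hsq : IsTest fun p => φ p ^ 2 :=
    ⟨hφ.smooth.pow 2, fun p => congrArg (· ^ 2) (hφ.periodic_x p),
      fun p => congrArg (· ^ 2) (hφ.periodic_y p)⟩
  have hder : ∀ p v, fderiv ℝ (fun p => φ p ^ 2) p v = 2 * φ p * fderiv ℝ φ p v := by
    intro p v
    have h1 := ((hφ.smooth.differentiable (by simp) p).hasFDerivAt.pow 2).fderiv
    rw [h1]
    simp [φ]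
  have hx := hb.weak_dx _ (hsq.fderiv_apply (0, 1))
  have hy := hb.weak_dy _ (hsq.fderiv_apply (1, 0))
  have hsym := hsq.dy_dx
  have h1 : pair ψy (dx fun p => φ p ^ 2) = pair ψx (dy fun p => φ p ^ 2) := by
    have h2 : -pair ψy (dx fun p => φ p ^ 2) = -pair ψx (dy fun p => φ p ^ 2) := by
      refine hy.symm.trans (Eq.trans ?_ hx)
      exact congrArg (pair ψ) hsym
    linarith
  have hi : ∀ (g : L2) w, Integrable (fun p => φ p * (g p * trig S w p)) cell := by
    intro g w
    have h3 : Integrable (fun p => g p * trig S w p) cell :=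
      (Lp.memLp g).integrable_mul (memLp_trig S w)
    exact h3.bdd_mul (continuous_trig S z).aestronglyMeasurable
      (ae_of_all _ fun p => abs_trig_le S z p)
  have h4 : transport (trigL2 S z) ψx ψy φ
      = 2⁻¹ * (pair ψy (dx fun p => φ p ^ 2) - pair ψx (dy fun p => φ p ^ 2)) := by
    have h5 : ∀ (g : L2) (v : ℝ × ℝ) (w : Freq → ℂ), (∀ p, fderiv ℝ φ p v = trig S w p) →
        ∫ p in Omega, φ p * (g p * trig S w p)
          = 2⁻¹ * ∫ p in Omega, g p * fderiv ℝ (fun p => φ p ^ 2) p v := by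
      intro g v w hw
      rw [← integral_const_mul]
      refine integral_congr_ae (ae_of_all _ fun p => ?_)
      simp only
      rw [hder, hw]
      ring
    have h6 : transport (trigL2 S z) ψx ψy φ = ∫ p in Omega,
        (φ p * (ψy p * dx φ p) - φ p * (ψx p * dy φ p)) := by
      rw [transport_eq]
      refine integral_congr_ae ?_
      filter_upwards [coeFn_trigL2 S z] with p hp
      rw [hp]; ring
    rw [h6]
    simp only [φ]
    rw [dx_trig, dy_trig, integral_sub (hi _ _) (hi _ _),
      h5 ψy (1, 0) _ (fun p => congrFun (dx_trig S z) p),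
      h5 ψx (0, 1) _ (fun p => congrFun (dy_trig S z) p), mul_sub]
    rfl
  rw [h4, h1]
  ring

/-! ### Energy inequality for one step -/

/-- Inside the box the difference has the coefficients of `V - W`, outside those of `V`; the tail of
`V` vanishes as `N → ∞`. -/
theorem inSob_sub_trunc {V W : L2} (hV : InSob 1 V) (hW : InSob 1 W) (N : ℕ) :
    InSob 1 (V - trigL2 (box N) (coeff W)) ∧ sob 1 (V - trigL2 (box N) (coeff W))
      ≤ sob 1 (V - W) + (sob 1 V - sobFin 1 (box N) (coeff V)) := by
  have hind := (hasSum_sum_of_ne_finset_zero (L := SummationFilter.unconditional Freq) (s := box N)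
    (f := fun k => if k ∈ box N then wt k ^ 1 * ‖coeff V k‖ ^ 2 else 0) fun k hk => by simp only [hk, ↓reduceIte])
  have hs : ∑ k ∈ box N, (if k ∈ box N then wt k ^ 1 * ‖coeff V k‖ ^ 2 else 0)
      = sobFin 1 (box N) (coeff V) := Finset.sum_congr rfl fun k hk => by simp [hk]
  rw [hs] at hind
  have hsum := (hV.sub hW).hasSum.add (hV.hasSum.sub hind)
  have hle : ∀ k, wt k ^ 1 * ‖coeff (V - trigL2 (box N) (coeff W)) k‖ ^ 2
      ≤ wt k ^ 1 * ‖coeff (V - W) k‖ ^ 2 + (wt k ^ 1 * ‖coeff V k‖ ^ 2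
        - if k ∈ box N then wt k ^ 1 * ‖coeff V k‖ ^ 2 else 0) := by
    intro k
    rw [coeff_sub, coeff_sub, (isReal_box_coeff N W).coeff_trigL2]
    split_ifs with hk
    · simp
    · have := wt_pos k
      rw [sub_zero, sub_zero]
      have h0 : 0 ≤ wt k ^ 1 * ‖coeff V k - coeff W k‖ ^ 2 := by positivity
      linarith
  have h1 := hsum.summable.of_nonneg_of_le (fun k => sob_term_nonneg 1 _ k) hle
  exact ⟨h1, hasSum_le hle h1.hasSum hsum⟩

/-- By `IsStream.transport_self` the truncation of `W` may be subtracted from `V` for free, so only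
the increment of the step is transported. -/
theorem abs_transport_trunc_le {V W b ψ ψx ψy : L2} (hV : InSob 1 V) (hW : InSob 1 W)
    (hb : IsStream b ψ ψx ψy) (N : ℕ) :
    |transport V ψx ψy (trig (box N) (coeff W))|
      ≤ transportConst * √(sob 1 (V - W) + (sob 1 V - sobFin 1 (box N) (coeff V))) * ‖b‖
        * √(sobFin 4 (box N) (coeff W)) := by
  have h1 := inSob_sub_trunc hV hW N
  have h2 := abs_transport_le_sob_left hb (box N) (coeff W) h1.1
  rw [transport_sub_left, hb.transport_self, sub_zero] at h2
  refine h2.trans ?_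
  have := transportConst_nonneg
  gcongr
  exact h1.2

theorem pair_trig_coeff_self (W : L2) (S : Finset Freq) :
    pair W (trig S (coeff W)) = sobFin 0 S (coeff W) := by
  rw [pair_trig, sobFin]
  refine Finset.sum_congr rfl fun k _ => ?_
  rw [mul_comm, ← Complex.normSq_eq_conj_mul_self, Complex.ofReal_re, Complex.normSq_eq_norm_sq]
  simp

theorem tendsto_pair_trunc (V : L2) {W : L2} (hW : coeff W 0 = 0) :
    Tendsto (fun N => pair V (trig (box N) (coeff W))) atTop (𝓝 (inner ℝ V W)) := by
  have h := hasSum_conj_coeff_mul V W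
  rw [← h.tsum_eq]
  refine (tendsto_sum_box h.summable (by simp [hW])).congr fun N => ?_
  rw [pair_trig]
  refine Finset.sum_congr rfl fun k _ => ?_
  rw [mul_comm]

theorem tendsto_transport_bound {V W : L2} (b : L2) (hV : InSob 1 V) (hV0 : coeff V 0 = 0)
    (hW : InSob 4 W) (hW0 : coeff W 0 = 0) :
    Tendsto (fun N => transportConst * √(sob 1 (V - W) + (sob 1 V - sobFin 1 (box N) (coeff V)))
      * ‖b‖ * √(sobFin 4 (box N) (coeff W))) atTop
      (𝓝 (transportConst * √(sob 1 (V - W)) * ‖b‖ * √(sob 4 W))) := by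
  have h1 : Tendsto (fun N => sob 1 (V - W) + (sob 1 V - sobFin 1 (box N) (coeff V))) atTop
      (𝓝 (sob 1 (V - W))) := by
    have := ((tendsto_sobFin_box hV hV0).const_sub (sob 1 V)).const_add (sob 1 (V - W))
    simpa using this
  exact ((h1.sqrt.const_mul _).mul_const _).mul (tendsto_sobFin_box hW hW0).sqrt

/-- The limit `N → ∞` of the tested equation, with `2(W - V, W) = ‖W‖² - ‖V‖² + ‖V - W‖²`. The
abstract `L` lets the same inequality serve the scheme (forcing) and the error equation (consistency
error). -/
theorem energy_step_inequality {V W b ψ ψx ψy : L2} (hV : InSob 1 V) (hV0 : coeff V 0 = 0)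
    (hW : InSob 4 W) (hW0 : coeff W 0 = 0) (hb : IsStream b ψ ψx ψy) {θ τ L : ℝ} (hτ : 0 ≤ τ)
    (h : ∀ N, pair W (trig (box N) (coeff W)) - pair V (trig (box N) (coeff W))
        + θ * sobFin 4 (box N) (coeff W)
      ≤ τ * transport V ψx ψy (trig (box N) (coeff W))
        + τ * (L * √(sobFin 4 (box N) (coeff W)))) :
    ‖W‖ ^ 2 - ‖V‖ ^ 2 + ‖V - W‖ ^ 2 + 2 * (θ * sob 4 W)
      ≤ 2 * (τ * (transportConst * √(sob 1 (V - W)) * ‖b‖ * √(sob 4 W)))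
        + 2 * (τ * (L * √(sob 4 W))) := by
  have hlim := le_of_tendsto_of_tendsto'
    (((tendsto_pair_trunc W hW0).sub (tendsto_pair_trunc V hW0)).add
      ((tendsto_sobFin_box hW hW0).const_mul θ))
    (((tendsto_transport_bound b hV hV0 hW hW0).const_mul τ).add
      (((tendsto_sobFin_box hW hW0).sqrt.const_mul L).const_mul τ))
    (fun N => (h N).trans (by
      gcongr
      exact (le_abs_self _).trans (abs_transport_trunc_le hV (hW.mono (by norm_num)) hb N)))
  rw [real_inner_self_eq_norm_sq] at hlim
  have h2 := norm_sub_sq_real V W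
  linarith

theorem sob_one_le_interpolate {g : L2} (hg : InSob 2 g) {l : ℝ} (hl : 0 < l) :
    sob 1 g ≤ l * ‖g‖ ^ 2 + sob 2 g / (4 * l) := by
  have hs := ((inSob_zero g).mul_left l).add (hg.div_const (4 * l))
  rw [← sob_zero, sob, sob, sob, ← tsum_mul_left, ← tsum_div_const,
    ← ((inSob_zero g).mul_left l).tsum_add (hg.div_const (4 * l))]
  refine (hg.mono (by norm_num : 1 ≤ 2)).tsum_le_tsum (fun k => ?_) hs
  have h1 : wt k ≤ l + wt k ^ 2 / (4 * l) := by
    rw [← sub_nonneg]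
    have : l + wt k ^ 2 / (4 * l) - wt k = (2 * l - wt k) ^ 2 / (4 * l) := by field_simp; ring
    rw [this]; positivity
  calc wt k ^ 1 * ‖coeff g k‖ ^ 2 ≤ (l + wt k ^ 2 / (4 * l)) * ‖coeff g k‖ ^ 2 := by
        rw [pow_one]; gcongr
    _ = _ := by ring

/-- The constant governing the admissible time steps: `8 C² B² / ν`. -/
noncomputable def stepConst (B ν : ℝ) : ℝ := 8 * (transportConst * B) ^ 2 / ν

/-- The discrete energy `‖W‖² + (θ / 16) ‖W‖²_{H^{1/2}}`. -/
noncomputable def stepEnergy (θ : ℝ) (W : L2) : ℝ := ‖W‖ ^ 2 + θ / 16 * sob 2 W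

theorem norm_sq_le_stepEnergy {θ : ℝ} (hθ : 0 ≤ θ) (W : L2) : ‖W‖ ^ 2 ≤ stepEnergy θ W := by
  have := sob_nonneg 2 W
  rw [stepEnergy]
  nlinarith

/-- One step decreases the discrete energy, up to the forcing. -/
theorem stepEnergy_le {V W b ψ ψx ψy : L2} (hV : InSob 2 V) (hV0 : coeff V 0 = 0)
    (hW : InSob 4 W) (hW0 : coeff W 0 = 0) (hb : IsStream b ψ ψx ψy) {ν τ L B : ℝ} (hν : 0 < ν)
    (hτ : 0 < τ) (hντ : ν * τ ≤ 1) (hB : ‖b‖ ≤ B) (hsmall : 16 * τ * stepConst B ν ^ 2 ≤ ν)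
    (h : ∀ N, pair W (trig (box N) (coeff W)) - pair V (trig (box N) (coeff W))
        + ν * τ * sobFin 4 (box N) (coeff W)
      ≤ τ * transport V ψx ψy (trig (box N) (coeff W))
        + τ * (L * √(sobFin 4 (box N) (coeff W)))) :
    stepEnergy (ν * τ) W * (1 + ν * τ / 2) ≤ stepEnergy (ν * τ) V + τ * (L ^ 2 / ν) := by
  have h1 := energy_step_inequality (hV.mono (by norm_num)) hV0 hW hW0 hb hτ.le h
  have hW2 : InSob 2 W := hW.mono (by norm_num)
  have hd2 := hV.sub hW2
  set K := stepConst B ν with hK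
  have hK0 : 0 ≤ K := by rw [hK, stepConst]; positivity
  set x := √(sob 4 W)
  have hx : x ^ 2 = sob 4 W := Real.sq_sqrt (sob_nonneg 4 W)
  set y := √(sob 1 (V - W))
  have hy : y ^ 2 = sob 1 (V - W) := Real.sq_sqrt (sob_nonneg 1 _)
  have hx0 : 0 ≤ x := Real.sqrt_nonneg _
  have hy0 : 0 ≤ y := Real.sqrt_nonneg _
  have hC := transportConst_nonneg
  have hdsub := hV.sob_sub_le hW2
  have hw2 : sob 2 W ≤ x ^ 2 := hx ▸ hW.sob_mono (by norm_num)
  have hw0 : ‖W‖ ^ 2 ≤ x ^ 2 := by rw [hx, ← sob_zero]; exact hW.sob_mono (by norm_num)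
  -- Young's inequality; `stepConst` is exactly the coefficient of `y ^ 2` that goes with `ν / 8`.
  have hterm1 : 2 * (transportConst * y * ‖b‖ * x) ≤ ν / 8 * x ^ 2 + K * y ^ 2 := by
    have h2 : transportConst * y * ‖b‖ * x ≤ (transportConst * B) * y * x := by
      calc transportConst * y * ‖b‖ * x ≤ transportConst * y * B * x := by gcongr
        _ = _ := by ring
    have h3 : ν / 8 * x ^ 2 + K * y ^ 2 - 2 * ((transportConst * B) * y * x)
        = (ν * x - 8 * (transportConst * B) * y) ^ 2 / (8 * ν) := by
      rw [hK, stepConst]; field_simp; ring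
    have h4 : 0 ≤ (ν * x - 8 * (transportConst * B) * y) ^ 2 / (8 * ν) := by positivity
    linarith
  have hterm2 : 2 * (L * x) ≤ L ^ 2 / ν + ν * x ^ 2 := by
    have h3 : L ^ 2 / ν + ν * x ^ 2 - 2 * (L * x) = (L - ν * x) ^ 2 / ν := by field_simp; ring
    have h4 : 0 ≤ (L - ν * x) ^ 2 / ν := by positivity
    linarith
  have hinterp : τ * (K * y ^ 2) ≤ ‖V - W‖ ^ 2 + ν * τ / 32 * sob 2 (V - W) := by
    rcases hK0.eq_or_lt with hK0 | hK0
    · rw [← hK0]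
      have := sob_nonneg 2 (V - W)
      simp only [zero_mul, mul_zero]
      positivity
    -- The parameter `8 K / ν` makes the `H^{1/2}` part equal to `ν τ / 32`; the `L²` part then has
    -- coefficient at most one by the smallness of `τ`.
    · have hl : 0 < 8 * K / ν := by positivity
      have h5 := sob_one_le_interpolate hd2 hl
      rw [← hy] at h5
      have h6 : τ * (K * y ^ 2)
          ≤ τ * (K * (8 * K / ν * ‖V - W‖ ^ 2 + sob 2 (V - W) / (4 * (8 * K / ν)))) := by gcongr
      have h7 : τ * (K * (8 * K / ν * ‖V - W‖ ^ 2 + sob 2 (V - W) / (4 * (8 * K / ν))))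
          = (8 * τ * K ^ 2 / ν) * ‖V - W‖ ^ 2 + ν * τ / 32 * sob 2 (V - W) := by
        field_simp; ring
      have h8 : 8 * τ * K ^ 2 / ν ≤ 1 := by
        rw [div_le_one hν]; nlinarith [mul_nonneg hτ.le (sq_nonneg K)]
      have h9 : (8 * τ * K ^ 2 / ν) * ‖V - W‖ ^ 2 ≤ 1 * ‖V - W‖ ^ 2 := by gcongr
      linarith
  set θ := ν * τ with hθ
  have hθ0 : 0 < θ := by positivity
  have e1 : 2 * (τ * (transportConst * y * ‖b‖ * x)) ≤ θ / 8 * x ^ 2 + τ * (K * y ^ 2) := by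
    have := mul_le_mul_of_nonneg_left hterm1 hτ.le
    rw [hθ]; linarith
  have e2 : 2 * (τ * (L * x)) ≤ τ * (L ^ 2 / ν) + θ * x ^ 2 := by
    have := mul_le_mul_of_nonneg_left hterm2 hτ.le
    rw [hθ]; linarith
  -- The `V` share is the `H^{1/2}` part of the old energy; the `W` share is paid by viscosity.
  have e3 : θ / 32 * sob 2 (V - W) ≤ θ / 16 * sob 2 V + θ / 16 * x ^ 2 := by
    have := mul_le_mul_of_nonneg_left hdsub (by positivity : 0 ≤ θ / 32)
    have h10 := mul_le_mul_of_nonneg_left hw2 (by positivity : 0 ≤ θ / 16)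
    linarith
  rw [← hx] at h1
  -- Remaining viscosity: `2 - 1/8 - 1 - 1/16 = 13/16`. Rebuilding the new energy with its factor `1
  -- + θ / 2` costs `1/2 + 3/32`, which is less.
  have e4 : ‖W‖ ^ 2 + 13 / 16 * (θ * x ^ 2) ≤ ‖V‖ ^ 2 + θ / 16 * sob 2 V + τ * (L ^ 2 / ν) := by
    linarith
  rw [stepEnergy, stepEnergy]
  have e5 : θ / 2 * ‖W‖ ^ 2 ≤ θ / 2 * x ^ 2 := by gcongr
  have e6 : θ / 16 * sob 2 W * (1 + θ / 2) ≤ θ / 16 * x ^ 2 * (1 + 1 / 2) := by gcongr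
  have e7 : 0 ≤ θ * x ^ 2 := by positivity
  linarith

/-! ### Derivatives along Navier-Stokes trajectories -/

/-- The weak form of `ν Δa - ∇^⊥ψ · ∇a + f` tested against a trigonometric polynomial. -/
noncomputable def rate (ν : ℝ) (f a vx vy : L2) (S : Finset Freq) (z : Freq → ℂ) : ℝ :=
  ν * pair a (lap (trig S z)) + transport a vx vy (trig S z) + pair f (trig S z)

theorem pair_sub_trig (a b : L2) (S : Finset Freq) (z : Freq → ℂ) :
    pair (a - b) (trig S z) = pair a (trig S z) - pair b (trig S z) := by
  rw [pair_trigL2, pair_trigL2, pair_trigL2, inner_sub_left]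

theorem sobFin_mono {i j : ℕ} (hij : i ≤ j) (S : Finset Freq) (z : Freq → ℂ) :
    sobFin i S z ≤ sobFin j S z :=
  Finset.sum_le_sum fun k _ => by gcongr; exact one_le_wt k

theorem abs_pair_trig_le (g : L2) (S : Finset Freq) (z : Freq → ℂ) (j : ℕ) :
    |pair g (trig S z)| ≤ ‖g‖ * √(sobFin j S z) := by
  rw [pair_trigL2]
  refine (abs_real_inner_le_norm _ _).trans ?_
  gcongr
  refine Real.le_sqrt_of_sq_le ((norm_trigL2_sq_le S z).trans ?_)
  refine le_trans (le_of_eq ?_) (sobFin_mono (Nat.zero_le j) S z)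
  simp [sobFin]

theorem continuousOn_pair {w : ℝ → L2} (hw : ContinuousOn w (Ici 0)) (S : Finset Freq)
    (z : Freq → ℂ) : ContinuousOn (fun s => pair (w s) (trig S z)) (Ici 0) := by
  simp_rw [pair_trigL2]
  exact hw.inner continuousOn_const

/-- With a smooth test function the form is bilinear and bounded on `L²`. No continuity of the
stream functions is assumed: their differences are stream functions of the vorticity differences. -/
theorem continuousOn_transport {w ψ ψx ψy : ℝ → L2} (hw : ContinuousOn w (Ici 0))
    (hs : ∀ t, 0 ≤ t → IsStream (w t) (ψ t) (ψx t) (ψy t)) (S : Finset Freq) (z : Freq → ℂ) :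
    ContinuousOn (fun s => transport (w s) (ψx s) (ψy s) (trig S z)) (Ici 0) := by
  intro t ht
  have hsub : ContinuousWithinAt (fun s => w s - w t) (Ici 0) t :=
    (hw t ht).sub continuousWithinAt_const
  have hbound : Tendsto (fun s => transportConst * ‖w s - w t‖ * ‖w s‖ * √(sobFin 5 S z)
      + transportConst * ‖w t‖ * ‖w s - w t‖ * √(sobFin 5 S z)) (𝓝[Ici 0] t) (𝓝 0) := by
    have h1 : ContinuousWithinAt (fun s => transportConst * ‖w s - w t‖ * ‖w s‖ * √(sobFin 5 S z)
      + transportConst * ‖w t‖ * ‖w s - w t‖ * √(sobFin 5 S z)) (Ici 0) t :=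
      (((continuousWithinAt_const.mul hsub.norm).mul (hw t ht).norm).mul
        continuousWithinAt_const).add
        ((continuousWithinAt_const.mul hsub.norm).mul continuousWithinAt_const)
    have h2 := h1.tendsto
    simpa using h2
  refine tendsto_iff_norm_sub_tendsto_zero.2 (squeeze_zero' (Eventually.of_forall fun _ =>
    norm_nonneg _) ?_ hbound)
  filter_upwards [self_mem_nhdsWithin] with s hs0
  have e : transport (w s) (ψx s) (ψy s) (trig S z) - transport (w t) (ψx t) (ψy t) (trig S z)
      = transport (w s - w t) (ψx s) (ψy s) (trig S z)
        + transport (w t) (ψx s - ψx t) (ψy s - ψy t) (trig S z) := by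
    rw [transport_sub_left, transport_sub_right]; ring
  rw [e]
  refine (norm_add_le _ _).trans (add_le_add ?_ ?_)
  · exact abs_transport_le_sob_test (hs s hs0) S z
  · exact abs_transport_le_sob_test ((hs s hs0).sub (hs t ht)) S z

/-- The integrand of the weak formulation is continuous in time, so the fundamental theorem of
calculus applies. -/
theorem IsNSESolution.exists_hasDerivAt {ν : ℝ} {f : L2} {w : ℝ → L2} (h : IsNSESolution ν f w) :
    ∃ ψ ψx ψy : ℝ → L2, (∀ t, 0 ≤ t → IsStream (w t) (ψ t) (ψx t) (ψy t)) ∧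
      ∀ S z, 0 ∉ S → ∀ t, 0 < t →
        HasDerivAt (fun s => pair (w s) (trig S z)) (rate ν f (w t) (ψx t) (ψy t) S z) t := by
  obtain ⟨ψ, ψx, ψy, hs, hweak⟩ := h.weak
  refine ⟨ψ, ψx, ψy, hs, fun S z hS t ht => ?_⟩
  have hc : ContinuousOn (fun s => rate ν f (w s) (ψx s) (ψy s) S z) (Ici 0) := by
    unfold rate
    refine ((continuousOn_const.mul ?_).add (continuousOn_transport h.continuousOn hs S z)).add
      continuousOn_const
    rw [lap_trig hS]
    exact continuousOn_pair h.continuousOn _ _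
  have hd : HasDerivAt (fun u => ∫ s in (0 : ℝ)..u, rate ν f (w s) (ψx s) (ψy s) S z)
      (rate ν f (w t) (ψx t) (ψy t) S z) t := by
    refine intervalIntegral.integral_hasDerivAt_right ?_ ?_ ?_
    · refine (hc.mono ?_).intervalIntegrable
      rw [uIcc_of_le ht.le]
      exact Icc_subset_Ici_self
    · exact (hc.mono Ioi_subset_Ici_self).stronglyMeasurableAtFilter isOpen_Ioi t ht
    · exact hc.continuousAt (Ici_mem_nhds ht)
  refine (hd.const_add (pair (w 0) (trig S z))).congr_of_eventuallyEq ?_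
  filter_upwards [Ioi_mem_nhds ht] with u hu
  have h1 := hweak _ (isTest_trig S z) u (le_of_lt hu)
  have h2 : ∫ s in (0 : ℝ)..u, rate ν f (w s) (ψx s) (ψy s) S z
      = ∫ s in (0 : ℝ)..u, (ν * pair (w s) (lap (trig S z))
        - advection (w s) (ψx s) (ψy s) (trig S z) + pair f (trig S z)) := by
    refine intervalIntegral.integral_congr fun s _ => ?_
    simp only [rate, transport]
    ring
  rw [h2, ← h1]
  ring

/-- The bound on `‖∂ₜₜω‖_{H⁻¹}` provided by `M_V`. -/
noncomputable def accelConst (M : ℝ) : ℝ := √(M + 1)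

theorem exists_hasDerivAt_deriv {ν : ℝ} {f : L2} {A : Set L2} (hMV : MV ν f A < ⊤) {w : ℝ → L2}
    (hw : IsNSESolution ν f w) (h0 : w 0 ∈ A) {t : ℝ} (ht : 0 < t) {S : Finset Freq} (hS : 0 ∉ S)
    (z : Freq → ℂ) :
    ∃ g, HasDerivAt (deriv fun s => pair (w s) (trig S z)) g t ∧
      |g| ≤ accelConst (MV ν f A).toReal * √(sobFin 4 S z) := by
  set M := (MV ν f A).toReal
  have hM0 : 0 ≤ M := ENNReal.toReal_nonneg
  have hMeq : MV ν f A = ENNReal.ofReal M := (ENNReal.ofReal_toReal hMV.ne).symm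
  have h1 : normDtt w t ^ 2 ≤ MV ν f A := by
    refine le_trans (le_self_add (b := ‖w t‖ₑ ^ 2 * normDt w t ^ 2)) ?_
    rw [MV]
    exact le_iSup_of_le w (le_iSup_of_le hw (le_iSup_of_le h0 (le_iSup_of_le t
      (le_iSup_of_le ht le_rfl))))
  -- The `+ 1` in `accelConst` makes the inequality strict, so that the infimum yields an actual
  -- second derivative `G` with this bound.
  have h2 : normDtt w t < ENNReal.ofReal (accelConst M) := by
    refine lt_of_not_ge fun hle => ?_
    have h3 : ENNReal.ofReal (M + 1) ≤ MV ν f A := by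
      refine le_trans ?_ h1
      calc ENNReal.ofReal (M + 1) = ENNReal.ofReal (accelConst M) ^ 2 := by
            rw [accelConst, ← ENNReal.ofReal_pow (Real.sqrt_nonneg _), Real.sq_sqrt (by positivity)]
        _ ≤ _ := by gcongr
    rw [hMeq, ENNReal.ofReal_le_ofReal_iff hM0] at h3
    linarith
  rw [normDtt, iInf_lt_iff] at h2
  obtain ⟨G, h2⟩ := h2
  rw [iInf_lt_iff] at h2
  obtain ⟨hG, h2⟩ := h2
  refine ⟨G (trig S z), hG _ (isTest_trig S z), ?_⟩
  have hK : 0 ≤ accelConst M := Real.sqrt_nonneg _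
  -- Normalizing by a number `r` above the norm, rather than by the norm, covers the case of norm
  -- zero.
  have key : ∀ r, √(sobFin 4 S z) < r → |G (trig S z)| ≤ accelConst M * r := by
    intro r hr
    have hr0 : 0 < r := (Real.sqrt_nonneg _).trans_lt hr
    set z' : Freq → ℂ := fun k => ((r⁻¹ : ℝ) : ℂ) * z k
    have hpair : ∀ g : L2, pair g (trig S z') = r⁻¹ * pair g (trig S z) := by
      intro g
      rw [pair_trig, pair_trig, Finset.mul_sum]
      refine Finset.sum_congr rfl fun k _ => ?_
      rw [mul_assoc, Complex.re_ofReal_mul]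
    have hsob : sobFin 4 S z' ≤ 1 := by
      have : sobFin 4 S z' = (r⁻¹) ^ 2 * sobFin 4 S z := by
        rw [sobFin, sobFin, Finset.mul_sum]
        refine Finset.sum_congr rfl fun k _ => ?_
        rw [norm_mul, Complex.norm_real, Real.norm_eq_abs, mul_pow, sq_abs]
        ring
      rw [this, inv_pow, inv_mul_le_one₀ (by positivity)]
      exact (Real.sqrt_le_left hr0.le).1 hr.le
    have h5 : ENNReal.ofReal |G (trig S z')| ≤ normHm1 G := by
      rw [normHm1]
      exact le_iSup_of_le (trig S z') (le_iSup_of_le (isTest_trig S z')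
        (le_iSup_of_le (integral_trig hS z')
          (le_iSup_of_le ((integral_grad_trig_sq_le hS z').trans hsob) le_rfl)))
    have h6 : |G (trig S z')| ≤ accelConst M :=
      (ENNReal.ofReal_le_ofReal_iff hK).1 (h5.trans h2.le)
    -- `G` is not assumed linear; homogeneity comes from uniqueness of derivatives.
    have h7 : G (trig S z') = r⁻¹ * G (trig S z) := by
      have e1 := hG _ (isTest_trig S z')
      have e2 : (fun s => pair (w s) (trig S z')) = fun s => r⁻¹ * pair (w s) (trig S z) :=
        funext fun s => hpair (w s)
      rw [e2, show (deriv fun s => r⁻¹ * pair (w s) (trig S z))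
        = fun s => r⁻¹ * deriv (fun s => pair (w s) (trig S z)) s from
        funext fun s => deriv_const_mul_field _] at e1
      exact e1.unique ((hG _ (isTest_trig S z)).const_mul r⁻¹)
    rw [h7, abs_mul, abs_of_pos (by positivity : 0 < r⁻¹), inv_mul_le_iff₀ hr0] at h6
    linarith
  refine le_of_forall_gt_imp_ge_of_dense fun c hc => ?_
  rcases hK.eq_or_lt with hK0 | hK0
  · have := key (√(sobFin 4 S z) + 1) (by linarith)
    rw [← hK0] at this hc
    linarith
  · have := key (c / accelConst M) (by rwa [lt_div_iff₀ hK0, mul_comm])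
    rwa [mul_div_cancel₀ _ hK0.ne'] at this

/-- Second order Taylor estimate on a half-line. -/
theorem abs_taylor_le {h h' : ℝ → ℝ} {κ : ℝ} (hc : ContinuousOn h (Ici 0))
    (h1 : ∀ t, 0 < t → HasDerivAt h (h' t) t)
    (h2 : ∀ t, 0 < t → ∃ g, HasDerivAt h' g t ∧ |g| ≤ κ) {t : ℝ} (ht : 0 < t) {s : ℝ}
    (hs : 0 ≤ s) : |h s - h t - h' t * (s - t)| ≤ κ * (s - t) ^ 2 := by
  have hκ : 0 ≤ κ := by
    obtain ⟨g, _, hg⟩ := h2 t ht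
    exact (abs_nonneg g).trans hg
  choose! g hg hgκ using h2
  have hlip : ∀ s, 0 < s → |h' s - h' t| ≤ κ * |s - t| := by
    intro s hs
    have := (convex_Ioi (0 : ℝ)).norm_image_sub_le_of_norm_hasDerivWithin_le (f := h') (f' := g)
      (C := κ) (fun x hx => (hg x hx).hasDerivWithinAt) (fun x hx => hgκ x hx) (mem_Ioi.2 ht)
      (mem_Ioi.2 hs)
    exact this
  have hpos : ∀ s, 0 < s → |h s - h t - h' t * (s - t)| ≤ κ * (s - t) ^ 2 := by
    intro s hs
    have hsub : ∀ x ∈ uIcc t s, 0 < x := fun x hx => (lt_min ht hs).trans_le hx.1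
    have hle : ∀ x ∈ uIcc t s, |h' x - h' t| ≤ κ * |s - t| := by
      intro x hx
      refine (hlip x (hsub x hx)).trans ?_
      exact mul_le_mul_of_nonneg_left (abs_sub_left_of_mem_uIcc hx) hκ
    have := (convex_uIcc t s).norm_image_sub_le_of_norm_hasDerivWithin_le
      (f := fun x => h x - h' t * x) (f' := fun x => h' x - h' t * 1) (C := κ * |s - t|)
      (fun x hx => ((h1 x (hsub x hx)).sub ((hasDerivAt_id x).const_mul _)).hasDerivWithinAt)
      (fun x hx => by rw [mul_one]; exact hle x hx) left_mem_uIcc right_mem_uIcc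
    rw [Real.norm_eq_abs, Real.norm_eq_abs, mul_assoc, ← sq, sq_abs] at this
    refine le_trans (le_of_eq ?_) this
    congr 1
    ring
  -- Derivatives are available for positive times only; `s = 0` is reached by continuity.
  rcases hs.eq_or_lt with rfl | hs
  · have hcl : ContinuousWithinAt (fun s => |h s - h t - h' t * (s - t)|) (Ioi 0) 0 := by
      have := (hc 0 self_mem_Ici).mono Ioi_subset_Ici_self
      exact ((this.sub continuousWithinAt_const).sub (by fun_prop)).abs
    have hcr : ContinuousWithinAt (fun s => κ * (s - t) ^ 2) (Ioi 0) 0 := by fun_prop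
    refine le_of_tendsto_of_tendsto hcl.tendsto hcr.tendsto ?_
    filter_upwards [self_mem_nhdsWithin] with s hs
    exact hpos s hs
  · exact hpos s hs

/-! ### Estimates on the attractor -/

/-- The form in which the bound `M_V` enters all later estimates. -/
theorem exists_stream_taylor {ν : ℝ} {f : L2} {A : Set L2} (hMV : MV ν f A < ⊤) {w : ℝ → L2}
    (hw : IsNSESolution ν f w) (h0 : w 0 ∈ A) :
    ∃ ψ ψx ψy : ℝ → L2, (∀ t, 0 ≤ t → IsStream (w t) (ψ t) (ψx t) (ψy t)) ∧
      ∀ S z, 0 ∉ S → ∀ t, 0 < t → ∀ s, 0 ≤ s →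
        |pair (w s) (trig S z) - pair (w t) (trig S z)
          - rate ν f (w t) (ψx t) (ψy t) S z * (s - t)|
          ≤ accelConst (MV ν f A).toReal * √(sobFin 4 S z) * (s - t) ^ 2 := by
  obtain ⟨ψ, ψx, ψy, hs, hd⟩ := hw.exists_hasDerivAt
  refine ⟨ψ, ψx, ψy, hs, fun S z hS t ht s hs0 => ?_⟩
  have h := abs_taylor_le (h := fun s => pair (w s) (trig S z))
    (h' := deriv fun s => pair (w s) (trig S z)) (continuousOn_pair hw.continuousOn S z)
    (fun t ht => (hd S z hS t ht).differentiableAt.hasDerivAt)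
    (fun t ht => exists_hasDerivAt_deriv hMV hw h0 ht hS z) ht hs0
  rwa [(hd S z hS t ht).deriv] at h

/-- The bound on `‖∂ₜω‖_{H⁻¹}` in terms of the bounds on `‖ω‖` and `‖∂ₜₜω‖_{H⁻¹}`. -/
noncomputable def velConst (B M : ℝ) : ℝ := 2 * B + accelConst M

theorem velConst_nonneg {B : ℝ} (hB : 0 ≤ B) (M : ℝ) : 0 ≤ velConst B M := by
  have : 0 ≤ accelConst M := Real.sqrt_nonneg _
  rw [velConst]; positivity

/-- A Landau-type argument: expanding over unit time expresses the first derivative through two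
states, bounded in `L²`, and the second-order remainder. -/
theorem abs_rate_le {ν : ℝ} {f : L2} {w ψx ψy : ℝ → L2} {B M : ℝ}
    (hB : ∀ t, 0 ≤ t → ‖w t‖ ≤ B)
    (hT : ∀ S z, 0 ∉ S → ∀ t, 0 < t → ∀ s, 0 ≤ s →
        |pair (w s) (trig S z) - pair (w t) (trig S z)
          - rate ν f (w t) (ψx t) (ψy t) S z * (s - t)|
          ≤ accelConst M * √(sobFin 4 S z) * (s - t) ^ 2)
    {S : Finset Freq} (hS : 0 ∉ S) (z : Freq → ℂ) {t : ℝ} (ht : 0 < t) :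
    |rate ν f (w t) (ψx t) (ψy t) S z| ≤ velConst B M * √(sobFin 4 S z) := by
  have h1 := hT S z hS t ht (t + 1) (by positivity)
  have hb : ∀ s, 0 ≤ s → |pair (w s) (trig S z)| ≤ B * √(sobFin 4 S z) := fun s hs =>
    (abs_pair_trig_le (w s) S z 4).trans (by gcongr; exact hB s hs)
  have h2 := abs_le.1 (hb t ht.le)
  have h3 := abs_le.1 (hb (t + 1) (by positivity))
  rw [add_sub_cancel_left, mul_one, one_pow, mul_one] at h1
  have h4 := abs_le.1 h1
  rw [velConst, abs_le]
  constructor <;> linarith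

theorem le_div_of_mul_sq_le {ν x R : ℝ} (hν : 0 < ν) (hx : 0 ≤ x) (hR : 0 ≤ R)
    (h : ν * x ^ 2 ≤ R * x) : x ≤ R / ν := by
  rw [le_div_iff₀ hν]
  rcases hx.eq_or_lt with rfl | hx
  · simpa using hR
  · nlinarith

theorem pair_lap_trig_mul (a : L2) {S : Finset Freq} (hS : 0 ∉ S) (m : Freq → ℝ) :
    pair a (lap (trig S fun k => m k * coeff a k))
      = -∑ k ∈ S, wt k ^ 4 * m k * ‖coeff a k‖ ^ 2 := by
  rw [lap_trig hS, pair_trig, ← Finset.sum_neg_distrib]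
  refine Finset.sum_congr rfl fun k _ => ?_
  rw [← Complex.normSq_eq_norm_sq, show -((wt k ^ 4 : ℝ) : ℂ) * (m k * coeff a k)
    * (starRingEnd ℂ) (coeff a k) = ((-(wt k ^ 4 * m k) : ℝ) : ℂ)
      * ((starRingEnd ℂ) (coeff a k) * coeff a k) by push_cast; ring,
    ← Complex.normSq_eq_conj_mul_self, ← Complex.ofReal_mul, Complex.ofReal_re]
  ring

theorem pair_lap_trig_coeff (a : L2) {S : Finset Freq} (hS : 0 ∉ S) :
    pair a (lap (trig S (coeff a))) = -sobFin 4 S (coeff a) := by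
  have h := pair_lap_trig_mul a hS fun _ => 1
  simpa [sobFin] using h

/-- The `H^{3/4}` bound for states with time derivative in `H⁻¹`. -/
noncomputable def lowRegConst (ν K F B : ℝ) : ℝ := (K + F + transportConst * B ^ 2) / ν

/-- The `H¹` bound for states with time derivative in `H⁻¹`. -/
noncomputable def regConst (ν K F B : ℝ) : ℝ :=
  (K + F + transportConst * lowRegConst ν K F B * B) / ν

theorem lowRegConst_nonneg {ν K F B : ℝ} (hν : 0 < ν) (hK : 0 ≤ K) (hF : 0 ≤ F) :
    0 ≤ lowRegConst ν K F B := by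
  have := transportConst_nonneg
  rw [lowRegConst]; positivity

theorem regConst_nonneg {ν K F B : ℝ} (hν : 0 < ν) (hK : 0 ≤ K) (hF : 0 ≤ F) (hB : 0 ≤ B) :
    0 ≤ regConst ν K F B := by
  have := transportConst_nonneg
  have := lowRegConst_nonneg (B := B) hν hK hF
  rw [regConst]; positivity

/-- Elliptic regularity for the stationary problem with a right hand side in `H⁻¹`. -/
theorem inSob_of_abs_rate_le {ν : ℝ} (hν : 0 < ν) {f a ψ ψx ψy : L2} (ha0 : coeff a 0 = 0)
    (hs : IsStream a ψ ψx ψy) {K F B : ℝ} (hK : 0 ≤ K) (hF : ‖f‖ ≤ F) (hB : ‖a‖ ≤ B)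
    (h : ∀ S z, 0 ∉ S → |rate ν f a ψx ψy S z| ≤ K * √(sobFin 4 S z)) :
    InSob 4 a ∧ sob 4 a ≤ regConst ν K F B ^ 2 := by
  have hF0 : 0 ≤ F := (norm_nonneg f).trans hF
  have hB0 : 0 ≤ B := (norm_nonneg a).trans hB
  have hC := transportConst_nonneg
  have hR := lowRegConst_nonneg (B := B) hν hK hF0
  have low : ∀ N, sobFin 3 (box N) (coeff a) ≤ lowRegConst ν K F B ^ 2 := by
    intro N
    have hS := zero_notMem_box N
    -- Testing with `|∇|^{-1/2} a`: viscosity controls the squared `H^{3/4}` norm of `a`, and the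
    -- `H^{5/4}` norm of the test function is that same `H^{3/4}` norm, so transport needs only `L²`
    -- bounds on `a`.
    set z : Freq → ℂ := fun k => ((wt k)⁻¹ : ℝ) * coeff a k
    have hz : ∀ j, sobFin (j + 2) (box N) z = sobFin j (box N) (coeff a) := by
      intro j
      refine Finset.sum_congr rfl fun k _ => ?_
      have := wt_pos k
      rw [norm_mul, Complex.norm_real, Real.norm_eq_abs, mul_pow, sq_abs]
      field_simp
      ring
    have h1 := h (box N) z hS
    rw [rate, pair_lap_trig_mul a hS] at h1
    have h2 : ∑ k ∈ box N, wt k ^ 4 * (wt k)⁻¹ * ‖coeff a k‖ ^ 2 = sobFin 3 (box N) (coeff a) := by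
      refine Finset.sum_congr rfl fun k _ => ?_
      have := wt_pos k
      field_simp
    rw [h2] at h1
    have h3 := abs_transport_le_sob_test (a := a) hs (box N) z
    have h4 := abs_pair_trig_le f (box N) z 4
    rw [hz 3] at h3
    rw [hz 2] at h4 h1
    set x := √(sobFin 3 (box N) (coeff a))
    have hx : x ^ 2 = sobFin 3 (box N) (coeff a) := Real.sq_sqrt (sobFin_nonneg _ _ _)
    have hx0 : 0 ≤ x := Real.sqrt_nonneg _
    have hy : √(sobFin 2 (box N) (coeff a)) ≤ x := Real.sqrt_le_sqrt (sobFin_mono (by norm_num) _ _)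
    have h5 : transportConst * ‖a‖ * ‖a‖ * x ≤ transportConst * B * B * x := by gcongr
    have h6 : ‖f‖ * √(sobFin 2 (box N) (coeff a)) ≤ F * x := by gcongr
    have h7 : K * √(sobFin 2 (box N) (coeff a)) ≤ K * x := by gcongr
    rw [← hx] at h1 ⊢
    have h8 := abs_le.1 h1
    have h9 := abs_le.1 h3
    have h10 := abs_le.1 h4
    have h11 : x ≤ lowRegConst ν K F B := by
      refine le_div_of_mul_sq_le hν hx0 (by positivity) ?_
      linarith
    gcongr
  obtain ⟨h3, h3'⟩ := inSob_of_sobFin_le ha0 low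
  have h1' : InSob 1 a := h3.mono (by norm_num)
  have hle : √(sob 1 a) ≤ lowRegConst ν K F B :=
    (Real.sqrt_le_left hR).2 ((h3.sob_mono (by norm_num)).trans h3')
  -- Second round: `a` is now known in `H^{1/4}`, so it can be tested with its own truncation.
  refine inSob_of_sobFin_le ha0 fun N => ?_
  have hS := zero_notMem_box N
  have h1 := h (box N) (coeff a) hS
  rw [rate, pair_lap_trig_coeff a hS] at h1
  have h2 := abs_transport_le_sob_left hs (box N) (coeff a) h1'
  have h4 := abs_pair_trig_le f (box N) (coeff a) 4
  set x := √(sobFin 4 (box N) (coeff a))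
  have hx : x ^ 2 = sobFin 4 (box N) (coeff a) := Real.sq_sqrt (sobFin_nonneg _ _ _)
  have hx0 : 0 ≤ x := Real.sqrt_nonneg _
  have h5 : transportConst * √(sob 1 a) * ‖a‖ * x ≤ transportConst * lowRegConst ν K F B * B * x := by
    gcongr
  have h6 : ‖f‖ * x ≤ F * x := by gcongr
  rw [← hx] at h1 ⊢
  have h8 := abs_le.1 h1
  have h9 := abs_le.1 h2
  have h10 := abs_le.1 h4
  have h11 : x ≤ regConst ν K F B := by
    refine le_div_of_mul_sq_le hν hx0 (by positivity) ?_
    linarith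
  gcongr

/-- Invariance places each point at time `1` of a trajectory in the attractor, where the derivative
bounds hold. -/
theorem sob_four_le_of_mem {ν : ℝ} (hν : 0 < ν) {f : L2} {A : Set L2} (hA : IsGlobalAttractor ν f A)
    (hMV : MV ν f A < ⊤) {F B : ℝ} (hF : ‖f‖ ≤ F) (hB : ∀ a ∈ A, ‖a‖ ≤ B) {a : L2} (ha : a ∈ A) :
    InSob 4 a ∧ sob 4 a ≤ regConst ν (velConst B (MV ν f A).toReal) F B ^ 2 := by
  obtain ⟨w, hw, hw0, rfl⟩ := hA.maps_onto a ha 1 zero_le_one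
  obtain ⟨ψ, ψx, ψy, hs, hT⟩ := exists_stream_taylor hMV hw hw0
  have hB' : ∀ t, 0 ≤ t → ‖w t‖ ≤ B := fun t ht => hB _ (hA.maps_into w hw hw0 t ht)
  have hB0 : 0 ≤ B := (norm_nonneg _).trans (hB _ ha)
  exact inSob_of_abs_rate_le hν (hA.meanZero _ ha).coeff_zero (hs 1 zero_le_one)
    (velConst_nonneg hB0 _) hF (hB _ ha)
    fun S z hS => abs_rate_le hB' hT hS z one_pos

/-- The `L²` bound on the attractor. -/
theorem norm_le_of_mem {ν : ℝ} (hν : 0 < ν) {f : L2} {A : Set L2} (hA : IsGlobalAttractor ν f A)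
    (hMV : MV ν f A < ⊤) {b : L2} (hb : b ∈ A) : ‖b‖ ≤ ‖f‖ / ν := by
  -- It suffices to bound the largest norm; at a maximizer the energy cannot be decreasing along a
  -- trajectory arriving there.
  obtain ⟨a, ha, hmax⟩ := hA.isCompact.exists_isMaxOn ⟨b, hb⟩ continuous_norm.continuousOn
  have hmax' : ∀ c ∈ A, ‖c‖ ≤ ‖a‖ := fun c hc => hmax hc
  refine (hmax' b hb).trans ?_
  have hreg := (sob_four_le_of_mem hν hA hMV le_rfl hmax' ha).1
  have ha0 := (hA.meanZero _ ha).coeff_zero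
  obtain ⟨w, hw, hw0, hwa⟩ := hA.maps_onto a ha 1 zero_le_one
  obtain ⟨ψ, ψx, ψy, hs, hT⟩ := exists_stream_taylor hMV hw hw0
  have hs1 := hs 1 zero_le_one
  rw [hwa] at hs1
  set κ := accelConst (MV ν f A).toReal
  have hpair := fun V : L2 => tendsto_pair_trunc V ha0
  have hsob := tendsto_sobFin_box hreg ha0
  have htr : Tendsto (fun N => transport a (ψx 1) (ψy 1) (trig (box N) (coeff a))) atTop (𝓝 0) := by
    have hb0 := tendsto_transport_bound a (hreg.mono (by norm_num : 1 ≤ 4)) ha0 hreg ha0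
    have hz : sob 1 (a - a) = 0 := by
      simp_rw [sob, coeff_sub]
      simp
    rw [hz, Real.sqrt_zero, mul_zero, zero_mul, zero_mul] at hb0
    refine squeeze_zero_norm (fun N => ?_) hb0
    have := abs_transport_trunc_le (hreg.mono (by norm_num : 1 ≤ 4))
      (hreg.mono (by norm_num : 1 ≤ 4)) hs1 N
    rwa [hz] at this
  have hrate : Tendsto (fun N => rate ν f a (ψx 1) (ψy 1) (box N) (coeff a)) atTop
      (𝓝 (ν * -sob 4 a + 0 + inner ℝ f a)) := by
    refine ((Tendsto.const_mul ν ?_).add htr).add (hpair f)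
    refine hsob.neg.congr fun N => ?_
    rw [pair_lap_trig_coeff a (zero_notMem_box N)]
  set D := ν * -sob 4 a + 0 + inner ℝ f a with hD
  -- `D` is the derivative of `(w(t), a)` at `t = 1`. Earlier states have norm at most `‖a‖`, so
  -- this pairing was no larger before; a negative `D` would contradict the Taylor expansion at `1 -
  -- e`.
  have hD0 : 0 ≤ D := by
    by_contra hneg
    push Not at hneg
    have key : ∀ e, 0 < e → e ≤ 1 → -D * e ≤ κ * √(sob 4 a) * e ^ 2 := by
      intro e he he1
      have h1 : |inner ℝ (w (1 - e)) a - inner ℝ a a - D * ((1 - e) - 1)|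
          ≤ κ * √(sob 4 a) * ((1 - e) - 1) ^ 2 := by
        refine le_of_tendsto_of_tendsto' (((hpair (w (1 - e))).sub (hpair a)).sub
          (hrate.mul_const _)).abs ((hsob.sqrt.const_mul κ).mul_const _) fun N => ?_
        have := hT (box N) (coeff a) (zero_notMem_box N) 1 one_pos (1 - e) (by linarith)
        rwa [hwa] at this
      have h2 : inner ℝ (w (1 - e)) a ≤ inner ℝ a a := by
        rw [real_inner_self_eq_norm_sq]
        have h3 := hmax' _ (hA.maps_into w hw hw0 (1 - e) (by linarith))
        calc inner ℝ (w (1 - e)) a ≤ ‖w (1 - e)‖ * ‖a‖ := real_inner_le_norm _ _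
          _ ≤ ‖a‖ * ‖a‖ := by gcongr
          _ = _ := by ring
      have h4 := (abs_le.1 h1).1
      nlinarith
    set c := κ * √(sob 4 a) with hc
    have hc0 : 0 ≤ c := by
      have : 0 ≤ κ := Real.sqrt_nonneg _
      positivity
    have hq : 0 < min 1 (-D / (2 * (c + 1))) := lt_min one_pos (by
      have : 0 < -D := by linarith
      positivity)
    have h5 := key _ hq (min_le_left _ _)
    have h6 : min 1 (-D / (2 * (c + 1))) ≤ -D / (2 * (c + 1)) := min_le_right _ _
    set e := min 1 (-D / (2 * (c + 1)))
    rw [le_div_iff₀ (by positivity)] at h6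
    have h7 : -D ≤ c * e := by
      have : (-D) * e ≤ (c * e) * e := by linarith
      exact le_of_mul_le_mul_right this hq
    nlinarith
  have h8 : ‖a‖ ^ 2 ≤ sob 4 a := by rw [← sob_zero]; exact hreg.sob_mono (by norm_num)
  have h9 := real_inner_le_norm f a
  refine le_div_of_mul_sq_le hν (norm_nonneg _) (norm_nonneg _) ?_
  have h10 := mul_le_mul_of_nonneg_left h8 hν.le
  linarith

/-! ### The scheme -/

theorem pair_trig_mul_coeff (W : L2) (S : Finset Freq) (m : Freq → ℝ) :
    pair W (trig S fun k => m k * coeff W k) = ∑ k ∈ S, m k * ‖coeff W k‖ ^ 2 := by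
  rw [pair_trig]
  refine Finset.sum_congr rfl fun k _ => ?_
  rw [← Complex.normSq_eq_norm_sq, mul_assoc, mul_comm (coeff W k),
    ← Complex.normSq_eq_conj_mul_self, ← Complex.ofReal_mul, Complex.ofReal_re]

/-- One step of the scheme, tested against trigonometric polynomials. -/
def IsStep (ν τ : ℝ) (f V W ψx ψy : L2) : Prop :=
  ∀ S z, 0 ∉ S → pair W (trig S z) - pair V (trig S z)
    = τ * (transport V ψx ψy (trig S z) + ν * pair W (lap (trig S z)) + pair f (trig S z))

theorem IsSchemeSolution.exists_isStep {ν τ : ℝ} {f : L2} {W : ℕ → L2}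
    (h : IsSchemeSolution ν f τ W) (hτ : 0 < τ) (n : ℕ) :
    ∃ ψ ψx ψy : L2, IsStream (W n) ψ ψx ψy ∧ IsStep ν τ f (W n) (W (n + 1)) ψx ψy := by
  obtain ⟨ψ, ψx, ψy, hs, hstep⟩ := h.step n
  refine ⟨ψ, ψx, ψy, hs, fun S z _ => ?_⟩
  have h1 := hstep _ (isTest_trig S z)
  rw [transport]
  field_simp at h1
  linarith

/-- The implicit viscous term puts the new state in `H¹`. This is qualitative: the bound degenerates
as `τ → 0` and only justifies the limits in the energy method. -/
theorem IsStep.inSob {ν τ : ℝ} {f V W ψ ψx ψy : L2} (h : IsStep ν τ f V W ψx ψy) (hν : 0 < ν)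
    (hτ : 0 < τ) (hs : IsStream V ψ ψx ψy) (hV : InSob 1 V) (hW0 : coeff W 0 = 0) : InSob 4 W := by
  have hC := transportConst_nonneg
  set R := ‖V‖ + τ * (transportConst * √(sob 1 V) * ‖V‖) + τ * ‖f‖ with hR
  have hR0 : 0 ≤ R := by positivity
  refine (inSob_of_sobFin_le (B := (R / (ν * τ)) ^ 2) hW0 fun N => ?_).1
  have h1 := h (box N) (coeff W) (zero_notMem_box N)
  rw [pair_lap_trig_coeff W (zero_notMem_box N), pair_trig_coeff_self] at h1
  have h2 := (abs_le.1 (abs_transport_le_sob_left hs (box N) (coeff W) hV)).2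
  have h3 := (abs_le.1 (abs_pair_trig_le V (box N) (coeff W) 4)).2
  have h4 := (abs_le.1 (abs_pair_trig_le f (box N) (coeff W) 4)).2
  have h5 := sobFin_nonneg 0 (box N) (coeff W)
  set x := √(sobFin 4 (box N) (coeff W))
  have hx : x ^ 2 = sobFin 4 (box N) (coeff W) := Real.sq_sqrt (sobFin_nonneg _ _ _)
  have hx0 : 0 ≤ x := Real.sqrt_nonneg _
  rw [← hx] at h1 ⊢
  have h6 := mul_le_mul_of_nonneg_left h2 hτ.le
  have h7 := mul_le_mul_of_nonneg_left h4 hτ.le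
  have h8 : x ≤ R / (ν * τ) := by
    refine le_div_of_mul_sq_le (by positivity) hx0 hR0 ?_
    rw [hR]
    linarith
  gcongr

theorem IsStep.stepEnergy_le {ν τ : ℝ} {f V W ψ ψx ψy : L2} (h : IsStep ν τ f V W ψx ψy)
    (hν : 0 < ν) (hτ : 0 < τ) (hντ : ν * τ ≤ 1) (hs : IsStream V ψ ψx ψy) (hV : InSob 2 V)
    (hV0 : coeff V 0 = 0) (hW : InSob 4 W) (hW0 : coeff W 0 = 0) {B : ℝ} (hB : ‖V‖ ≤ B)
    (hsmall : 16 * τ * stepConst B ν ^ 2 ≤ ν) :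
    stepEnergy (ν * τ) W * (1 + ν * τ / 2) ≤ stepEnergy (ν * τ) V + τ * (‖f‖ ^ 2 / ν) := by
  refine NSE2D.stepEnergy_le hV hV0 hW hW0 hs hν hτ hντ hB hsmall fun N => ?_
  have h1 := h (box N) (coeff W) (zero_notMem_box N)
  rw [pair_lap_trig_coeff W (zero_notMem_box N)] at h1
  have h4 := (abs_le.1 (abs_pair_trig_le f (box N) (coeff W) 4)).2
  have h7 := mul_le_mul_of_nonneg_left h4 hτ.le
  linarith

/-- Energy of the first step, in terms of the `L²` norm of the initial state alone;
here `ν τ = ξ ^ 4`. -/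
theorem IsStep.stepEnergy_initial_le {ν τ ξ : ℝ} {f V W ψ ψx ψy : L2}
    (h : IsStep ν τ f V W ψx ψy) (hν : 0 < ν) (hξ : 0 < ξ) (hξ1 : ξ ≤ 1) (hτξ : ν * τ = ξ ^ 4)
    (hs : IsStream V ψ ψx ψy) (hW : InSob 2 W) (hW0 : coeff W 0 = 0) :
    stepEnergy (ν * τ) W
      ≤ (‖V‖ + (τ * ‖f‖ + 2 * transportConst * ‖V‖ ^ 2 * ξ / ν)) ^ 2 := by
  have hC := transportConst_nonneg
  have hτe : τ = ξ ^ 4 / ν := by rw [← hτξ]; field_simp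
  have hτ : 0 < τ := by rw [hτe]; positivity
  have hfin : ∀ N, sobFin 0 (box N) (coeff W) + ν * τ / 16 * sobFin 2 (box N) (coeff W)
      ≤ (‖V‖ + (τ * ‖f‖ + 2 * transportConst * ‖V‖ ^ 2 * ξ / ν)) ^ 2 := by
    intro N
    set S := box N
    set E := sobFin 0 S (coeff W) + ν * τ / 16 * sobFin 2 S (coeff W) with hE
    have hEsum : E = ∑ k ∈ S, (1 + ξ ^ 4 * wt k ^ 2 / 16) * ‖coeff W k‖ ^ 2 := by
      rw [hE, hτξ, sobFin, sobFin, Finset.mul_sum, ← Finset.sum_add_distrib]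
      exact Finset.sum_congr rfl fun k _ => by ring
    -- The multiplier solves `(1 + ν τ |k|²) m = 1 + ν τ |k| / 16`, so testing with `m` times the
    -- coefficients of `W` produces exactly the discrete energy.
    set m : Freq → ℝ := fun k => (1 + ξ ^ 4 * wt k ^ 2 / 16) / (1 + ξ ^ 4 * wt k ^ 4) with hm
    have hmpos : ∀ k, 0 ≤ m k := fun k => by rw [hm]; positivity
    have hm1 : ∀ k, m k ≤ 1 := fun k => by
      rw [hm]
      simp only
      have hk := one_le_wt k
      rw [div_le_one (by positivity)]
      have h1 : wt k ^ 2 ≤ wt k ^ 4 := pow_le_pow_right₀ hk (by norm_num)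
      have h2 := mul_le_mul_of_nonneg_left h1 (by positivity : 0 ≤ ξ ^ 4)
      have h3 : 0 ≤ ξ ^ 4 * wt k ^ 2 := by positivity
      linarith
    have h1 := h S (fun k => m k * coeff W k) (zero_notMem_box N)
    rw [pair_lap_trig_mul W (zero_notMem_box N), pair_trig_mul_coeff] at h1
    have hlhs : E = ∑ k ∈ S, m k * ‖coeff W k‖ ^ 2
        + τ * (ν * ∑ k ∈ S, wt k ^ 4 * m k * ‖coeff W k‖ ^ 2) := by
      rw [hEsum, ← mul_assoc, mul_comm τ ν, hτξ, Finset.mul_sum, ← Finset.sum_add_distrib]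
      refine Finset.sum_congr rfl fun k _ => ?_
      have : (1 + ξ ^ 4 * wt k ^ 2 / 16) = m k * (1 + ξ ^ 4 * wt k ^ 4) := by
        rw [hm]
        have := wt_pos k
        field_simp
      rw [this]
      ring
    set z : Freq → ℂ := fun k => m k * coeff W k
    have hnz : ∀ k, ‖z k‖ ^ 2 = m k ^ 2 * ‖coeff W k‖ ^ 2 := fun k => by
      rw [norm_mul, Complex.norm_real, Real.norm_eq_abs, mul_pow, sq_abs]
    have hE0 : 0 ≤ E := by rw [hEsum]; exact Finset.sum_nonneg fun k _ => by positivity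
    have hz0 : sobFin 0 S z ≤ E := by
      rw [hEsum]
      refine Finset.sum_le_sum fun k _ => ?_
      rw [hnz, pow_zero, one_mul]
      have h2 : m k ^ 2 ≤ 1 := pow_le_one₀ (hmpos k) (hm1 k)
      have h3 : 0 ≤ ξ ^ 4 * wt k ^ 2 / 16 := by positivity
      gcongr
      linarith
    -- The `H^{5/4}` norm of the test function costs `ξ ^ (-3)`, while `τ = ξ ^ 4 / ν`; the
    -- transport term keeps one small factor `ξ`.
    have hz5 : sobFin 5 S z ≤ (2 / ξ ^ 3) ^ 2 * E := by
      rw [hEsum, Finset.mul_sum]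
      refine Finset.sum_le_sum fun k _ => ?_
      rw [hnz, ← mul_assoc, ← mul_assoc]
      refine mul_le_mul_of_nonneg_right ?_ (sq_nonneg _)
      have hk := one_le_wt k
      set r := wt k
      have hq : m k ^ 2 = (1 + ξ ^ 4 * r ^ 2 / 16) ^ 2 / (1 + ξ ^ 4 * r ^ 4) ^ 2 := by
        rw [hm]; simp only; rw [div_pow]
      rw [hq, ← mul_div_assoc, div_le_iff₀ (by positivity), div_pow]
      have hu : 0 < 1 + ξ ^ 4 * r ^ 2 / 16 := by positivity
      have key : r ^ 5 * (1 + ξ ^ 4 * r ^ 2 / 16) * ξ ^ 6 ≤ 4 * (1 + ξ ^ 4 * r ^ 4) ^ 2 := by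
        set y := ξ * r
        have hy : 0 ≤ y := by positivity
        have a1 : r ^ 5 * ξ ^ 6 ≤ y ^ 6 := by
          have : r ^ 5 ≤ r ^ 6 := pow_le_pow_right₀ hk (by norm_num)
          calc r ^ 5 * ξ ^ 6 ≤ r ^ 6 * ξ ^ 6 := by gcongr
            _ = y ^ 6 := by ring
        have a2 : r ^ 7 * ξ ^ 10 ≤ y ^ 8 := by
          have b1 : r ^ 7 ≤ r ^ 8 := pow_le_pow_right₀ hk (by norm_num)
          have b2 : ξ ^ 10 ≤ ξ ^ 8 := pow_le_pow_of_le_one hξ.le hξ1 (by norm_num)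
          calc r ^ 7 * ξ ^ 10 ≤ r ^ 8 * ξ ^ 8 := by gcongr
            _ = y ^ 8 := by ring
        have a3 : y ^ 6 ≤ y ^ 4 + y ^ 8 := by
          nlinarith [sq_nonneg (y ^ 2 - y ^ 4), pow_nonneg hy 4, pow_nonneg hy 8]
        have a4 : ξ ^ 4 * r ^ 4 = y ^ 4 := by ring
        have a5 : 0 ≤ y ^ 4 := by positivity
        have a6 : 0 ≤ y ^ 8 := by positivity
        rw [a4]
        nlinarith
      have h5 := mul_le_mul_of_nonneg_right key hu.le
      rw [show ((2 : ℝ) ^ 2 / (ξ ^ 3) ^ 2 * (1 + ξ ^ 4 * r ^ 2 / 16) * (1 + ξ ^ 4 * r ^ 4) ^ 2)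
        = (4 * (1 + ξ ^ 4 * r ^ 4) ^ 2 * (1 + ξ ^ 4 * r ^ 2 / 16)) / ξ ^ 6 by field_simp; ring,
        le_div_iff₀ (by positivity)]
      linarith
    have h2 := (abs_le.1 (abs_transport_le_sob_test (a := V) hs S z)).2
    have h3 := (abs_le.1 (abs_pair_trig_le V S z 0)).2
    have h4 := (abs_le.1 (abs_pair_trig_le f S z 0)).2
    set x := √E
    have hx : x ^ 2 = E := Real.sq_sqrt hE0
    have hx0 : 0 ≤ x := Real.sqrt_nonneg _
    have hs0 : √(sobFin 0 S z) ≤ x := Real.sqrt_le_sqrt hz0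
    have hs5 : √(sobFin 5 S z) ≤ 2 / ξ ^ 3 * x := by
      refine (Real.sqrt_le_sqrt hz5).trans_eq ?_
      rw [Real.sqrt_mul (by positivity), Real.sqrt_sq (by positivity)]
    have h5 : transportConst * ‖V‖ * ‖V‖ * √(sobFin 5 S z)
        ≤ transportConst * ‖V‖ * ‖V‖ * (2 / ξ ^ 3 * x) := by gcongr
    have h6 := mul_le_mul_of_nonneg_left (h2.trans h5) hτ.le
    have h7 : τ * (transportConst * ‖V‖ * ‖V‖ * (2 / ξ ^ 3 * x))
        = 2 * transportConst * ‖V‖ ^ 2 * ξ / ν * x := by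
      rw [hτe]; field_simp
    have h8 : pair V (trig S z) ≤ ‖V‖ * x := h3.trans (by gcongr)
    have h9 : τ * pair f (trig S z) ≤ τ * (‖f‖ * x) := by
      have := h4.trans (mul_le_mul_of_nonneg_left hs0 (norm_nonneg f))
      gcongr
    have h10 : x ^ 2 ≤ (‖V‖ + (τ * ‖f‖ + 2 * transportConst * ‖V‖ ^ 2 * ξ / ν)) * x := by
      rw [hx, hlhs]
      linarith
    have h11 : x ≤ ‖V‖ + (τ * ‖f‖ + 2 * transportConst * ‖V‖ ^ 2 * ξ / ν) := by
      have := le_div_of_mul_sq_le one_pos hx0 (by positivity :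
        0 ≤ ‖V‖ + (τ * ‖f‖ + 2 * transportConst * ‖V‖ ^ 2 * ξ / ν)) (by rwa [one_mul])
      rwa [div_one] at this
    rw [← hx]
    gcongr
  rw [stepEnergy, ← sob_zero]
  exact le_of_tendsto' ((tendsto_sobFin_box (inSob_zero W) hW0).add ((tendsto_sobFin_box hW hW0).const_mul _)) hfin

/-! ### Uniform stability of the scheme -/

/-- The upper bound on the fourth root of `ν Δt` used for the first step. -/
noncomputable def rootStep (a ν : ℝ) : ℝ := min 1 (ν / (8 * (transportConst * |a| + 1)))

/-- The admissible time steps. -/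
noncomputable def maxStep (a ν F : ℝ) : ℝ :=
  min (1 / (4 * ν)) (min (rootStep a ν ^ 4 / ν) (ν / (16 * stepConst (M0 a ν F) ν ^ 2 + 1)))

theorem rootStep_pos (a : ℝ) {ν : ℝ} (hν : 0 < ν) : 0 < rootStep a ν := by
  have := transportConst_nonneg
  exact lt_min one_pos (by positivity)

theorem maxStep_pos (a F : ℝ) {ν : ℝ} (hν : 0 < ν) : 0 < maxStep a ν F := by
  have := rootStep_pos a hν
  exact lt_min (by positivity) (lt_min (by positivity) (by positivity))

theorem M0_sq (a ν F : ℝ) : M0 a ν F ^ 2 = a ^ 2 + 2 / ν ^ 2 * F ^ 2 := by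
  rw [M0, Real.sq_sqrt (by positivity)]

theorem M0_nonneg (a ν F : ℝ) : 0 ≤ M0 a ν F := Real.sqrt_nonneg _

theorem le_M0 (a ν F : ℝ) : a ≤ M0 a ν F :=
  Real.le_sqrt_of_sq_le (by have : 0 ≤ 2 / ν ^ 2 * F ^ 2 := by positivity
                            linarith)

/-- With `‖V‖ ≤ ‖f‖/ν` and an increment `η ≤ ‖f‖/(2ν)`, the excess `2‖V‖η + η²` is at most
`(5/4)(‖f‖/ν)²`, within the `2(‖f‖/ν)²` allowed by `M₀²`. -/
theorem stepEnergy_one_le {ν τ : ℝ} {f V W ψ ψx ψy : L2} (h : IsStep ν τ f V W ψx ψy)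
    (hν : 0 < ν) (hτ : 0 < τ) (hs : IsStream V ψ ψx ψy) (hW : InSob 2 W) (hW0 : coeff W 0 = 0)
    (hV : ‖V‖ ≤ ‖f‖ / ν) (hsmall : τ < maxStep ‖V‖ ν ‖f‖) :
    stepEnergy (ν * τ) W ≤ M0 ‖V‖ ν ‖f‖ ^ 2 := by
  have hC := transportConst_nonneg
  have hτ1 : τ < 1 / (4 * ν) := hsmall.trans_le (min_le_left _ _)
  have hτ2 : τ < rootStep ‖V‖ ν ^ 4 / ν :=
    hsmall.trans_le ((min_le_right _ _).trans (min_le_left _ _))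
  have hr := rootStep_pos ‖V‖ hν
  rw [lt_div_iff₀ hν, mul_comm] at hτ2
  set ξ := √(√(ν * τ))
  have hξ : 0 < ξ := Real.sqrt_pos.2 (Real.sqrt_pos.2 (by positivity))
  have hξ4 : ν * τ = ξ ^ 4 := by
    rw [show 4 = 2 * 2 from rfl, pow_mul, Real.sq_sqrt (Real.sqrt_nonneg _),
      Real.sq_sqrt (by positivity)]
  have hξr : ξ ≤ rootStep ‖V‖ ν :=
    le_of_pow_le_pow_left₀ (by norm_num : 4 ≠ 0) hr.le (hξ4 ▸ hτ2.le)
  have h1 := h.stepEnergy_initial_le hν hξ (hξr.trans (min_le_left _ _)) hξ4 hs hW hW0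
  refine h1.trans ?_
  rw [M0_sq]
  have hξ2 : ξ ≤ ν / (8 * (transportConst * ‖V‖ + 1)) := by
    have := hξr.trans (min_le_right _ _)
    rwa [abs_of_nonneg (norm_nonneg V)] at this
  rw [le_div_iff₀ (by positivity)] at hξ2
  have hg1 : transportConst * ‖V‖ * ξ ≤ ν / 8 := by nlinarith
  have hF : ‖V‖ * ν ≤ ‖f‖ := (le_div_iff₀ hν).1 hV
  -- Half of this budget is for the forcing, through `τ < 1/(4ν)`, and half for transport, through
  -- the smallness of `ξ`.
  have hη : τ * ‖f‖ + 2 * transportConst * ‖V‖ ^ 2 * ξ / ν ≤ ‖f‖ / (2 * ν) := by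
    have e1 : τ * ‖f‖ ≤ 1 / (4 * ν) * ‖f‖ := by gcongr
    have e2 : 2 * transportConst * ‖V‖ ^ 2 * ξ / ν ≤ 2 * (ν / 8) * (‖f‖ / ν) / ν := by
      rw [show 2 * transportConst * ‖V‖ ^ 2 * ξ = 2 * (transportConst * ‖V‖ * ξ) * ‖V‖ by ring]
      gcongr
    have e3 : 1 / (4 * ν) * ‖f‖ + 2 * (ν / 8) * (‖f‖ / ν) / ν = ‖f‖ / (2 * ν) := by
      field_simp; ring
    linarith
  set η := τ * ‖f‖ + 2 * transportConst * ‖V‖ ^ 2 * ξ / ν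
  have hη0 : 0 ≤ η := by positivity
  have e4 : ‖V‖ * η ≤ (‖f‖ / ν) * (‖f‖ / (2 * ν)) := by gcongr
  have e5 : η ^ 2 ≤ (‖f‖ / (2 * ν)) ^ 2 := by gcongr
  have e6 : 2 / ν ^ 2 * ‖f‖ ^ 2 - 2 * ((‖f‖ / ν) * (‖f‖ / (2 * ν))) - (‖f‖ / (2 * ν)) ^ 2
      = 3 / 4 * (‖f‖ / ν) ^ 2 := by field_simp; ring
  have e7 : 0 ≤ 3 / 4 * (‖f‖ / ν) ^ 2 := by positivity
  nlinarith

theorem IsSchemeSolution.inSob {ν τ : ℝ} {f : L2} {W : ℕ → L2} (h : IsSchemeSolution ν f τ W)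
    (hν : 0 < ν) (hτ : 0 < τ) (h0 : InSob 4 (W 0)) (n : ℕ) : InSob 4 (W n) := by
  induction n with
  | zero => exact h0
  | succ n ih =>
    obtain ⟨ψ, ψx, ψy, hs, hst⟩ := h.exists_isStep hτ n
    exact hst.inSob hν hτ hs (ih.mono (by norm_num)) (h.meanZero _).coeff_zero

/-- The induction propagates the energy bound from index one on, since the energy at index zero is
not controlled by `‖W 0‖`. The bound persists because `2‖f‖²/ν²`, the equilibrium of the energy
recursion, is at most `M₀²`. -/
theorem IsSchemeSolution.norm_le {ν τ : ℝ} {f : L2} {W : ℕ → L2} (h : IsSchemeSolution ν f τ W)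
    (hν : 0 < ν) (hτ : 0 < τ) (h0 : InSob 4 (W 0)) (hV : ‖W 0‖ ≤ ‖f‖ / ν)
    (hsmall : τ < maxStep ‖W 0‖ ν ‖f‖) (n : ℕ) : ‖W n‖ ≤ M0 ‖W 0‖ ν ‖f‖ := by
  set B := M0 ‖W 0‖ ν ‖f‖ with hB
  have hB0 : 0 ≤ B := M0_nonneg _ _ _
  have hτ1 : τ < 1 / (4 * ν) := hsmall.trans_le (min_le_left _ _)
  have hτ3 : τ < ν / (16 * stepConst B ν ^ 2 + 1) :=
    hsmall.trans_le ((min_le_right _ _).trans (min_le_right _ _))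
  rw [lt_div_iff₀ (by positivity)] at hτ1 hτ3
  have hντ : 0 < ν * τ := by positivity
  have key : ∀ n, stepEnergy (ν * τ) (W (n + 1)) ≤ B ^ 2 := by
    intro n
    induction n with
    | zero =>
      obtain ⟨ψ, ψx, ψy, hs, hst⟩ := h.exists_isStep hτ 0
      exact stepEnergy_one_le hst hν hτ hs ((h.inSob hν hτ h0 1).mono (by norm_num))
        (h.meanZero 1).coeff_zero hV hsmall
    | succ n ih =>
      obtain ⟨ψ, ψx, ψy, hs, hst⟩ := h.exists_isStep hτ (n + 1)
      have hn : ‖W (n + 1)‖ ≤ B :=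
        le_of_pow_le_pow_left₀ two_ne_zero hB0 ((norm_sq_le_stepEnergy hντ.le _).trans ih)
      have h1 := hst.stepEnergy_le hν hτ (by linarith) hs
        ((h.inSob hν hτ h0 (n + 1)).mono (by norm_num)) (h.meanZero _).coeff_zero
        (h.inSob hν hτ h0 (n + 2)) (h.meanZero _).coeff_zero hn (by linarith)
      have h2 : τ * (‖f‖ ^ 2 / ν) ≤ ν * τ / 2 * B ^ 2 := by
        have e : τ * (‖f‖ ^ 2 / ν) = ν * τ / 2 * (2 / ν ^ 2 * ‖f‖ ^ 2) := by field_simp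
        rw [e, hB, M0_sq]
        gcongr
        have := sq_nonneg ‖W 0‖
        linarith
      have h3 : stepEnergy (ν * τ) (W (n + 1 + 1)) * (1 + ν * τ / 2) ≤ B ^ 2 * (1 + ν * τ / 2) := by
        linarith
      exact le_of_mul_le_mul_right h3 (by positivity)
  cases n with
  | zero => exact le_M0 _ _ _
  | succ n => exact le_of_pow_le_pow_left₀ two_ne_zero hB0 ((norm_sq_le_stepEnergy hντ.le _).trans (key n))

/-! ### Error estimate -/

/-- The bound on the `H¹` norm on the attractor in terms of `M₀`, `M_V` and `ν`. -/
noncomputable def attrConst (B M ν : ℝ) : ℝ := regConst ν (velConst B M) (ν * B) B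

/-- The bound on `‖ω(t + Δt) - ω(t)‖² / Δt`. -/
noncomputable def incrConst (B M ν : ℝ) : ℝ :=
  2 * attrConst B M ν * (velConst B M + accelConst M)

/-- Duality: the increment is `O(τ)` in `H⁻¹` and only bounded in `H¹`. This yields `τ`, not `τ²`,
and thereby fixes the order of the final estimate. -/
theorem norm_sub_sq_le {ν : ℝ} {f : L2} {w ψx ψy : ℝ → L2} {B M H : ℝ} (hB0 : 0 ≤ B)
    (hB : ∀ t, 0 ≤ t → ‖w t‖ ≤ B) (hm : ∀ t, 0 ≤ t → MeanZero (w t)) (hH0 : 0 ≤ H)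
    (hH : ∀ t, 0 ≤ t → InSob 4 (w t) ∧ sob 4 (w t) ≤ H ^ 2)
    (hT : ∀ S z, 0 ∉ S → ∀ t, 0 < t → ∀ s, 0 ≤ s →
        |pair (w s) (trig S z) - pair (w t) (trig S z)
          - rate ν f (w t) (ψx t) (ψy t) S z * (s - t)|
          ≤ accelConst M * √(sobFin 4 S z) * (s - t) ^ 2)
    {s τ : ℝ} (hs : 0 ≤ s) (hτ : 0 < τ) (hτ1 : τ ≤ 1) :
    ‖w (s + τ) - w s‖ ^ 2 ≤ 2 * H * (velConst B M + accelConst M) * τ := by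
  have hst : 0 < s + τ := by positivity
  set d := w (s + τ) - w s with hd
  have hd0 : coeff d 0 = 0 := by
    rw [hd, coeff_sub, (hm _ hst.le).coeff_zero, (hm _ hs).coeff_zero, sub_zero]
  have hK2 : 0 ≤ accelConst M := Real.sqrt_nonneg _
  have hK1 := velConst_nonneg hB0 M
  have hreg := (hH _ hst.le).1.sub (hH _ hs).1
  have hdsob : √(sob 4 d) ≤ 2 * H := by
    refine (Real.sqrt_le_left (by positivity)).2 ?_
    have := (hH _ hst.le).1.sob_sub_le (hH _ hs).1
    have h1 := (hH _ hst.le).2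
    have h2 := (hH _ hs).2
    linarith
  rw [← sob_zero]
  refine (inSob_of_sobFin_le hd0 fun N => ?_).2
  have hS := zero_notMem_box N
  rw [← pair_trig_coeff_self, hd, pair_sub_trig, ← hd]
  have h1 := (abs_le.1 (hT _ (coeff d) hS _ hst s hs)).2
  have h1' := (abs_le.1 (hT _ (coeff d) hS _ hst s hs)).1
  have h2 := (abs_le.1 (abs_rate_le hB hT hS (coeff d) hst)).2
  have hx : √(sobFin 4 (box N) (coeff d)) ≤ 2 * H :=
    (Real.sqrt_le_sqrt (hreg.sobFin_le _)).trans hdsob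
  set x := √(sobFin 4 (box N) (coeff d))
  have hx0 : 0 ≤ x := Real.sqrt_nonneg _
  have e : s - (s + τ) = -τ := by ring
  rw [e] at h1 h1'
  have h3 := mul_le_mul_of_nonneg_right h2 hτ.le
  have h4 : accelConst M * x * (-τ) ^ 2 ≤ accelConst M * x * τ := by
    have : (-τ) ^ 2 ≤ τ := by nlinarith
    gcongr
  have h5 : (velConst B M + accelConst M) * τ * x ≤ (velConst B M + accelConst M) * τ * (2 * H) := by
    gcongr
  linarith

/-- One step of the error equation. -/
theorem error_step {ν τ : ℝ} {f : L2} {V W v w ψ ψx ψy χ χx χy η ηx ηy : L2} {K H D : ℝ}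
    (hst : IsStep ν τ f V W ψx ψy) (hV : IsStream V ψ ψx ψy) (hv : IsStream v χ χx χy)
    (hw : IsStream w η ηx ηy) (hτ : 0 < τ) (hv1 : InSob 1 v) (hvH : √(sob 1 v) ≤ H)
    (hw1 : InSob 1 w) (hwH : √(sob 1 w) ≤ H) (hD : ‖w - v‖ ≤ D)
    (hT : ∀ S z, 0 ∉ S → |pair v (trig S z) - pair w (trig S z)
      - rate ν f w ηx ηy S z * (-τ)| ≤ K * √(sobFin 4 S z) * (-τ) ^ 2) (N : ℕ) :
    pair (W - w) (trig (box N) (coeff (W - w))) - pair (V - v) (trig (box N) (coeff (W - w)))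
        + ν * τ * sobFin 4 (box N) (coeff (W - w))
      ≤ τ * transport (V - v) ψx ψy (trig (box N) (coeff (W - w)))
        + τ * ((transportConst * H * (‖V - v‖ + 2 * D) + K * τ)
          * √(sobFin 4 (box N) (coeff (W - w)))) := by
  have hC := transportConst_nonneg
  have hS := zero_notMem_box N
  set z := coeff (W - w) with hz
  have h1 := hst (box N) z hS
  have h2 := (abs_le.1 (hT (box N) z hS)).2
  have h3 := pair_lap_trig_coeff (W - w) hS
  rw [lap_trig hS, pair_sub_trig, ← lap_trig hS, ← hz] at h3
  -- Writing `T(a, b)` for transport of `a` by the velocity of `b`: `T(V,V) - T(w,w) = T(V-v, V) +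
  -- T(v, V-v) - T(v, w-v) - T(w-v, w)`. The first term is left to the energy method; in the others
  -- an `H^{1/4}` bound on the exact solution is available.
  have t1 := (abs_le.1 (abs_transport_le_sob_left (hV.sub hv) (box N) z hv1)).2
  have t2 := (abs_le.1 (abs_transport_le_sob_left (hw.sub hv) (box N) z hv1)).1
  have t3 := (abs_le.1 (abs_transport_le_sob_right (a := w - v) hw (box N) z hw1)).1
  rw [transport_sub_right] at t1 t2
  rw [transport_sub_left] at t3
  rw [transport_sub_left, pair_sub_trig, pair_sub_trig]
  rw [rate] at h2
  set x := √(sobFin 4 (box N) z)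
  have hx0 : 0 ≤ x := Real.sqrt_nonneg _
  have b1 : transportConst * √(sob 1 v) * ‖V - v‖ * x ≤ transportConst * H * ‖V - v‖ * x := by
    gcongr
  have hH0 : 0 ≤ H := (Real.sqrt_nonneg _).trans hvH
  have b2 : transportConst * √(sob 1 v) * ‖w - v‖ * x ≤ transportConst * H * D * x := by gcongr
  have b3 : transportConst * ‖w - v‖ * √(sob 1 w) * x ≤ transportConst * D * H * x := by
    have hD0 : 0 ≤ D := (norm_nonneg _).trans hD
    gcongr
  have c1 := mul_le_mul_of_nonneg_left (t1.trans b1) hτ.le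
  have c2 := mul_le_mul_of_nonneg_left ((neg_le_neg b2).trans t2) hτ.le
  have c3 := mul_le_mul_of_nonneg_left ((neg_le_neg b3).trans t3) hτ.le
  have h4 : τ * (ν * (pair W (lap (trig (box N) z)) - pair w (lap (trig (box N) z))))
      = τ * (ν * -sobFin 4 (box N) z) := by rw [h3]
  linarith

/-- Growth rate of the error. -/
noncomputable def growthConst (B M ν : ℝ) : ℝ := 3 * (transportConst * attrConst B M ν) ^ 2 / ν

/-- Size of the consistency error. -/
noncomputable def consistConst (B M ν : ℝ) : ℝ :=
  (12 * (transportConst * attrConst B M ν) ^ 2 * incrConst B M ν + 3 * accelConst M ^ 2) / ν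

/-- Time steps below this bound are covered by the energy method. -/
noncomputable def smallStep (B ν : ℝ) : ℝ := min (1 / ν) (ν / (16 * stepConst B ν ^ 2 + 1))

/-- The constant in the error estimate. -/
noncomputable def errorConst (B M ν : ℝ) : ℝ :=
  consistConst B M ν * Real.exp (growthConst B M ν) + 4 * B ^ 2 / smallStep B ν

theorem smallStep_pos (B : ℝ) {ν : ℝ} (hν : 0 < ν) : 0 < smallStep B ν :=
  lt_min (by positivity) (by positivity)

/-- This removes `‖f‖` from the constants, so that the final one depends on `M₀`, `M_V` and `ν`
only. -/
theorem norm_forcing_le (a F : ℝ) {ν : ℝ} (hν : 0 < ν) : F ≤ ν * M0 a ν F := by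
  refine le_of_pow_le_pow_left₀ two_ne_zero (by have := M0_nonneg a ν F; positivity) ?_
  rw [mul_pow, M0_sq]
  have e : ν ^ 2 * (a ^ 2 + 2 / ν ^ 2 * F ^ 2) = (ν * a) ^ 2 + 2 * F ^ 2 := by field_simp
  rw [e]
  nlinarith [sq_nonneg (ν * a), sq_nonneg F]

theorem error_estimate {ν τ : ℝ} {f : L2} {A : Set L2} {ω : ℝ → L2} {W : ℕ → L2} (hν : 0 < ν)
    (hτ : 0 < τ) (hA : IsGlobalAttractor ν f A) (hω : IsNSESolution ν f ω) (hω0 : ω 0 ∈ A)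
    (hMV : MV ν f A < ⊤) (hW : IsSchemeSolution ν f τ W) (hW0 : W 0 = ω 0) {B : ℝ}
    (hf : ‖f‖ ≤ ν * B) (hWB : ∀ n, ‖W n‖ ≤ B) (n : ℕ) (hn : n * τ ≤ 1) :
    ‖W n - ω (n * τ)‖ ^ 2 ≤ τ * errorConst B (MV ν f A).toReal ν := by
  set M := (MV ν f A).toReal
  have hB0 : 0 ≤ B := (norm_nonneg _).trans (hWB 0)
  have hmem : ∀ t, 0 ≤ t → ω t ∈ A := fun t ht => hA.maps_into ω hω hω0 t ht
  have hAB : ∀ a ∈ A, ‖a‖ ≤ B := fun a ha =>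
    (norm_le_of_mem hν hA hMV ha).trans ((div_le_iff₀ hν).2 (by linarith))
  have hωB : ∀ t, 0 ≤ t → ‖ω t‖ ≤ B := fun t ht => hAB _ (hmem t ht)
  set H := attrConst B M ν with hH
  have hK1 := velConst_nonneg hB0 M
  have hK2 : 0 ≤ accelConst M := Real.sqrt_nonneg _
  have hC := transportConst_nonneg
  have hH0 : 0 ≤ H := regConst_nonneg hν hK1 (by positivity) hB0
  have hreg : ∀ t, 0 ≤ t → InSob 4 (ω t) ∧ sob 4 (ω t) ≤ H ^ 2 := fun t ht =>
    sob_four_le_of_mem hν hA hMV hf hAB (hmem t ht)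
  have hI0 : 0 ≤ incrConst B M ν := by rw [incrConst, ← hH]; positivity
  have hβ0 : 0 ≤ consistConst B M ν := by rw [consistConst]; positivity
  have hα0 : 0 ≤ growthConst B M ν := by rw [growthConst]; positivity
  have hk := smallStep_pos B hν
  rcases le_or_gt τ (smallStep B ν) with hsmall | hlarge
  swap
  -- A time step bounded below makes the trivial bound `4 B²` already of order `τ`; the scheme's
  -- stability here is a hypothesis.
  · have h1 : ‖W n - ω (n * τ)‖ ≤ 2 * B :=
      (norm_sub_le _ _).trans (by linarith [hWB n, hωB (n * τ) (by positivity)])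
    have h2 : ‖W n - ω (n * τ)‖ ^ 2 ≤ 4 * B ^ 2 :=
      (pow_le_pow_left₀ (norm_nonneg _) h1 2).trans_eq (by ring)
    have h3 : 4 * B ^ 2 ≤ τ * (4 * B ^ 2 / smallStep B ν) := by
      rw [← mul_div_assoc, le_div_iff₀ hk, mul_comm]
      gcongr
    have h4 : 0 ≤ τ * (consistConst B M ν * Real.exp (growthConst B M ν)) := by positivity
    rw [errorConst]
    linarith
  have hντ : ν * τ ≤ 1 := by
    have := hsmall.trans (min_le_left _ _)
    rw [le_div_iff₀ hν] at this
    linarith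
  have hstepsmall : 16 * τ * stepConst B ν ^ 2 ≤ ν := by
    have := hsmall.trans (min_le_right _ _)
    rw [le_div_iff₀ (by positivity)] at this
    linarith
  obtain ⟨χ, χx, χy, hs, hT⟩ := exists_stream_taylor hMV hω hω0
  set e : ℕ → L2 := fun n => W n - ω (n * τ) with he
  have hregW := hW.inSob hν hτ (hW0 ▸ (hreg 0 le_rfl).1)
  have hrege : ∀ n, InSob 4 (e n) := fun n => (hregW n).sub (hreg _ (by positivity)).1
  have he0 : ∀ n, coeff (e n) 0 = 0 := fun n => by
    rw [he]
    simp only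
    rw [coeff_sub, (hW.meanZero n).coeff_zero, (hω.meanZero _ (by positivity)).coeff_zero, sub_zero]
  have hsqrt : ∀ t, 0 ≤ t → √(sob 1 (ω t)) ≤ H := fun t ht =>
    (Real.sqrt_le_left hH0).2 (((hreg t ht).1.sob_mono (by norm_num)).trans (hreg t ht).2)
  set D := √(incrConst B M ν * τ) with hDdef
  have hD2 : D ^ 2 = incrConst B M ν * τ := Real.sq_sqrt (by positivity)
  have hstep : ∀ n : ℕ, τ ≤ 1 → stepEnergy (ν * τ) (e (n + 1))
      ≤ (1 + growthConst B M ν * τ) * stepEnergy (ν * τ) (e n) + consistConst B M ν * τ ^ 2 := by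
    intro n hτ1
    obtain ⟨ψ, ψx, ψy, hV, hst⟩ := hW.exists_isStep hτ n
    have ht0 : 0 ≤ n * τ := by positivity
    have ht1 : ((n + 1 : ℕ) : ℝ) * τ = n * τ + τ := by push_cast; ring
    have hd : ‖ω (n * τ + τ) - ω (n * τ)‖ ≤ D := by
      refine Real.le_sqrt_of_sq_le ?_
      exact norm_sub_sq_le hB0 hωB hω.meanZero hH0 hreg hT ht0 hτ hτ1
    have hT' : ∀ S z, 0 ∉ S → |pair (ω (n * τ)) (trig S z) - pair (ω (n * τ + τ)) (trig S z)
        - rate ν f (ω (n * τ + τ)) (χx (n * τ + τ)) (χy (n * τ + τ)) S z * (-τ)|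
        ≤ accelConst M * √(sobFin 4 S z) * (-τ) ^ 2 := by
      intro S z hS
      have := hT S z hS (n * τ + τ) (by positivity) (n * τ) ht0
      rwa [show n * τ - (n * τ + τ) = -τ by ring] at this
    -- The error is advected by the velocity of the numerical state `W n`, so the smallness
    -- condition involves only `B`.
    have h1 := stepEnergy_le (V := e n) (W := e (n + 1)) ((hrege n).mono (by norm_num)) (he0 n)
      (hrege (n + 1)) (he0 (n + 1)) hV hν hτ hντ (hWB n) hstepsmall
      (L := transportConst * H * (‖e n‖ + 2 * D) + accelConst M * τ) (fun N => by
        have h2 := error_step hst hV (hs (n * τ) ht0) (hs (n * τ + τ) (by positivity)) hτ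
          ((hreg _ ht0).1.mono (by norm_num)) (hsqrt _ ht0)
          ((hreg _ (by positivity)).1.mono (by norm_num)) (hsqrt _ (by positivity)) hd hT' N
        rw [← ht1] at h2
        exact h2)
    have h3 : (transportConst * H * (‖e n‖ + 2 * D) + accelConst M * τ) ^ 2
        ≤ 3 * (transportConst * H) ^ 2 * ‖e n‖ ^ 2 + 12 * (transportConst * H) ^ 2 * D ^ 2
          + 3 * accelConst M ^ 2 * τ ^ 2 := by
      nlinarith [sq_nonneg (transportConst * H * ‖e n‖ - transportConst * H * (2 * D)),
        sq_nonneg (transportConst * H * ‖e n‖ - accelConst M * τ),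
        sq_nonneg (transportConst * H * (2 * D) - accelConst M * τ)]
    have h4 : 3 * accelConst M ^ 2 * τ ^ 2 ≤ 3 * accelConst M ^ 2 * τ := by
      have : τ ^ 2 ≤ τ := by nlinarith
      gcongr
    rw [hD2] at h3
    have h5 : (transportConst * H * (‖e n‖ + 2 * D) + accelConst M * τ) ^ 2 / ν
        ≤ growthConst B M ν * ‖e n‖ ^ 2 + consistConst B M ν * τ := by
      rw [div_le_iff₀ hν]
      have : (growthConst B M ν * ‖e n‖ ^ 2 + consistConst B M ν * τ) * ν
          = 3 * (transportConst * H) ^ 2 * ‖e n‖ ^ 2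
            + (12 * (transportConst * H) ^ 2 * incrConst B M ν + 3 * accelConst M ^ 2) * τ := by
        rw [growthConst, consistConst, ← hH]; field_simp
      rw [this]
      linarith
    have h6 := norm_sq_le_stepEnergy (by positivity : 0 ≤ ν * τ) (e n)
    have h7 := norm_sq_le_stepEnergy (by positivity : 0 ≤ ν * τ) (e (n + 1))
    have h8 : 0 ≤ stepEnergy (ν * τ) (e (n + 1)) * (ν * τ / 2) := by
      have := (sq_nonneg _).trans h7
      positivity
    have h9 : τ * ((transportConst * H * (‖e n‖ + 2 * D) + accelConst M * τ) ^ 2 / ν)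
        ≤ τ * (growthConst B M ν * stepEnergy (ν * τ) (e n) + consistConst B M ν * τ) := by
      gcongr
      refine h5.trans ?_
      gcongr
    linarith
  -- Discrete Gronwall inequality, started from zero error.
  have hgr : ∀ n : ℕ, n * τ ≤ 1 → stepEnergy (ν * τ) (e n)
      ≤ n * (consistConst B M ν * τ ^ 2) * (1 + growthConst B M ν * τ) ^ n := by
    intro n
    induction n with
    | zero =>
      intro _
      have : e 0 = 0 := by simp [he, hW0]
      rw [this]
      have hz : sob 2 (0 : L2) = 0 := by
        have hc : ∀ k, coeff (0 : L2) k = 0 := fun k => by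
          have := coeff_sub (0 : L2) 0 k
          simpa using this
        simp [sob, hc]
      simp [stepEnergy, hz]
    | succ n ih =>
      intro hn1
      push_cast at hn1 ⊢
      have h0 : (0 : ℝ) ≤ n * τ := by positivity
      have ih' := ih (by linarith)
      have h1 := hstep n (by linarith)
      have hq : 1 ≤ 1 + growthConst B M ν * τ := by
        have : 0 ≤ growthConst B M ν * τ := by positivity
        linarith
      set q := 1 + growthConst B M ν * τ
      have h2 : q * stepEnergy (ν * τ) (e n)
          ≤ q * (n * (consistConst B M ν * τ ^ 2) * q ^ n) := by gcongr
      have h3 : consistConst B M ν * τ ^ 2 ≤ consistConst B M ν * τ ^ 2 * q ^ (n + 1) :=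
        le_mul_of_one_le_right (by positivity) (one_le_pow₀ hq)
      calc stepEnergy (ν * τ) (e (n + 1))
          ≤ q * (n * (consistConst B M ν * τ ^ 2) * q ^ n)
            + consistConst B M ν * τ ^ 2 * q ^ (n + 1) := by linarith
        _ = _ := by ring
  have h1 := (norm_sq_le_stepEnergy (by positivity : 0 ≤ ν * τ) (e n)).trans (hgr n hn)
  have h2 : (1 + growthConst B M ν * τ) ^ n ≤ Real.exp (growthConst B M ν) := by
    calc (1 + growthConst B M ν * τ) ^ n ≤ Real.exp (growthConst B M ν * τ) ^ n := by
          gcongr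
          linarith [Real.add_one_le_exp (growthConst B M ν * τ)]
      _ = Real.exp (n * (growthConst B M ν * τ)) := by rw [← Real.exp_nat_mul]
      _ ≤ _ := by
          refine Real.exp_le_exp.2 ?_
          calc n * (growthConst B M ν * τ) = growthConst B M ν * (n * τ) := by ring
            _ ≤ growthConst B M ν * 1 := by gcongr
            _ = _ := mul_one _
  have h3 : n * (consistConst B M ν * τ ^ 2) * (1 + growthConst B M ν * τ) ^ n
      ≤ (τ * consistConst B M ν) * Real.exp (growthConst B M ν) := by
    refine mul_le_mul ?_ h2 (by positivity) (by positivity)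
    calc n * (consistConst B M ν * τ ^ 2) = (τ * consistConst B M ν) * (n * τ) := by ring
      _ ≤ (τ * consistConst B M ν) * 1 := by gcongr
      _ = _ := mul_one _
  have h4 : 0 ≤ τ * (4 * B ^ 2 / smallStep B ν) := by positivity
  rw [errorConst]
  have h5 : ‖e n‖ ^ 2 ≤ τ * consistConst B M ν * Real.exp (growthConst B M ν) := h1.trans h3
  calc ‖W n - ω (n * τ)‖ ^ 2 = ‖e n‖ ^ 2 := rfl
    _ ≤ _ := by linarith

end NSE2D


/-! ### Conclusion: uniform stability and the error estimate -/

theorem lemma2p8 :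
    ∃ k₀ C : ℝ → ℝ → ℝ → ℝ, (∀ a ν F : ℝ, 0 < ν → 0 < k₀ a ν F) ∧
      ∀ (ν : ℝ) (f : NSE2D.L2) (A : Set NSE2D.L2) (ω₀ : NSE2D.L2) (ω : ℝ → NSE2D.L2),
        0 < ν → NSE2D.MeanZero f → NSE2D.IsGlobalAttractor ν f A → ω₀ ∈ A →
        NSE2D.IsNSESolution ν f ω → ω 0 = ω₀ →
        NSE2D.MV ν f A < ⊤ →
        ∀ (Δt : ℝ) (W : ℕ → NSE2D.L2), 0 < Δt →
          NSE2D.IsSchemeSolution ν f Δt W → W 0 = ω₀ →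
          (Δt < k₀ ‖ω₀‖ ν ‖f‖ → ∀ n, ‖W n‖ ≤ NSE2D.M0 ‖ω₀‖ ν ‖f‖) ∧
          ((Δt < k₀ ‖ω₀‖ ν ‖f‖ ∨ ∀ n, ‖W n‖ ≤ NSE2D.M0 ‖ω₀‖ ν ‖f‖) →
            ∀ n : ℕ, (n : ℝ) * Δt ≤ 1 →
              ‖W n - ω (n * Δt)‖ ^ 2 ≤
                Δt * C (NSE2D.M0 ‖ω₀‖ ν ‖f‖) (NSE2D.MV ν f A).toReal ν) := by
  refine ⟨NSE2D.maxStep, NSE2D.errorConst, fun a ν F hν => NSE2D.maxStep_pos a F hν, ?_⟩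
  intro ν f A ω₀ ω hν _ hA hω₀ hω hω0 hMV Δt W hΔt hW hW0
  have hstable : Δt < NSE2D.maxStep ‖ω₀‖ ν ‖f‖ → ∀ n, ‖W n‖ ≤ NSE2D.M0 ‖ω₀‖ ν ‖f‖ := by
    intro hsmall n
    have hnorm : ∀ a ∈ A, ‖a‖ ≤ ‖f‖ / ν := fun a ha => NSE2D.norm_le_of_mem hν hA hMV ha
    have hreg := (NSE2D.sob_four_le_of_mem hν hA hMV le_rfl hnorm hω₀).1
    subst hW0
    exact hW.norm_le hν hΔt hreg (hnorm _ hω₀) hsmall n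
  refine ⟨hstable, fun h n hn => ?_⟩
  -- The error estimate uses the time step restriction only through this bound, so both alternatives
  -- lead to the same constant.
  have hbound : ∀ n, ‖W n‖ ≤ NSE2D.M0 ‖ω₀‖ ν ‖f‖ := h.elim hstable id
  exact NSE2D.error_estimate hν hΔt hA hω (hω0 ▸ hω₀) hMV hW (hW0.trans hω0.symm)
    (NSE2D.norm_forcing_le _ _ hν) hbound n hn
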